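/- **Theorem.** For $w\in\mathbb C$ and $\tau$ in the upper half plane put $\zeta=e^{2\pi i w}$, $q=e^{2\pi i\tau}$, $\zeta^{1/2}=e^{\pi i w}$, $q^{r}=e^{2\pi i r\tau}$ for rational $r$, and let $$\vartheta(w;\tau)=i\zeta^{\frac12}q^{\frac18}\prod_{n\ge1}(1-q^n)(1-\zeta q^n)(1-\zeta^{-1}q^{n-1}),\qquad \eta(\tau)=q^{\frac1{24}}\prod_{n\ge1}(1-q^n),$$ $$g(w;\tau)=i\,\frac{(\zeta^{\frac12}-\zeta^{-\frac12})\,\eta(\tau)^3}{\vartheta(w;\tau)},\qquad f_k(w;\tau)=\frac{g(w;\tau)^2}{\eta(\tau)^k},$$ where $k\ge 1$ is an integer. There is exactly one family of numbers $a_{m,k}(n)$ ($m\in\mathbb Z$, $n\in\mathbb Z_{\ge0}$) such that $$f_k(w;\tau)=\sum_{m\in\mathbb Z,\;n\ge0}a_{m,k}(n)\,\zeta^m q^{\,n-\frac k{24}}$$ with absolute convergence for all $w,\tau$ with $|q|<|\zeta|<|q|^{-1}$ and $\zeta\ne1$ (at $\zeta=1$ the function $g$ has a removable singularity). For $m\in\mathbb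 Z$ and $\operatorname{Re} z>0$ let $$g_{m,1}(z)=\frac{8\pi^2}{z^2}\int_0^{\frac12}\frac{\sin(\pi w)^2}{\sinh\left(\frac{2\pi^2w}{z}\right)^2}\,e^{\frac{4\pi^2w^2}{z}}\cos(2\pi m w)\,dw ,$$ and let $d_{m,k}(\ell)$ be the coefficient of $z^\ell$ in the formal power series $$e^{-\frac{kz}{24}}\cdot 2\sum_{\ell_1\ge1,\;\ell_2\ge0,\;j\ge0}\frac{(-1)^j\,m^{2\ell_2}\,B_{2(\ell_1+\ell_2+j)}}{(2\ell_1)!\,(2\ell_2)!\,j!}\,z^{2(\ell_1+\ell_2)+j-1},$$ where $B_r$ are the Bernoulli numbers. Let $I_\nu$ be the $I$-Bessel function, for $x>0$ $$I_\nu(x)=\frac{(x/2)^\nu}{2\pi i}\int_{-\infty}^{(0+)}t^{-\nu-1}\exp\left(t+\frac{x^2}{4t}\right)dt ,$$ the integral being along any counterclockwise loop from $-\infty$ around $0$ back to $-\infty$. Then for every fixed $m\in\mathbb Z$ and every integer $N\ge 0$: 1. The $d_{m,k}(\ell)$ are the Taylor coefficients of $e^{-kz/24}g_{m,1}(z)$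 at $0$, in the sense that $$e^{-\frac{kz}{24}}g_{m,1}(z)=\sum_{\ell=1}^N d_{m,k}(\ell)\,z^\ell+O\left(z^{N+1}\right)$$ as $z\to0$ in any fixed sector $\operatorname{Re} z>0$, $|\operatorname{Im} z|\le M\operatorname{Re} z$. 2. As $n\to\infty$, $$a_{m,k}(n)=(2\pi)^{-\frac k2}\sum_{\ell=1}^N d_{m,k}(\ell)\,n^{-\frac{2+2\ell+k}4}\left(\pi\sqrt{\tfrac k6}\right)^{1+\ell+\frac k2} I_{-1-\ell-\frac k2}\left(\pi\sqrt{\tfrac{2kn}3}\right)+O\left(n^{-1-\frac N2-\frac k4}\,e^{\pi\sqrt{\frac{2kn}3}}\right),$$ where the implied constant depends only on $m$, $k$, $N$. -/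

import Mathlib

namespace ChiGenus

open Complex MeasureTheory

noncomputable section

/-- The Jacobi theta function
`ϑ(w;τ) = i ζ^{1/2} q^{1/8} ∏_{n ≥ 1} (1 - q^n) (1 - ζ q^n) (1 - ζ⁻¹ q^{n-1})`,
with `ζ = e^{2πiw}`, `q = e^{2πiτ}`, `ζ^{1/2} = e^{πiw}`, `q^{1/8} = e^{2πiτ/8}`. -/
def theta (w τ : ℂ) : ℂ :=
  I * exp (Real.pi * I * w) * exp (2 * Real.pi * I * τ / 8) *
    ∏' n : ℕ, ((1 - exp (2 * Real.pi * I * τ) ^ (n + 1)) *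
      (1 - exp (2 * Real.pi * I * w) * exp (2 * Real.pi * I * τ) ^ (n + 1)) *
      (1 - (exp (2 * Real.pi * I * w))⁻¹ * exp (2 * Real.pi * I * τ) ^ n))

/-- `g(w;τ) = i (ζ^{1/2} - ζ^{-1/2}) η(τ)^3 / ϑ(w;τ)`. -/
def g (w τ : ℂ) : ℂ :=
  I * ((exp (Real.pi * I * w) - exp (-(Real.pi * I * w))) * ModularForm.eta τ ^ 3) / theta w τ

/-- `f_k(w;τ) = g(w;τ)^2 / η(τ)^k`. -/
def f (k : ℕ) (w τ : ℂ) : ℂ := g w τ ^ 2 / ModularForm.eta τ ^ k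

/-- `a m n` are the coefficients of `f_k`:
`f_k(w;τ) = ∑_{m ∈ ℤ, n ≥ 0} a m n ζ^m q^{n - k/24}` (absolutely convergent) for `τ` in the upper
half plane and `|q| < |ζ| < |q|⁻¹`. The points with `ζ = 1` are left out: there the quotient that
defines `g` has the form `0 / 0` (a removable singularity). -/
def IsCoeffs (k : ℕ) (a : ℤ → ℕ → ℂ) : Prop :=
  ∀ τ w : ℂ, 0 < τ.im → |w.im| < τ.im → exp (2 * Real.pi * I * w) ≠ 1 →
    HasSum
      (fun p : ℤ × ℕ => a p.1 p.2 * exp (2 * Real.pi * I * w) ^ p.1 *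
        exp (2 * Real.pi * I * τ * ((p.2 : ℂ) - (k : ℂ) / 24)))
      (f k w τ)

/-- The function `g_{m,1}(z) =
(8π²/z²) ∫_0^{1/2} sin(πw)² / sinh(2π²w/z)² · e^{4π²w²/z} cos(2πmw) dw`. -/
def gMain (m : ℤ) (z : ℂ) : ℂ :=
  8 * (Real.pi : ℂ) ^ 2 / z ^ 2 *
    ∫ w in (0 : ℝ)..(1 / 2), sin (Real.pi * w) ^ 2 / sinh (2 * (Real.pi : ℂ) ^ 2 * w / z) ^ 2 *
      exp (4 * (Real.pi : ℂ) ^ 2 * (w : ℂ) ^ 2 / z) * cos (2 * Real.pi * m * w)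

/-- The coefficient of `z^r` in the formal series
`2 ∑_{l₁ ≥ 1, l₂ ≥ 0, j ≥ 0} (-1)^j m^{2 l₂} B_{2(l₁+l₂+j)} / ((2l₁)! (2l₂)! j!) z^{2(l₁+l₂)+j-1}`.
The constraint `2 (l₁ + l₂) + j = r + 1` with `l₁ ≥ 1` forces `l₁, l₂, j ≤ r`. -/
def gMainCoeff (m : ℤ) (r : ℕ) : ℝ :=
  2 * ∑ l₁ ∈ Finset.Icc 1 r, ∑ l₂ ∈ Finset.range (r + 1), ∑ j ∈ Finset.range (r + 1),
    if 2 * (l₁ + l₂) + j = r + 1 then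
      (-1 : ℝ) ^ j * (m : ℝ) ^ (2 * l₂) /
        ((Nat.factorial (2 * l₁) : ℝ) * (Nat.factorial (2 * l₂) : ℝ) * (Nat.factorial j : ℝ)) *
        ((bernoulli (2 * (l₁ + l₂ + j)) : ℚ) : ℝ)
    else 0

/-- `d_{m,k}(ℓ)`: the coefficient of `z^ℓ` in the product of the series of `e^{-kz/24}` with the
formal series of `gMainCoeff m`. -/
def d (m : ℤ) (k ℓ : ℕ) : ℝ :=
  ∑ p ∈ Finset.HasAntidiagonal.antidiagonal ℓ,
    gMainCoeff m p.1 * ((-((k : ℝ) / 24)) ^ p.2 / (Nat.factorial p.2 : ℝ))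

/-- Integral of `F` along the counterclockwise loop from `-∞` around `0` back to `-∞` that runs
along `Im t = -r` to `r - ir`, up to `r + ir`, and back along `Im t = r`. -/
def loopIntegral (r : ℝ) (F : ℂ → ℂ) : ℂ :=
  (∫ s in Set.Iic r, F ((s : ℂ) - r * I)) + I * (∫ y in (-r)..r, F ((r : ℂ) + y * I)) -
    ∫ s in Set.Iic r, F ((s : ℂ) + r * I)

/-- The `I`-Bessel function of real order `ν` at `x > 0`:
`I_ν(x) = (x/2)^ν / (2πi) ∫_{-∞}^{(0+)} t^{-ν-1} exp(t + (x/2)²/t) dt`, principal branch of the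
power. The value does not depend on the loop; here the loop through `x/2` is taken. -/
def besselI (ν x : ℝ) : ℂ :=
  (((x / 2) ^ ν : ℝ) : ℂ) / (2 * Real.pi * I) *
    loopIntegral (x / 2) (fun t => t ^ ((-ν - 1 : ℝ) : ℂ) * exp (t + ((x / 2 : ℝ) : ℂ) ^ 2 / t))

end

end ChiGenus

/-! ### The q-Pochhammer symbol and its logarithm -/

namespace ChiGenus

open Complex MeasureTheory Filter Topology

/-! The proof is Wright's version of the circle method. Put q = e^{-z}. For |ζ| = 1 the m-th Fourier
coefficient of f_k in w, `fourierF k m z`, is the generating series of the row a_{m,k}(n), and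
Cauchy's formula (`IsCoeffs.eq_integral`) recovers a_{m,k}(n) from it by integration over Re z = η,
|Im z| ≤ π. This already gives uniqueness. Existence follows by exponentiating the logarithm of the
product, an absolutely convergent series of monomials in ζ and q (`exists_coeff_exp`). For the
asymptotics η is fixed by n η² = kπ²/6, so that η is the saddle point of n z + kπ²/(6z), with
critical value 2nη = π√(2kn/3).

Major arc, |Im z| ≤ η. The inversion τ ↦ -1/τ (`euler_sq_div_thetaProd_eq`, by Liouville's theorem,
and `exp_div_euler_pow_eq`) turns `fourierF` into (z/2π)^{k/2} e^{kπ²/(6z)} times an integral over 0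
< w ≤ 1/2. That integral is g_{m,1}(z), up to a factor in the integrand that is 1 + O(|z|^N) for
every N (`exists_dualCore_bound`). The expansion of g_{m,1} (`gMain_isBigO`) is of Watson type:
1/sinh² concentrates the integrand at w of order |z|, so sin², cos and exp may be replaced by Taylor
polynomials and the range by (0, ∞). The moments of 1/sinh² are values of ζ at even integers, hence
the Bernoulli numbers (`integral_pow_div_sinh_sq`).

Integrating z^{ℓ+k/2} e^{nz+kπ²/(6z)} over the major arc gives, after t = nz, the vertical edge of
the loop that defines I_{-1-ℓ-k/2} at 2nη. The horizontal edges contribute only O(e^{7nη/4}),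
against a main size e^{2nη} (`exists_besselI_sub_besselVertical_le`).

Minor arcs, η ≤ |Im z| ≤ π. The Lambert series of the inverse Euler product lowers the constant π²/6
in the exponent by 1/10 (`norm_inv_euler_le`). This saving survives because g grows only
polynomially in 1/(1-|q|), uniformly on |ζ| = 1. That bound comes from a partial fraction expansion
in ζ + ζ⁻¹ with coefficients (-1)^j q^{j(j+1)/2} (1 + q^{j+1}) (`euler_sq_div_thetaProd_eq_tsum`).

The error η^{N+1+k/2} e^{2nη} on an arc of length 2η, with η of order n^{-1/2}, is the stated one.
-/

/-- The infinite `q`-Pochhammer symbol `(x; q)_∞ = ∏_{n ≥ 0} (1 - x q^n)`. -/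
noncomputable def qPoch (x q : ℂ) : ℂ := ∏' n : ℕ, (1 - x * q ^ n)

lemma summable_norm_mul_pow (x : ℂ) {q : ℂ} (hq : ‖q‖ < 1) :
    Summable fun n : ℕ => ‖-(x * q ^ n)‖ := by
  simpa using (summable_geometric_of_lt_one (norm_nonneg q) hq).mul_left ‖x‖

lemma multipliable_qPoch (x : ℂ) {q : ℂ} (hq : ‖q‖ < 1) :
    Multipliable fun n : ℕ => 1 - x * q ^ n := by
  simpa [sub_eq_add_neg] using multipliable_one_add_of_summable (summable_norm_mul_pow x hq)

lemma qPoch_eq_mul (x : ℂ) {q : ℂ} (hq : ‖q‖ < 1) :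
    qPoch x q = (1 - x) * qPoch (x * q) q := by
  have hfun : (fun n : ℕ => 1 - x * q * q ^ n) = fun n : ℕ => 1 - x * q ^ (n + 1) := by
    funext n
    rw [pow_succ']
    ring
  have h := multipliable_qPoch (x * q) hq
  rw [hfun] at h
  rw [qPoch, tprod_eq_zero_mul' (f := fun n : ℕ => 1 - x * q ^ n) h, qPoch, hfun, pow_zero, mul_one]

lemma qPoch_ne_zero {x q : ℂ} (hq : ‖q‖ < 1) (h : ∀ n : ℕ, x * q ^ n ≠ 1) :
    qPoch x q ≠ 0 := by
  have := tprod_one_add_ne_zero_of_summable (f := fun n : ℕ => -(x * q ^ n))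
    (fun n => by simpa [← sub_eq_add_neg, sub_eq_zero] using (h n).symm)
    (summable_norm_mul_pow x hq)
  simpa [qPoch, sub_eq_add_neg] using this

lemma qPoch_ne_zero_of_norm_lt {x q : ℂ} (hq : ‖q‖ < 1) (hx : ‖x‖ < 1) : qPoch x q ≠ 0 := by
  refine qPoch_ne_zero hq fun n h => ?_
  have h1 : ‖x * q ^ n‖ < 1 := by
    rw [norm_mul, norm_pow]
    exact mul_lt_one_of_nonneg_of_lt_one_left (norm_nonneg _) hx
      (pow_le_one₀ (norm_nonneg _) hq.le)
  rw [h] at h1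
  simp at h1

/-- The product converges locally uniformly: on a ball around 0 that contains x₀ the factors are
dominated by a geometric series. -/
lemma differentiable_qPoch {q : ℂ} (hq : ‖q‖ < 1) : Differentiable ℂ fun x => qPoch x q := by
  intro x₀
  have hx₀ : x₀ ∈ Metric.ball (0 : ℂ) (‖x₀‖ + 1) := by simp
  have hsum : Summable fun n : ℕ => (‖x₀‖ + 1) * ‖q‖ ^ n :=
    (summable_geometric_of_lt_one (norm_nonneg q) hq).mul_left _
  have h := hsum.hasProdLocallyUniformlyOn_nat_one_add
    (f := fun (n : ℕ) (x : ℂ) => -(x * q ^ n)) (K := Metric.ball (0 : ℂ) (‖x₀‖ + 1))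
    Metric.isOpen_ball (.of_forall fun n x hx => by
      rw [norm_neg, norm_mul, norm_pow]
      have : ‖x‖ ≤ ‖x₀‖ + 1 := by simpa using (Metric.mem_ball.1 hx).le
      gcongr) (fun n => by fun_prop)
  have hd := h.differentiableOn (.of_forall fun s => by
    simpa [Finset.prod_fn] using DifferentiableOn.finsetProd (fun _ _ => by fun_prop))
    Metric.isOpen_ball
  have := hd.differentiableAt (Metric.isOpen_ball.mem_nhds hx₀)
  simpa [qPoch, sub_eq_add_neg] using this

/-- The terms of the double series of `-log (x; q)_∞`. -/
noncomputable def logTerm (x q : ℂ) (p : ℕ × ℕ) : ℂ :=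
  (x * q ^ p.1) ^ (p.2 + 1) / ((p.2 : ℂ) + 1)

/-- Since |q| ≤ 1, lowering the exponent n(r+1) of |q| to n and dropping the denominator decouples
the two indices, so the majorant is a product of two geometric series. -/
lemma norm_logTerm_le {x q : ℂ} (hq : ‖q‖ < 1) (p : ℕ × ℕ) :
    ‖logTerm x q p‖ ≤ ‖q‖ ^ p.1 * ‖x‖ ^ (p.2 + 1) := by
  have h1 : (1 : ℝ) ≤ ‖((p.2 : ℂ) + 1)‖ := by
    have : ((p.2 : ℂ) + 1) = ((p.2 + 1 : ℕ) : ℂ) := by push_cast; ring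
    rw [this, Complex.norm_natCast]
    exact_mod_cast Nat.succ_le_succ (Nat.zero_le _)
  rw [logTerm, norm_div, norm_pow, norm_mul, norm_pow, mul_pow, ← pow_mul]
  refine (div_le_self (by positivity) h1).trans ?_
  rw [mul_comm]
  gcongr ?_ * _
  exact pow_le_pow_of_le_one (norm_nonneg _) hq.le (Nat.le_mul_of_pos_right _ (Nat.succ_pos _))

lemma summable_logTerm_bound {s t : ℝ} (hs : 0 ≤ s) (hs1 : s < 1) (ht : 0 ≤ t) (ht1 : t < 1) :
    HasSum (fun p : ℕ × ℕ => s ^ p.1 * t ^ (p.2 + 1)) ((1 - s)⁻¹ * (t * (1 - t)⁻¹)) := by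
  have h1 := hasSum_geometric_of_lt_one hs hs1
  have h2 : HasSum (fun n : ℕ => t ^ (n + 1)) (t * (1 - t)⁻¹) := by
    simpa only [pow_succ'] using (hasSum_geometric_of_lt_one ht ht1).mul_left t
  have h3 : Summable fun p : ℕ × ℕ => s ^ p.1 * t ^ (p.2 + 1) :=
    Summable.mul_of_nonneg (f := fun n : ℕ => s ^ n) (g := fun n : ℕ => t ^ (n + 1))
      h1.summable h2.summable (fun n => pow_nonneg hs n) (fun n => pow_nonneg ht (n + 1))
  exact HasSum.mul (f := fun n : ℕ => s ^ n) (g := fun n : ℕ => t ^ (n + 1)) h1 h2 h3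

lemma summable_norm_logTerm {x q : ℂ} (hq : ‖q‖ < 1) (hx : ‖x‖ < 1) :
    Summable fun p => ‖logTerm x q p‖ :=
  Summable.of_nonneg_of_le (fun _ => norm_nonneg _) (norm_logTerm_le hq)
    (summable_logTerm_bound (norm_nonneg _) hq (norm_nonneg _) hx).summable

lemma norm_tsum_logTerm_le {x q : ℂ} (hq : ‖q‖ < 1) (hx : ‖x‖ < 1) :
    ‖∑' p, logTerm x q p‖ ≤ (1 - ‖q‖)⁻¹ * (‖x‖ * (1 - ‖x‖)⁻¹) :=
  tsum_of_norm_bounded (summable_logTerm_bound (norm_nonneg _) hq (norm_nonneg _) hx)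
    (norm_logTerm_le hq)

/-- Summing over the second index first gives -log (1 - x qⁿ), with the principal logarithm because
|x qⁿ| < 1; the exponential of the sum of logarithms is the product. -/
lemma qPoch_eq_exp {x q : ℂ} (hq : ‖q‖ < 1) (hx : ‖x‖ < 1) :
    qPoch x q = exp (-∑' p, logTerm x q p) := by
  have hlt (n : ℕ) : ‖x * q ^ n‖ < 1 := by
    rw [norm_mul, norm_pow]
    exact mul_lt_one_of_nonneg_of_lt_one_left (norm_nonneg _) hx
      (pow_le_one₀ (norm_nonneg _) hq.le)
  have hs := (summable_norm_logTerm hq hx).of_norm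
  have hinner (n : ℕ) : ∑' r, logTerm x q (n, r) = -log (1 - x * q ^ n) :=
    (hasSum_taylorSeries_neg_log' (hlt n)).tsum_eq
  have hsum : Summable fun n : ℕ => log (1 - x * q ^ n) := by
    simpa [sub_eq_add_neg] using
      summable_log_one_add_of_summable (summable_norm_mul_pow x hq).of_norm
  rw [hs.tsum_prod]
  simp_rw [hinner]
  rw [tsum_neg, neg_neg, cexp_tsum_eq_tprod (fun n => ?_) hsum, qPoch]
  rw [sub_ne_zero]
  intro h
  have := hlt n
  rw [← h] at this
  simp at this

end ChiGenus

/-! ### Exponentials of absolutely convergent series -/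

namespace ChiGenus

open Complex MeasureTheory Filter Topology

section ExpSeries

variable {ι R : Type*} [NormedField R] [CompleteSpace R]

/-- Repeated Cauchy products, one index split off at a time. The field is left general because the
lemma is applied both to the complex series and to the real series of its norms. -/
lemma hasSum_prod_fin {x : ι → R} (hx : Summable fun i => ‖x i‖) (s : ℕ) :
    (Summable fun v : Fin s → ι => ‖∏ j, x (v j)‖) ∧
      HasSum (fun v : Fin s → ι => ∏ j, x (v j)) ((∑' i, x i) ^ s) := by
  induction s with
  | zero =>
    refine ⟨Summable.of_finite, ?_⟩
    simp [hasSum_unique]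
  | succ s ih =>
    obtain ⟨h1, h2⟩ := ih
    let e : (ι × (Fin s → ι)) ≃ (Fin (s + 1) → ι) := Fin.consEquiv (fun _ => ι)
    have hval (p : ι × (Fin s → ι)) :
        ∏ j, x (e p j) = x p.1 * ∏ j, x (p.2 j) := by
      rw [Fin.prod_univ_succ]
      simp [e, Fin.consEquiv]
    have hs : Summable fun p : ι × (Fin s → ι) => ‖x p.1 * ∏ j, x (p.2 j)‖ :=
      Summable.mul_norm (f := x) (g := fun v : Fin s → ι => ∏ j, x (v j)) hx h1
    constructor
    · refine (e.summable_iff (f := fun v : Fin (s + 1) → ι => ‖∏ j, x (v j)‖)).1 ?_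
      simpa only [Function.comp_def, hval] using hs
    · refine (e.hasSum_iff (f := fun v : Fin (s + 1) → ι => ∏ j, x (v j))).1 ?_
      simp only [Function.comp_def, hval, pow_succ']
      exact HasSum.mul (f := x) (g := fun v : Fin s → ι => ∏ j, x (v j))
        hx.of_norm.hasSum h2 hs.of_norm

end ExpSeries

section Monomials

variable {ι : Type*}

/-- The term of `exp (∑ x i)` that belongs to a tuple of indices. -/
noncomputable def expTerm (x : ι → ℂ) (v : Σ s : ℕ, Fin s → ι) : ℂ :=
  (v.1.factorial : ℂ)⁻¹ * ∏ j, x (v.2 j)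

/-- Every power in the exponential series is expanded over tuples. The norms add up to ∑ (∑ ‖x i‖)^s
/ s!, which justifies summing over tuples of all lengths at once. -/
lemma hasSum_expTerm {x : ι → ℂ} (hx : Summable fun i => ‖x i‖) :
    HasSum (expTerm x) (exp (∑' i, x i)) := by
  have hnorm : Summable fun v => ‖expTerm x v‖ := by
    refine (summable_sigma_of_nonneg fun _ => norm_nonneg _).2 ⟨fun s => ?_, ?_⟩
    · simpa [expTerm] using (hasSum_prod_fin hx s).1.mul_left ((s.factorial : ℝ)⁻¹)
    · have hx' : Summable fun i => ‖(‖x i‖ : ℝ)‖ := by simpa using hx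
      have h (s : ℕ) : ∑' v : Fin s → ι, ‖expTerm x ⟨s, v⟩‖
          = (∑' i, ‖x i‖) ^ s / s.factorial := by
        have := (hasSum_prod_fin (R := ℝ) hx' s).2.mul_left ((s.factorial : ℝ)⁻¹)
        rw [div_eq_inv_mul, ← this.tsum_eq]
        simp [expTerm]
      simp_rw [h]
      exact Real.summable_pow_div_factorial _
  refine HasSum.sigma_of_hasSum ?_ (fun s => ?_) hnorm.of_norm (g := fun s : ℕ =>
    (s.factorial : ℂ)⁻¹ * (∑' i, x i) ^ s)
  · rw [Complex.exp_eq_exp_ℂ]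
    simpa [div_eq_inv_mul] using NormedSpace.expSeries_div_hasSum_exp (∑' i, x i)
  · simpa only [expTerm] using (hasSum_prod_fin hx s).2.mul_left ((s.factorial : ℂ)⁻¹)

/-- The exponential of an absolutely convergent series of monomials `ζ ^ a * q ^ b` is again such
a series, with coefficients that do not depend on `ζ` and `q`. -/
lemma exists_coeff_exp (u : ι → ℂ) (d : ι → ℤ × ℕ) :
    ∃ c : ℤ × ℕ → ℂ, ∀ ζ q : ℂ, ζ ≠ 0 →
      (Summable fun i => ‖u i * (ζ ^ (d i).1 * q ^ (d i).2)‖) →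
      HasSum (fun p => c p * (ζ ^ p.1 * q ^ p.2))
        (exp (∑' i, u i * (ζ ^ (d i).1 * q ^ (d i).2))) := by
  -- Total degree of a tuple. The coefficient of a monomial collects the fibre over its degree, so
  -- it is fixed before ζ and q are chosen.
  let deg : (Σ s : ℕ, Fin s → ι) → ℤ × ℕ := fun v => ∑ j, d (v.2 j)
  refine ⟨fun p => ∑' v : {v // deg v = p}, expTerm u v.1, fun ζ q hζ hs => ?_⟩
  have hmon (s : ℕ) (v : Fin s → ι) :
      ∏ j, (ζ ^ (d (v j)).1 * q ^ (d (v j)).2)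
        = ζ ^ (∑ j, d (v j)).1 * q ^ (∑ j, d (v j)).2 := by
    rw [Prod.fst_sum, Prod.snd_sum, Finset.prod_mul_distrib, Finset.prod_pow_eq_pow_sum]
    congr 1
    induction s with
    | zero => simp
    | succ s ih => rw [Fin.prod_univ_succ, Fin.sum_univ_succ, zpow_add₀ hζ, ih]
  have hterm (v : Σ s : ℕ, Fin s → ι) :
      expTerm (fun i => u i * (ζ ^ (d i).1 * q ^ (d i).2)) v
        = expTerm u v * (ζ ^ (deg v).1 * q ^ (deg v).2) := by
    obtain ⟨s, v⟩ := v
    simp only [expTerm, deg]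
    rw [Finset.prod_mul_distrib, hmon, mul_assoc]
  have hsum := hasSum_expTerm hs
  rw [funext hterm] at hsum
  refine ((Equiv.sigmaFiberEquiv deg).hasSum_iff.2 hsum).sigma fun p => ?_
  have hp := ((Equiv.sigmaFiberEquiv deg).summable_iff.2 hsum.summable).sigma_factor p
  have heq : (fun v : {v // deg v = p} =>
      ((fun v => expTerm u v * (ζ ^ (deg v).1 * q ^ (deg v).2)) ∘ (Equiv.sigmaFiberEquiv deg))
        ⟨p, v⟩) = fun v : {v // deg v = p} => expTerm u v.1 * (ζ ^ p.1 * q ^ p.2) := by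
    funext v
    obtain ⟨v, rfl⟩ := v
    rfl
  rw [heq] at hp ⊢
  -- In a field this needs no summability of the coefficients in the fibre, which `hp` would not
  -- give when q ^ p.2 = 0.
  rw [← tsum_mul_right]
  exact hp.hasSum

end Monomials

/-! ### Product formulas for f_k and existence of the coefficients -/

/-- The Euler product `∏_{n ≥ 1} (1 - q^n)`. -/
noncomputable def euler (q : ℂ) : ℂ := qPoch q q

/-- `∏_{n ≥ 1} (1 - ζ q^n) (1 - ζ⁻¹ q^n)`. -/
noncomputable def thetaProd (ζ q : ℂ) : ℂ := qPoch (ζ * q) q * qPoch (ζ⁻¹ * q) q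

/-- The function `q^{k/24} f_k` as a function of `ζ` and `q`. -/
noncomputable def core (k : ℕ) (ζ q : ℂ) : ℂ :=
  (euler q ^ 2 / thetaProd ζ q) ^ 2 / euler q ^ k

lemma euler_ne_zero {q : ℂ} (hq : ‖q‖ < 1) : euler q ≠ 0 := qPoch_ne_zero_of_norm_lt hq hq

lemma thetaProd_ne_zero {ζ q : ℂ} (hq : ‖q‖ < 1) (h1 : ‖ζ * q‖ < 1) (h2 : ‖ζ⁻¹ * q‖ < 1) :
    thetaProd ζ q ≠ 0 :=
  mul_ne_zero (qPoch_ne_zero_of_norm_lt hq h1) (qPoch_ne_zero_of_norm_lt hq h2)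

lemma thetaProd_inv (ζ q : ℂ) : thetaProd ζ⁻¹ q = thetaProd ζ q := by
  rw [thetaProd, thetaProd, inv_inv, mul_comm]

/-- With E the Euler product and Θ = `thetaProd`, `core` is E^{4-k} Θ^{-2}, and each Pochhammer
symbol is the exponential of minus its logarithmic series; hence the weights k - 4, 2, 2. -/
lemma core_eq_exp (k : ℕ) {ζ q : ℂ} (hq : ‖q‖ < 1) (h1 : ‖ζ * q‖ < 1) (h2 : ‖ζ⁻¹ * q‖ < 1) :
    core k ζ q = exp (((k : ℂ) - 4) * ∑' p, logTerm q q p +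
      (2 * ∑' p, logTerm (ζ * q) q p + 2 * ∑' p, logTerm (ζ⁻¹ * q) q p)) := by
  rw [core, euler, thetaProd, qPoch_eq_exp hq hq, qPoch_eq_exp hq h1, qPoch_eq_exp hq h2,
    ← exp_nat_mul, ← exp_nat_mul, ← exp_add, ← exp_sub, ← exp_nat_mul, ← exp_sub]
  congr 1
  push_cast
  ring

lemma exists_coeff_core (k : ℕ) : ∃ c : ℤ × ℕ → ℂ, ∀ ζ q : ℂ, ζ ≠ 0 → ‖q‖ < 1 → ‖ζ * q‖ < 1 →
    ‖ζ⁻¹ * q‖ < 1 → HasSum (fun p => c p * (ζ ^ p.1 * q ^ p.2)) (core k ζ q) := by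
  let J := ℕ × ℕ
  let u : J ⊕ (J ⊕ J) → ℂ := Sum.elim (fun p => ((k : ℂ) - 4) / ((p.2 : ℂ) + 1))
    (Sum.elim (fun p => 2 / ((p.2 : ℂ) + 1)) (fun p => 2 / ((p.2 : ℂ) + 1)))
  -- The term (n, r) in the logarithm of (ζq; q)_∞ is ζ^{r+1} q^{(n+1)(r+1)} / (r+1); the Euler
  -- product carries no ζ, and the third product carries ζ⁻¹.
  let d : J ⊕ (J ⊕ J) → ℤ × ℕ := Sum.elim (fun p => (0, (p.1 + 1) * (p.2 + 1)))
    (Sum.elim (fun p => ((p.2 + 1 : ℕ), (p.1 + 1) * (p.2 + 1)))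
      (fun p => (-(p.2 + 1 : ℕ), (p.1 + 1) * (p.2 + 1))))
  obtain ⟨c, hc⟩ := exists_coeff_exp u d
  refine ⟨c, fun ζ q hζ hq h1 h2 => ?_⟩
  let t : J ⊕ (J ⊕ J) → ℂ := Sum.elim (fun p => ((k : ℂ) - 4) * logTerm q q p)
    (Sum.elim (fun p => 2 * logTerm (ζ * q) q p) (fun p => 2 * logTerm (ζ⁻¹ * q) q p))
  have ht : (fun i => u i * (ζ ^ (d i).1 * q ^ (d i).2)) = t := by
    funext i
    rcases i with p | p | p
    · simp only [u, d, t, logTerm, Sum.elim_inl]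
      rw [← pow_succ', ← pow_mul, zpow_zero]
      ring
    · simp only [u, d, t, logTerm, Sum.elim_inl, Sum.elim_inr]
      rw [mul_assoc, ← pow_succ', mul_pow, ← pow_mul, zpow_natCast]
      ring
    · simp only [u, d, t, logTerm, Sum.elim_inr]
      rw [mul_assoc, ← pow_succ', mul_pow, ← pow_mul, zpow_neg, zpow_natCast, inv_pow]
      ring
  have hs0 := summable_norm_logTerm hq hq
  have hs1 := summable_norm_logTerm hq h1
  have hs2 := summable_norm_logTerm hq h2
  have hnorm : Summable fun i => ‖t i‖ := by
    refine Summable.sum _ ?_ (Summable.sum _ ?_ ?_)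
    · simpa [t, Function.comp_def] using hs0.mul_left ‖(k : ℂ) - 4‖
    · simpa [t, Function.comp_def] using hs1.mul_left 2
    · simpa [t, Function.comp_def] using hs2.mul_left 2
  have hval : HasSum t (((k : ℂ) - 4) * ∑' p, logTerm q q p +
      (2 * ∑' p, logTerm (ζ * q) q p + 2 * ∑' p, logTerm (ζ⁻¹ * q) q p)) :=
    HasSum.sum (hs0.of_norm.hasSum.mul_left _)
      (HasSum.sum (hs1.of_norm.hasSum.mul_left _) (hs2.of_norm.hasSum.mul_left _))
  have := hc ζ q hζ (by simpa only [← ht] using hnorm)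
  rwa [ht, hval.tsum_eq, ← core_eq_exp k hq h1 h2] at this

lemma norm_exp_two_pi (w : ℂ) : ‖exp (2 * Real.pi * I * w)‖ = Real.exp (-(2 * Real.pi * w.im)) := by
  rw [Complex.norm_exp]
  congr 1
  simp

lemma eta_eq (τ : ℂ) : ModularForm.eta τ =
    exp (2 * Real.pi * I * τ / 24) * euler (exp (2 * Real.pi * I * τ)) := by
  rw [ModularForm.eta, euler, qPoch]
  congr 1
  refine tprod_congr fun n => ?_
  rw [ModularForm.eta_q_eq_pow, pow_succ']

/-- The factor 1 - ζ⁻¹ at n = 0 combines with ζ^{1/2} to ζ^{1/2} - ζ^{-1/2}; the remaining product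
is symmetric under ζ ↦ ζ⁻¹. -/
lemma theta_eq (w τ : ℂ) (hτ : 0 < τ.im) : theta w τ =
    I * (exp (Real.pi * I * w) - exp (-(Real.pi * I * w))) * exp (2 * Real.pi * I * τ / 8) *
      (euler (exp (2 * Real.pi * I * τ)) *
        thetaProd (exp (2 * Real.pi * I * w)) (exp (2 * Real.pi * I * τ))) := by
  have hq : ‖exp (2 * Real.pi * I * τ)‖ < 1 := by
    rw [norm_exp_two_pi, Real.exp_lt_one_iff]
    have := mul_pos Real.two_pi_pos hτ
    linarith
  have hz : exp (Real.pi * I * w) - exp (-(Real.pi * I * w)) =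
      exp (Real.pi * I * w) * (1 - (exp (2 * Real.pi * I * w))⁻¹) := by
    rw [mul_sub, ← exp_neg, ← exp_add]
    ring_nf
  rw [hz, theta]
  set q := exp (2 * Real.pi * I * τ)
  set ζ := exp (2 * Real.pi * I * w)
  have e1 : (fun n : ℕ => 1 - q ^ (n + 1)) = fun n : ℕ => 1 - q * q ^ n := by
    funext n; rw [pow_succ']
  have e2 : (fun n : ℕ => 1 - ζ * q ^ (n + 1)) = fun n : ℕ => 1 - ζ * q * q ^ n := by
    funext n; rw [pow_succ', mul_assoc]
  have m1 : Multipliable fun n : ℕ => 1 - q ^ (n + 1) := e1 ▸ multipliable_qPoch q hq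
  have m2 : Multipliable fun n : ℕ => 1 - ζ * q ^ (n + 1) := e2 ▸ multipliable_qPoch (ζ * q) hq
  have m3 := multipliable_qPoch ζ⁻¹ hq
  rw [(m1.mul m2).tprod_mul m3, m1.tprod_mul m2, e1, e2]
  change _ * (qPoch q q * qPoch (ζ * q) q * qPoch ζ⁻¹ q) = _
  rw [qPoch_eq_mul ζ⁻¹ hq, euler, thetaProd]
  ring

lemma exp_sub_exp_neg_ne_zero {w : ℂ} (hw : exp (2 * Real.pi * I * w) ≠ 1) :
    exp (Real.pi * I * w) - exp (-(Real.pi * I * w)) ≠ 0 := by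
  intro h
  apply hw
  rw [sub_eq_zero] at h
  rw [show 2 * Real.pi * I * w = Real.pi * I * w + Real.pi * I * w by ring, exp_add]
  nth_rw 1 [h]
  rw [← exp_add, neg_add_cancel, exp_zero]

/-- The factor i (ζ^{1/2} - ζ^{-1/2}) q^{1/8} cancels between η³ and ϑ, which leaves g = E²/Θ. The
cancellation requires ζ ≠ 1: at ζ = 1 the quotient defining `g` is 0 / 0 = 0 and not the limit. -/
lemma f_eq (k : ℕ) {w τ : ℂ} (hτ : 0 < τ.im) (hw : exp (2 * Real.pi * I * w) ≠ 1) :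
    f k w τ = exp (2 * Real.pi * I * τ * (-((k : ℂ) / 24))) *
      core k (exp (2 * Real.pi * I * w)) (exp (2 * Real.pi * I * τ)) := by
  have hq : ‖exp (2 * Real.pi * I * τ)‖ < 1 := by
    rw [norm_exp_two_pi, Real.exp_lt_one_iff]
    have := mul_pos Real.two_pi_pos hτ
    linarith
  have hP := euler_ne_zero hq
  have hg : g w τ = euler (exp (2 * Real.pi * I * τ)) ^ 2 /
      thetaProd (exp (2 * Real.pi * I * w)) (exp (2 * Real.pi * I * τ)) := by
    have h0 := exp_sub_exp_neg_ne_zero hw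
    rw [g, theta_eq w τ hτ, eta_eq, mul_pow, ← exp_nat_mul]
    rw [show ((3 : ℕ) : ℂ) * (2 * Real.pi * I * τ / 24) = 2 * Real.pi * I * τ / 8 by
      push_cast; ring]
    have h8 := exp_ne_zero (2 * Real.pi * I * τ / 8)
    generalize exp (2 * Real.pi * I * τ / 8) = e8 at *
    generalize exp (Real.pi * I * w) - exp (-(Real.pi * I * w)) = s at *
    generalize euler (exp (2 * Real.pi * I * τ)) = P at *
    rw [show I * (s * (e8 * P ^ 3)) = (I * s * e8 * P) * P ^ 2 by ring,
      show I * s * e8 * (P * thetaProd (exp (2 * Real.pi * I * w)) (exp (2 * Real.pi * I * τ))) =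
      (I * s * e8 * P) * thetaProd (exp (2 * Real.pi * I * w)) (exp (2 * Real.pi * I * τ)) by ring]
    exact mul_div_mul_left _ _ (by simp [h0, h8, hP])
  rw [f, hg, core, eta_eq, mul_pow, ← exp_nat_mul, show 2 * Real.pi * I * τ * (-((k : ℂ) / 24)) =
    -((k : ℂ) * (2 * Real.pi * I * τ / 24)) by ring, exp_neg]
  rw [← div_div, div_right_comm, inv_mul_eq_div]

lemma exists_isCoeffs (k : ℕ) : ∃ a : ℤ → ℕ → ℂ, IsCoeffs k a := by
  obtain ⟨c, hc⟩ := exists_coeff_core k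
  refine ⟨fun m n => c (m, n), fun τ w hτ hw hζ => ?_⟩
  have hpi := Real.two_pi_pos
  obtain ⟨hw1, hw2⟩ := abs_lt.1 hw
  have h := hc (exp (2 * Real.pi * I * w)) (exp (2 * Real.pi * I * τ)) (exp_ne_zero _)
    (by rw [norm_exp_two_pi, Real.exp_lt_one_iff]; nlinarith)
    (by rw [norm_mul, norm_exp_two_pi, norm_exp_two_pi, ← Real.exp_add, Real.exp_lt_one_iff]
        nlinarith)
    (by rw [norm_mul, norm_inv, norm_exp_two_pi, norm_exp_two_pi, ← Real.exp_neg, ← Real.exp_add,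
          Real.exp_lt_one_iff]
        nlinarith)
  rw [f_eq k hτ hζ]
  refine (h.mul_left (exp (2 * Real.pi * I * τ * (-((k : ℂ) / 24))))).congr_fun ?_
  intro p
  rw [sub_eq_add_neg, mul_add, exp_add, ← exp_nat_mul]
  ring_nf

end ChiGenus

/-! ### Fourier coefficients in w, Cauchy's formula and uniqueness -/

namespace ChiGenus

open Complex MeasureTheory Filter Topology

/-- The value of `f_k (w; i z / 2π)` (with the removable singularities in `w` filled). -/
noncomputable def fz (k : ℕ) (z w : ℂ) : ℂ :=
  exp (k * z / 24) * core k (exp (2 * Real.pi * I * w)) (exp (-z))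

/-- The `m`-th Fourier coefficient of `w ↦ f_k (w; i z / 2π)`. -/
noncomputable def fourierF (k : ℕ) (m : ℤ) (z : ℂ) : ℂ :=
  ∫ w in (-(1 / 2) : ℝ)..(1 / 2), fz k z w * exp (-(2 * Real.pi * I * m * w))

lemma two_pi_mul_tau (z : ℂ) : 2 * Real.pi * I * (I * z / (2 * Real.pi)) = -z := by
  have : (Real.pi : ℂ) ≠ 0 := ofReal_ne_zero.2 Real.pi_ne_zero
  field_simp
  simp

lemma tau_im (z : ℂ) : (I * z / (2 * Real.pi)).im = z.re / (2 * Real.pi) := by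
  have : (I * z / (2 * Real.pi)) = ((1 / (2 * Real.pi) : ℝ) : ℂ) * (I * z) := by
    push_cast; ring
  rw [this, im_ofReal_mul]
  simp
  ring

lemma exp_two_pi_I_ne_one {w : ℝ} (hw : w ∈ Set.Ioc (-(1 / 2)) (1 / 2 : ℝ)) (h0 : w ≠ 0) :
    exp (2 * Real.pi * I * w) ≠ 1 := by
  intro h
  obtain ⟨n, hn⟩ := Complex.exp_eq_one_iff.1 h
  have hpi : (Real.pi : ℂ) ≠ 0 := ofReal_ne_zero.2 Real.pi_ne_zero
  have h2 : (w : ℂ) = n := by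
    have h3 : (2 * Real.pi * I) * (w : ℂ) = (2 * Real.pi * I) * n := by rw [hn]; ring
    exact mul_left_cancel₀ (by simp [hpi]) h3
  have h4 : w = n := by exact_mod_cast h2
  obtain ⟨h5, h6⟩ := hw
  rw [h4] at h5 h6 h0
  have h7 : (-1 : ℤ) < n := by
    have : (-1 : ℝ) < n := by linarith
    exact_mod_cast this
  have h8 : n < 1 := by
    have : (n : ℝ) < 1 := by linarith
    exact_mod_cast this
  exact h0 (by simp [show n = 0 by omega])

lemma ae_exp_two_pi_I_ne_one : ∀ᵐ w : ℝ, w ∈ Set.uIoc (-(1 / 2)) (1 / 2 : ℝ) →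
    exp (2 * Real.pi * I * w) ≠ 1 := by
  have h : ∀ᵐ w : ℝ, w ≠ 0 := by simp [ae_iff]
  filter_upwards [h] with w hw hmem
  rw [Set.uIoc_of_le (by norm_num)] at hmem
  exact exp_two_pi_I_ne_one hmem hw

section Coefficients

variable {k : ℕ} {a : ℤ → ℕ → ℂ}

lemma IsCoeffs.hasSum_fz (ha : IsCoeffs k a) {z : ℂ} (hz : 0 < z.re) {w : ℝ}
    (hw : exp (2 * Real.pi * I * w) ≠ 1) :
    HasSum (fun p : ℤ × ℕ => a p.1 p.2 * exp (2 * Real.pi * I * w) ^ p.1 *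
      exp (-z * ((p.2 : ℂ) - (k : ℂ) / 24))) (fz k z w) := by
  have him : 0 < (I * z / (2 * Real.pi)).im := by
    rw [tau_im]
    exact div_pos hz Real.two_pi_pos
  have h := ha (I * z / (2 * Real.pi)) w him (by simpa using him) hw
  rw [f_eq k him hw] at h
  simp only [two_pi_mul_tau] at h
  rw [fz]
  convert h using 3
  ring

lemma norm_exp_two_pi_ofReal (w : ℝ) : ‖exp (2 * Real.pi * I * w)‖ = 1 := by
  rw [norm_exp_two_pi]
  simp

lemma norm_exp_neg_mul (z : ℂ) (b : ℝ) : ‖exp (-z * b)‖ = Real.exp (-z.re * b) := by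
  rw [Complex.norm_exp]
  simp

lemma norm_coeff_term (z : ℂ) (w : ℝ) (p : ℤ × ℕ) :
    ‖a p.1 p.2 * exp (2 * Real.pi * I * w) ^ p.1 * exp (-z * ((p.2 : ℂ) - (k : ℂ) / 24))‖ =
      ‖a p.1 p.2‖ * Real.exp (-z.re * ((p.2 : ℝ) - (k : ℝ) / 24)) := by
  rw [norm_mul, norm_mul, norm_zpow, norm_exp_two_pi_ofReal, one_zpow, mul_one]
  have := norm_exp_neg_mul z ((p.2 : ℝ) - (k : ℝ) / 24)
  push_cast at this
  rw [this]

/-- For real w the norms of the terms do not depend on w, so absolute convergence at one w suffices;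
w = 1/4 avoids ζ = 1. -/
lemma IsCoeffs.summable_norm (ha : IsCoeffs k a) {x : ℝ} (hx : 0 < x) :
    Summable fun p : ℤ × ℕ => ‖a p.1 p.2‖ * Real.exp (-x * ((p.2 : ℝ) - (k : ℝ) / 24)) := by
  have hw : exp (2 * Real.pi * I * ((1 / 4 : ℝ) : ℂ)) ≠ 1 :=
    exp_two_pi_I_ne_one (by constructor <;> norm_num) (by norm_num)
  have := (ha.hasSum_fz (z := x) (by simpa using hx) hw).summable.norm
  simp only [norm_coeff_term, ofReal_re] at this
  exact this

lemma integral_exp_two_pi_int (n : ℤ) :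
    ∫ w in (-(1 / 2) : ℝ)..(1 / 2), exp (2 * Real.pi * I * n * w) = if n = 0 then 1 else 0 := by
  split_ifs with h
  · simp [h]; norm_num
  · have hc : (2 * Real.pi * I * n : ℂ) ≠ 0 := by
      simp [h, Real.pi_ne_zero]
    rw [integral_exp_mul_complex hc, div_eq_zero_iff]
    left
    rw [sub_eq_zero, Complex.exp_eq_exp_iff_exists_int]
    exact ⟨n, by push_cast; ring⟩

lemma integral_exp_int_I (n : ℤ) :
    ∫ y in (-Real.pi)..Real.pi, exp (n * I * y) = if n = 0 then 2 * (Real.pi : ℂ) else 0 := by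
  split_ifs with h
  · simp [h]; ring
  · have hc : (n * I : ℂ) ≠ 0 := by simp [h]
    rw [integral_exp_mul_complex hc, div_eq_zero_iff]
    left
    rw [sub_eq_zero, Complex.exp_eq_exp_iff_exists_int]
    exact ⟨n, by push_cast; ring⟩

/-- Integrating the double series against e^{-2πimw} term by term, orthogonality of characters keeps
only the row m. The excluded point w = 0 is a null set. -/
lemma IsCoeffs.hasSum_fourierF (ha : IsCoeffs k a) (m : ℤ) {z : ℂ} (hz : 0 < z.re) :
    HasSum (fun n : ℕ => a m n * exp (-z * ((n : ℂ) - (k : ℂ) / 24))) (fourierF k m z) := by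
  have key : HasSum (fun p : ℤ × ℕ => ∫ w in (-(1 / 2) : ℝ)..(1 / 2),
      a p.1 p.2 * exp (2 * Real.pi * I * w) ^ p.1 * exp (-z * ((p.2 : ℂ) - (k : ℂ) / 24)) *
        exp (-(2 * Real.pi * I * m * w))) (fourierF k m z) := by
    refine intervalIntegral.hasSum_integral_of_dominated_convergence
      (fun p _ => ‖a p.1 p.2‖ * Real.exp (-z.re * ((p.2 : ℝ) - (k : ℝ) / 24))) ?_ ?_ ?_ ?_ ?_
    · intro p
      refine Continuous.aestronglyMeasurable ?_
      have : Continuous fun w : ℝ => exp (2 * Real.pi * I * w) ^ p.1 :=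
        Continuous.zpow₀ (by fun_prop) _ (fun w => Or.inl (exp_ne_zero _))
      fun_prop
    · refine fun p => .of_forall fun w _ => ?_
      rw [norm_mul, norm_coeff_term]
      have : ‖exp (-(2 * Real.pi * I * m * w))‖ = 1 := by
        rw [Complex.norm_exp]; simp
      rw [this, mul_one]
    · exact .of_forall fun w _ => ha.summable_norm hz
    · exact intervalIntegrable_const
    · filter_upwards [ae_exp_two_pi_I_ne_one] with w hw hmem
      exact (ha.hasSum_fz hz (hw hmem)).mul_right _
  have hinteg (p : ℤ × ℕ) : ∫ w in (-(1 / 2) : ℝ)..(1 / 2),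
      a p.1 p.2 * exp (2 * Real.pi * I * w) ^ p.1 * exp (-z * ((p.2 : ℂ) - (k : ℂ) / 24)) *
        exp (-(2 * Real.pi * I * m * w)) =
      if p.1 - m = 0 then a p.1 p.2 * exp (-z * ((p.2 : ℂ) - (k : ℂ) / 24)) else 0 := by
    have h1 : (fun w : ℝ => a p.1 p.2 * exp (2 * Real.pi * I * w) ^ p.1 *
        exp (-z * ((p.2 : ℂ) - (k : ℂ) / 24)) * exp (-(2 * Real.pi * I * m * w))) =
        fun w : ℝ => (a p.1 p.2 * exp (-z * ((p.2 : ℂ) - (k : ℂ) / 24))) *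
          exp (2 * Real.pi * I * ((p.1 - m : ℤ) : ℂ) * w) := by
      funext w
      rw [← exp_int_mul]
      rw [show 2 * Real.pi * I * ((p.1 - m : ℤ) : ℂ) * w =
        (p.1 : ℂ) * (2 * Real.pi * I * w) + -(2 * Real.pi * I * m * w) by push_cast; ring, exp_add]
      ring
    rw [h1, intervalIntegral.integral_const_mul, integral_exp_two_pi_int]
    split_ifs <;> simp
  simp only [hinteg] at key
  have hinj : Function.Injective fun n : ℕ => (m, n) := fun _ _ h => (Prod.mk.inj h).2
  rw [← hinj.hasSum_iff] at key
  · simpa [Function.comp_def] using key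
  · rintro ⟨m', n⟩ hp
    rw [if_neg]
    intro h
    exact hp ⟨n, by rw [show m = m' by simp only at h; omega]⟩

lemma IsCoeffs.summable_norm_row (ha : IsCoeffs k a) (m : ℤ) {x : ℝ} (hx : 0 < x) :
    Summable fun n : ℕ => ‖a m n‖ * Real.exp (-x * ((n : ℝ) - (k : ℝ) / 24)) :=
  (ha.summable_norm hx).comp_injective (i := fun n : ℕ => (m, n)) fun _ _ h => (Prod.mk.inj h).2

lemma norm_row_term (m : ℤ) (z : ℂ) (n : ℕ) :
    ‖a m n * exp (-z * ((n : ℂ) - (k : ℂ) / 24))‖ =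
      ‖a m n‖ * Real.exp (-z.re * ((n : ℝ) - (k : ℝ) / 24)) := by
  have := norm_exp_neg_mul z ((n : ℝ) - (k : ℝ) / 24)
  push_cast at this
  rw [norm_mul, this]

lemma IsCoeffs.continuous_fourierF (ha : IsCoeffs k a) (m : ℤ) {x : ℝ} (hx : 0 < x) :
    Continuous fun y : ℝ => fourierF k m (x + y * I) := by
  have h (y : ℝ) : fourierF k m (x + y * I) =
      ∑' n : ℕ, a m n * exp (-(x + y * I) * ((n : ℂ) - (k : ℂ) / 24)) :=
    (ha.hasSum_fourierF m (by simpa using hx)).tsum_eq.symm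
  rw [funext h]
  refine continuous_tsum (fun n => by fun_prop) (ha.summable_norm_row m hx) fun n y => ?_
  rw [norm_row_term]
  simp

/-- Cauchy's formula for the coefficients. -/
lemma IsCoeffs.eq_integral (ha : IsCoeffs k a) (m : ℤ) (n : ℕ) {x : ℝ} (hx : 0 < x) :
    2 * (Real.pi : ℂ) * a m n = ∫ y in (-Real.pi)..Real.pi,
      exp ((x + y * I) * ((n : ℂ) - (k : ℂ) / 24)) * fourierF k m (x + y * I) := by
  have key : HasSum (fun n' : ℕ => ∫ y in (-Real.pi)..Real.pi,
      exp ((x + y * I) * ((n : ℂ) - (k : ℂ) / 24)) *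
        (a m n' * exp (-(x + y * I) * ((n' : ℂ) - (k : ℂ) / 24))))
      (∫ y in (-Real.pi)..Real.pi,
        exp ((x + y * I) * ((n : ℂ) - (k : ℂ) / 24)) * fourierF k m (x + y * I)) := by
    refine intervalIntegral.hasSum_integral_of_dominated_convergence
      (fun n' _ => Real.exp (x * ((n : ℝ) - (k : ℝ) / 24)) *
        (‖a m n'‖ * Real.exp (-x * ((n' : ℝ) - (k : ℝ) / 24)))) ?_ ?_ ?_ ?_ ?_
    · exact fun n' => Continuous.aestronglyMeasurable (by fun_prop)
    · refine fun n' => .of_forall fun y _ => ?_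
      have := norm_exp_neg_mul (-(x + y * I)) ((n : ℝ) - (k : ℝ) / 24)
      push_cast at this
      rw [neg_neg] at this
      rw [norm_mul, norm_row_term, this]
      simp
    · exact .of_forall fun y _ => (ha.summable_norm_row m hx).mul_left _
    · exact intervalIntegrable_const
    · exact .of_forall fun y _ => (ha.hasSum_fourierF m (by simpa using hx)).mul_left _
  have hinteg (n' : ℕ) : ∫ y in (-Real.pi)..Real.pi,
      exp ((x + y * I) * ((n : ℂ) - (k : ℂ) / 24)) *
        (a m n' * exp (-(x + y * I) * ((n' : ℂ) - (k : ℂ) / 24))) =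
      if n' = n then 2 * (Real.pi : ℂ) * a m n else 0 := by
    have h1 : (fun y : ℝ => exp ((x + y * I) * ((n : ℂ) - (k : ℂ) / 24)) *
        (a m n' * exp (-(x + y * I) * ((n' : ℂ) - (k : ℂ) / 24)))) =
        fun y : ℝ => (a m n' * exp (x * ((n : ℂ) - n'))) *
          exp ((((n : ℤ) - (n' : ℤ) : ℤ) : ℂ) * I * y) := by
      funext y
      rw [mul_left_comm, ← exp_add, mul_assoc, ← exp_add]
      congr 2
      push_cast
      ring
    rw [h1, intervalIntegral.integral_const_mul, integral_exp_int_I]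
    by_cases h : n' = n
    · subst h; simp [mul_comm]
    · rw [if_neg h, if_neg (by omega), mul_zero]
  simp only [hinteg] at key
  have := hasSum_ite_eq n (2 * (Real.pi : ℂ) * a m n)
  exact this.unique key

/-- The right side of Cauchy's formula involves only f_k, not the coefficients. -/
lemma IsCoeffs.unique {b : ℤ → ℕ → ℂ} (ha : IsCoeffs k a) (hb : IsCoeffs k b) : a = b := by
  funext m n
  have h := (ha.eq_integral m n one_pos).trans (hb.eq_integral m n one_pos).symm
  exact mul_left_cancel₀ (by simp [Real.pi_ne_zero]) h

end Coefficients

lemma existsUnique_isCoeffs (k : ℕ) : ∃! a : ℤ → ℕ → ℂ, IsCoeffs k a := by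
  obtain ⟨a, ha⟩ := exists_isCoeffs k
  exact ⟨a, ha, fun b hb => hb.unique ha⟩

end ChiGenus

/-! ### Modular inversion by Liouville's theorem -/

namespace ChiGenus

open Complex MeasureTheory Filter Topology

/-- The entire function `sin (π w) ∏_{n ≥ 1} (1 - ζ q^n) (1 - ζ⁻¹ q^n)`, with simple zeros at the
points of the lattice `ℤ + ℤ τ`. -/
noncomputable def sigmaFun (τ w : ℂ) : ℂ :=
  sin (Real.pi * w) * thetaProd (exp (2 * Real.pi * I * w)) (exp (2 * Real.pi * I * τ))

lemma norm_exp_tau_lt_one {τ : ℂ} (hτ : 0 < τ.im) : ‖exp (2 * Real.pi * I * τ)‖ < 1 := by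
  rw [norm_exp_two_pi, Real.exp_lt_one_iff]
  have := mul_pos Real.two_pi_pos hτ
  linarith

/-- Since sin (πw) = -(i/2) ζ^{1/2} (1 - ζ⁻¹), the sine supplies the missing factor of (ζ⁻¹; q)_∞.
In this form the shift w ↦ w + τ adds one factor to one product and removes one from the other. -/
lemma sigmaFun_eq {τ : ℂ} (hτ : 0 < τ.im) (w : ℂ) : sigmaFun τ w =
    -(I / 2) * exp (Real.pi * I * w) * (qPoch (exp (-(2 * Real.pi * I * w)))
      (exp (2 * Real.pi * I * τ)) *
        qPoch (exp (2 * Real.pi * I * w) * exp (2 * Real.pi * I * τ))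
          (exp (2 * Real.pi * I * τ))) := by
  rw [sigmaFun, thetaProd, ← exp_neg, qPoch_eq_mul (exp (-(2 * Real.pi * I * w)))
    (norm_exp_tau_lt_one hτ)]
  have h : sin (Real.pi * w) =
      -(I / 2) * exp (Real.pi * I * w) * (1 - exp (-(2 * Real.pi * I * w))) := by
    rw [mul_assoc, mul_sub, mul_one, ← exp_add, sin,
      show Real.pi * I * w + -(2 * Real.pi * I * w) = -(Real.pi * w) * I by ring,
      show (Real.pi : ℂ) * I * w = Real.pi * w * I by ring]
    ring
  rw [h]
  ring

lemma sigmaFun_add_one (τ w : ℂ) : sigmaFun τ (w + 1) = -sigmaFun τ w := by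
  rw [sigmaFun, sigmaFun, mul_add, mul_one, sin_add_pi, mul_add, mul_one, exp_add, exp_two_pi_mul_I]
  simp

lemma sigmaFun_add_tau {τ : ℂ} (hτ : 0 < τ.im) (w : ℂ) :
    sigmaFun τ (w + τ) = -exp (-(2 * Real.pi * I * w) - Real.pi * I * τ) * sigmaFun τ w := by
  have hq := norm_exp_tau_lt_one hτ
  have hq0 := exp_ne_zero (2 * Real.pi * I * τ)
  rw [sigmaFun_eq hτ, sigmaFun_eq hτ, qPoch_eq_mul (exp (-(2 * Real.pi * I * (w + τ)))) hq,
    qPoch_eq_mul (exp (2 * Real.pi * I * w) * exp (2 * Real.pi * I * τ)) hq]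
  have e1 : exp (-(2 * Real.pi * I * (w + τ))) * exp (2 * Real.pi * I * τ) =
      exp (-(2 * Real.pi * I * w)) := by
    rw [← exp_add]; ring_nf
  have e2 : exp (2 * Real.pi * I * (w + τ)) =
      exp (2 * Real.pi * I * w) * exp (2 * Real.pi * I * τ) := by
    rw [← exp_add]; ring_nf
  rw [e1, e2]
  have e3 : exp (Real.pi * I * (w + τ)) * (1 - exp (-(2 * Real.pi * I * (w + τ)))) =
      -exp (-(2 * Real.pi * I * w) - Real.pi * I * τ) * (exp (Real.pi * I * w) *
        (1 - exp (2 * Real.pi * I * w) * exp (2 * Real.pi * I * τ))) := by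
    simp only [mul_sub, mul_one, neg_mul, ← exp_add]
    ring_nf
  linear_combination (-(I / 2) * qPoch (exp (-(2 * Real.pi * I * w))) (exp (2 * Real.pi * I * τ)) *
    qPoch (exp (2 * Real.pi * I * w) * exp (2 * Real.pi * I * τ) * exp (2 * Real.pi * I * τ))
      (exp (2 * Real.pi * I * τ))) * e3

lemma differentiable_thetaProd {q : ℂ} (hq : ‖q‖ < 1) :
    Differentiable ℂ fun w => thetaProd (exp (2 * Real.pi * I * w)) q := by
  have h1 : Differentiable ℂ fun w : ℂ => qPoch (exp (2 * Real.pi * I * w) * q) q :=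
    (differentiable_qPoch hq).comp (by fun_prop)
  have h2 : Differentiable ℂ fun w : ℂ => qPoch (exp (-(2 * Real.pi * I * w)) * q) q :=
    (differentiable_qPoch hq).comp (by fun_prop)
  simp only [thetaProd, ← exp_neg]
  exact h1.mul h2

lemma differentiable_sigmaFun {τ : ℂ} (hτ : 0 < τ.im) : Differentiable ℂ (sigmaFun τ) := by
  have h : Differentiable ℂ fun w : ℂ => sin (Real.pi * w) := by fun_prop
  exact h.mul (differentiable_thetaProd (norm_exp_tau_lt_one hτ))

lemma thetaProd_one (q : ℂ) : thetaProd 1 q = euler q ^ 2 := by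
  simp [thetaProd, euler, sq]

section Transformation

variable {τ : ℂ}

/-- The function `sin (π w) / w`, extended to `0`. -/
noncomputable def sinSlope (w : ℂ) : ℂ := dslope (fun w => sin (Real.pi * w)) 0 w

lemma sin_eq_mul_sinSlope (w : ℂ) : sin (Real.pi * w) = w * sinSlope w := by
  have := sub_smul_dslope (fun w : ℂ => sin (Real.pi * w)) 0 w
  simpa [sinSlope] using this.symm

lemma sinSlope_zero : sinSlope 0 = Real.pi := by
  rw [sinSlope, dslope_same]
  have h : HasDerivAt (fun w : ℂ => sin (Real.pi * w)) (cos (Real.pi * 0) * (Real.pi * 1)) 0 :=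
    ((hasDerivAt_id (0 : ℂ)).const_mul (Real.pi : ℂ)).csin
  simpa using h.deriv

lemma differentiable_sinSlope : Differentiable ℂ sinSlope := by
  have h : DifferentiableOn ℂ (fun w : ℂ => sin (Real.pi * w)) Set.univ := by fun_prop
  have := (Complex.differentiableOn_dslope (c := (0 : ℂ)) Filter.univ_mem).2 h
  exact differentiableOn_univ.1 this

lemma im_neg_inv_pos (hτ : 0 < τ.im) : 0 < (-1 / τ).im := by
  have h0 : τ ≠ 0 := by rintro rfl; simp at hτ
  rw [neg_div, one_div, neg_im, inv_im]
  rw [neg_div, neg_neg]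
  exact div_pos hτ (normSq_pos.2 h0)

/-- The numerator in the proof of the inversion formula. -/
noncomputable def invNum (τ w : ℂ) : ℂ := exp (Real.pi * I * w ^ 2 / τ) * sigmaFun τ w

/-- The denominator in the proof of the inversion formula. -/
noncomputable def invDen (τ w : ℂ) : ℂ := sigmaFun (-1 / τ) (w / τ)

lemma invNum_add_one (w : ℂ) : invNum τ (w + 1) =
    -exp ((2 * Real.pi * I * w + Real.pi * I) / τ) * invNum τ w := by
  rw [invNum, invNum, sigmaFun_add_one,
    show Real.pi * I * (w + 1) ^ 2 / τ = (2 * Real.pi * I * w + Real.pi * I) / τ +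
      Real.pi * I * w ^ 2 / τ by ring, exp_add]
  ring

lemma invDen_add_one (hτ : 0 < τ.im) (w : ℂ) : invDen τ (w + 1) =
    -exp ((2 * Real.pi * I * w + Real.pi * I) / τ) * invDen τ w := by
  have h := sigmaFun_add_tau (im_neg_inv_pos hτ) ((w + 1) / τ)
  rw [show (w + 1) / τ + -1 / τ = w / τ by ring] at h
  rw [invDen, invDen, h, ← mul_assoc, neg_mul_neg, ← exp_add]
  rw [show (2 * Real.pi * I * w + Real.pi * I) / τ +
    (-(2 * Real.pi * I * ((w + 1) / τ)) - Real.pi * I * (-1 / τ)) = 0 by ring, exp_zero, one_mul]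

lemma invNum_add_tau (hτ : 0 < τ.im) (w : ℂ) : invNum τ (w + τ) = -invNum τ w := by
  have h0 : τ ≠ 0 := by rintro rfl; simp at hτ
  rw [invNum, invNum, sigmaFun_add_tau hτ, ← mul_assoc, mul_neg, ← exp_add]
  rw [show Real.pi * I * (w + τ) ^ 2 / τ + (-(2 * Real.pi * I * w) - Real.pi * I * τ) =
    Real.pi * I * w ^ 2 / τ by field_simp; ring]
  ring

lemma invDen_add_tau (hτ : 0 < τ.im) (w : ℂ) : invDen τ (w + τ) = -invDen τ w := by
  have h0 : τ ≠ 0 := by rintro rfl; simp at hτ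
  rw [invDen, invDen, add_div, div_self h0, sigmaFun_add_one]

lemma differentiable_invNum (hτ : 0 < τ.im) : Differentiable ℂ (invNum τ) := by
  have h : Differentiable ℂ fun w : ℂ => exp (Real.pi * I * w ^ 2 / τ) := by fun_prop
  exact h.mul (differentiable_sigmaFun hτ)

lemma differentiable_invDen (hτ : 0 < τ.im) : Differentiable ℂ (invDen τ) :=
  (differentiable_sigmaFun (im_neg_inv_pos hτ)).comp (by fun_prop)

/-- With σ = -1/τ the argument w/τ is y - xσ, whose imaginary part is at most Im σ / 2 in absolute
value. Hence no factor of the product vanishes, and the sine vanishes only at the origin. -/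
lemma invDen_ne_zero (hτ : 0 < τ.im) {x y : ℝ} (hx : |x| ≤ 1 / 2) (hy : |y| ≤ 1 / 2)
    (h : (x : ℂ) + y * τ ≠ 0) : invDen τ (x + y * τ) ≠ 0 := by
  have h0 : τ ≠ 0 := by rintro rfl; simp at hτ
  have hτ' := im_neg_inv_pos hτ
  have hpi := Real.two_pi_pos
  set σ := -1 / τ with hσ
  have hw : ((x : ℂ) + y * τ) / τ = y - x * σ := by
    rw [hσ]; field_simp; ring
  have him : ((y : ℂ) - x * σ).im = -(x * σ.im) := by simp
  obtain ⟨hx1, hx2⟩ := abs_le.1 hx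
  rw [invDen, hw, sigmaFun]
  refine mul_ne_zero ?_ (thetaProd_ne_zero (norm_exp_tau_lt_one hτ') ?_ ?_)
  · rw [Complex.sin_ne_zero_iff]
    intro n hn
    have hpi0 : (Real.pi : ℂ) ≠ 0 := ofReal_ne_zero.2 Real.pi_ne_zero
    have hn' : (y : ℂ) - x * σ = n := mul_left_cancel₀ hpi0 (by rw [hn]; ring)
    have hx0 : x = 0 := by
      have := congrArg Complex.im hn'
      rw [him] at this
      simp at this
      rcases this with h | h
      · exact h
      · exact absurd h hτ'.ne'
    have hyn : y = n := by
      rw [hx0] at hn'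
      have : (y : ℂ) = n := by simpa using hn'
      exact_mod_cast this
    have hn0 : n = 0 := by
      rw [hyn] at hy
      have h1 : |(n : ℝ)| < 1 := by linarith
      have h2 : |n| < 1 := by exact_mod_cast h1
      exact Int.abs_lt_one_iff.1 h2
    apply h
    rw [hx0, hyn, hn0]
    simp
  · rw [norm_mul, norm_exp_two_pi, norm_exp_two_pi, ← Real.exp_add, Real.exp_lt_one_iff, him]
    have : 0 < 2 * Real.pi * σ.im * (1 - x) := by
      apply mul_pos (mul_pos hpi hτ'); linarith
    nlinarith
  · rw [norm_mul, norm_inv, norm_exp_two_pi, norm_exp_two_pi, ← Real.exp_neg, ← Real.exp_add,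
      Real.exp_lt_one_iff, him]
    have : 0 < 2 * Real.pi * σ.im * (1 + x) := by
      apply mul_pos (mul_pos hpi hτ'); linarith
    nlinarith

/-- The quotient of the two sides of the inversion formula, extended to the lattice points. -/
noncomputable def invRatio (τ w : ℂ) : ℂ :=
  open Classical in
  if invDen τ w = 0 then
    τ * euler (exp (2 * Real.pi * I * τ)) ^ 2 / euler (exp (2 * Real.pi * I * (-1 / τ))) ^ 2
  else invNum τ w / invDen τ w

lemma invRatio_periodic_one (hτ : 0 < τ.im) : Function.Periodic (invRatio τ) 1 := by
  intro w
  have he : -exp ((2 * Real.pi * I * w + Real.pi * I) / τ) ≠ 0 := neg_ne_zero.2 (exp_ne_zero _)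
  rw [invRatio, invRatio, invDen_add_one hτ, invNum_add_one, mul_div_mul_left _ _ he]
  simp only [mul_eq_zero, he, false_or]

lemma invRatio_periodic_tau (hτ : 0 < τ.im) : Function.Periodic (invRatio τ) τ := by
  intro w
  rw [invRatio, invRatio, invDen_add_tau hτ, invNum_add_tau hτ, neg_div_neg_eq]
  simp only [neg_eq_zero]

/-- Numerator and denominator both have a simple zero at 0, carried by the sine and divided out
through `sinSlope`. The value assigned by `invRatio` at zeros of the denominator is exactly the
quotient of the two first-order coefficients. -/
lemma differentiableAt_invRatio_zero (hτ : 0 < τ.im) : DifferentiableAt ℂ (invRatio τ) 0 := by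
  have h0 : τ ≠ 0 := by rintro rfl; simp at hτ
  have hτ' := im_neg_inv_pos hτ
  have hpi0 : (Real.pi : ℂ) ≠ 0 := ofReal_ne_zero.2 Real.pi_ne_zero
  let Nl : ℂ → ℂ := fun w => exp (Real.pi * I * w ^ 2 / τ) * (sinSlope w *
    thetaProd (exp (2 * Real.pi * I * w)) (exp (2 * Real.pi * I * τ)))
  let Dl : ℂ → ℂ := fun w => τ⁻¹ * (sinSlope (w / τ) *
    thetaProd (exp (2 * Real.pi * I * (w / τ))) (exp (2 * Real.pi * I * (-1 / τ))))
  have hN : Differentiable ℂ Nl := by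
    have h : Differentiable ℂ fun w : ℂ => exp (Real.pi * I * w ^ 2 / τ) := by fun_prop
    exact h.mul (differentiable_sinSlope.mul (differentiable_thetaProd (norm_exp_tau_lt_one hτ)))
  have hD : Differentiable ℂ Dl := by
    have h1 : Differentiable ℂ fun w : ℂ => sinSlope (w / τ) :=
      differentiable_sinSlope.comp (by fun_prop)
    have h2 : Differentiable ℂ fun w : ℂ => thetaProd (exp (2 * Real.pi * I * (w / τ)))
        (exp (2 * Real.pi * I * (-1 / τ))) :=
      (differentiable_thetaProd (norm_exp_tau_lt_one hτ')).comp
        (f := fun w : ℂ => w / τ) (by fun_prop)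
    exact (h1.mul h2).const_mul _
  have hN0 : Nl 0 = Real.pi * euler (exp (2 * Real.pi * I * τ)) ^ 2 := by
    simp [Nl, sinSlope_zero, thetaProd_one]
  have hD0 : Dl 0 = τ⁻¹ * (Real.pi * euler (exp (2 * Real.pi * I * (-1 / τ))) ^ 2) := by
    simp only [Dl, zero_div, sinSlope_zero, mul_zero, exp_zero, thetaProd_one]
  have hP := euler_ne_zero (norm_exp_tau_lt_one hτ')
  have hD0' : Dl 0 ≠ 0 := by
    rw [hD0]
    exact mul_ne_zero (inv_ne_zero h0) (mul_ne_zero hpi0 (pow_ne_zero _ hP))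
  have hev : ∀ᶠ w in 𝓝 (0 : ℂ), Dl w ≠ 0 := hD.continuous.continuousAt.eventually_ne hD0'
  have heq : invRatio τ =ᶠ[𝓝 0] fun w => Nl w / Dl w := by
    filter_upwards [hev] with w hw
    have hden : invDen τ w = w * Dl w := by
      rw [invDen, sigmaFun, sin_eq_mul_sinSlope]
      simp only [Dl]
      ring
    have hnum : invNum τ w = w * Nl w := by
      rw [invNum, sigmaFun, sin_eq_mul_sinSlope]
      simp only [Nl]
      ring
    rw [invRatio, hden, hnum]
    by_cases h : w = 0
    · rw [if_pos (by simp [h]), h, hN0, hD0]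
      field_simp
    · rw [if_neg (mul_ne_zero h hw), mul_div_mul_left _ _ h]
  exact (hN.differentiableAt.div hD.differentiableAt hD0').congr_of_eventuallyEq heq

lemma exists_lattice_reduction (hτ : 0 < τ.im) (w : ℂ) : ∃ (x y : ℝ) (a b : ℤ),
    |x| ≤ 1 / 2 ∧ |y| ≤ 1 / 2 ∧ w = x + y * τ + a * 1 + b * τ := by
  let y₀ := w.im / τ.im
  let x₀ := w.re - y₀ * τ.re
  refine ⟨x₀ - round x₀, y₀ - round y₀, round x₀, round y₀, abs_sub_round _, abs_sub_round _, ?_⟩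
  have h : w = x₀ + y₀ * τ := by
    apply Complex.ext
    · simp [x₀]
    · simp [y₀, hτ.ne']
  nth_rw 1 [h]
  push_cast
  ring

lemma invRatio_reduce (hτ : 0 < τ.im) (w : ℂ) (a b : ℤ) :
    invRatio τ (w + a * 1 + b * τ) = invRatio τ w := by
  rw [(invRatio_periodic_tau hτ).int_mul b, (invRatio_periodic_one hτ).int_mul a]

/-- Periodicity moves every point into the parallelogram |x|, |y| ≤ 1/2, where the origin is the
only zero of the denominator. -/
lemma differentiable_invRatio (hτ : 0 < τ.im) : Differentiable ℂ (invRatio τ) := by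
  have hbase (x y : ℝ) (hx : |x| ≤ 1 / 2) (hy : |y| ≤ 1 / 2) :
      DifferentiableAt ℂ (invRatio τ) (x + y * τ) := by
    by_cases h : (x : ℂ) + y * τ = 0
    · rw [h]
      exact differentiableAt_invRatio_zero hτ
    · have hne := invDen_ne_zero hτ hx hy h
      have heq : invRatio τ =ᶠ[𝓝 ((x : ℂ) + y * τ)] fun w => invNum τ w / invDen τ w := by
        filter_upwards [(differentiable_invDen hτ).continuous.continuousAt.eventually_ne hne]
          with w hw
        rw [invRatio, if_neg hw]
      exact ((differentiable_invNum hτ).differentiableAt.div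
        (differentiable_invDen hτ).differentiableAt hne).congr_of_eventuallyEq heq
  intro w
  obtain ⟨x, y, a, b, hx, hy, rfl⟩ := exists_lattice_reduction hτ w
  have hfun : invRatio τ = fun v => invRatio τ (v - (a * 1 + b * τ)) := by
    funext v
    have := invRatio_reduce hτ (v - (a * 1 + b * τ)) a b
    rw [← this]
    congr 1
    ring
  rw [hfun]
  have h1 : DifferentiableAt ℂ (invRatio τ)
      ((x : ℂ) + y * τ + a * 1 + b * τ - (a * 1 + b * τ)) := by
    rw [show (x : ℂ) + y * τ + a * 1 + b * τ - (a * 1 + b * τ) = x + y * τ by ring]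
    exact hbase x y hx hy
  exact h1.comp ((x : ℂ) + y * τ + a * 1 + b * τ)
    (f := fun v : ℂ => v - (a * 1 + b * τ)) (by fun_prop)

/-- Liouville: an entire function with periods 1 and τ is bounded by its values on a compact
parallelogram, hence constant, and the constant is read off at 0. -/
lemma invRatio_eq (hτ : 0 < τ.im) (w : ℂ) : invRatio τ w =
    τ * euler (exp (2 * Real.pi * I * τ)) ^ 2 / euler (exp (2 * Real.pi * I * (-1 / τ))) ^ 2 := by
  have hcont := (differentiable_invRatio hτ).continuous
  have hb : Bornology.IsBounded (Set.range (invRatio τ)) := by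
    have hK : IsCompact ((fun p : ℝ × ℝ => invRatio τ (p.1 + p.2 * τ)) ''
        (Set.Icc (-(1 / 2)) (1 / 2) ×ˢ Set.Icc (-(1 / 2)) (1 / 2))) :=
      (isCompact_Icc.prod isCompact_Icc).image (by fun_prop)
    refine hK.isBounded.subset ?_
    rintro _ ⟨w, rfl⟩
    obtain ⟨x, y, a, b, hx, hy, rfl⟩ := exists_lattice_reduction hτ w
    exact ⟨(x, y), ⟨abs_le.1 hx, abs_le.1 hy⟩, (invRatio_reduce hτ _ a b).symm⟩
  rw [(differentiable_invRatio hτ).apply_eq_apply_of_bounded hb w 0, invRatio, if_pos]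
  simp [invDen, sigmaFun]

end Transformation

/-- Inversion formula for the quotient `g` in terms of `q = e^{-z}`. -/
lemma euler_sq_div_thetaProd_eq {z : ℂ} (hz : 0 < z.re) {w : ℝ} (hw0 : 0 < w) (hw : w ≤ 1 / 2) :
    euler (exp (-z)) ^ 2 / thetaProd (exp (2 * Real.pi * I * w)) (exp (-z)) =
      2 * Real.pi / z * exp (2 * Real.pi ^ 2 * w ^ 2 / z) *
        (sin (Real.pi * w) / sinh (2 * Real.pi ^ 2 * w / z)) *
        (euler (exp (-(4 * Real.pi ^ 2 / z))) ^ 2 /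
          thetaProd (exp (4 * Real.pi ^ 2 * w / z)) (exp (-(4 * Real.pi ^ 2 / z)))) := by
  have hz0 : z ≠ 0 := by rintro rfl; simp at hz
  have hpi0 : (Real.pi : ℂ) ≠ 0 := ofReal_ne_zero.2 Real.pi_ne_zero
  -- This τ has nome e^{-z}, while -1/τ = 2πi/z has nome e^{-4π²/z}; the imaginary argument w/τ
  -- turns the sine into a hyperbolic sine.
  set τ := I * z / (2 * Real.pi) with hτdef
  have hτ : 0 < τ.im := by
    rw [hτdef, tau_im]
    exact div_pos hz Real.two_pi_pos
  have h0 : τ ≠ 0 := by rintro h; simp [h] at hτ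
  have hq : exp (2 * Real.pi * I * τ) = exp (-z) := by rw [hτdef, two_pi_mul_tau]
  have hinv : τ⁻¹ = -(2 * Real.pi * I / z) := by
    rw [hτdef]
    field_simp
    simp
  have hq' : exp (2 * Real.pi * I * (-1 / τ)) = exp (-(4 * Real.pi ^ 2 / z)) := by
    rw [neg_div, one_div, hinv]
    congr 1
    linear_combination (4 * (Real.pi : ℂ) ^ 2 / z) * I_sq
  have hz' : exp (2 * Real.pi * I * (w / τ)) = exp (4 * Real.pi ^ 2 * w / z) := by
    rw [div_eq_mul_inv (w : ℂ), hinv]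
    congr 1
    linear_combination (-4 * (Real.pi : ℂ) ^ 2 * w / z) * I_sq
  have hsin : sin (Real.pi * (w / τ)) = -(sinh (2 * Real.pi ^ 2 * w / z) * I) := by
    rw [← sin_mul_I, ← Complex.sin_neg, div_eq_mul_inv (w : ℂ), hinv]
    congr 1
    ring
  have hexp : exp (Real.pi * I * w ^ 2 / τ) = exp (2 * Real.pi ^ 2 * w ^ 2 / z) := by
    rw [div_eq_mul_inv _ τ, hinv]
    congr 1
    linear_combination (-2 * (Real.pi : ℂ) ^ 2 * w ^ 2 / z) * I_sq
  have hden := invDen_ne_zero hτ (x := w) (y := 0) (abs_le.2 ⟨by linarith, hw⟩) (by simp)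
    (by simpa using hw0.ne')
  simp only [ofReal_zero, zero_mul, add_zero] at hden
  have hmain := invRatio_eq hτ w
  rw [invRatio, if_neg hden, invNum, invDen, sigmaFun, sigmaFun, hq, hq', hz', hsin, hexp] at hmain
  have hE := euler_ne_zero (q := exp (-(4 * Real.pi ^ 2 / z))) (by
    rw [← hq']; exact norm_exp_tau_lt_one (im_neg_inv_pos hτ))
  rw [invDen, sigmaFun, hz', hsin, hq'] at hden
  have hT : thetaProd (exp (2 * Real.pi * I * w)) (exp (-z)) ≠ 0 := by
    have hn : ‖exp (-z)‖ < 1 := by rw [← hq]; exact norm_exp_tau_lt_one hτ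
    refine thetaProd_ne_zero hn ?_ ?_
    · rw [norm_mul, norm_exp_two_pi_ofReal, one_mul]; exact hn
    · rw [norm_mul, norm_inv, norm_exp_two_pi_ofReal, inv_one, one_mul]; exact hn
  obtain ⟨hS, hT'⟩ := mul_ne_zero_iff.1 hden
  have hS' : sinh (2 * Real.pi ^ 2 * w / z) ≠ 0 := by
    intro h; rw [h] at hS; simp at hS
  generalize thetaProd (exp (2 * Real.pi * I * w)) (exp (-z)) = T at *
  generalize thetaProd (exp (4 * Real.pi ^ 2 * w / z)) (exp (-(4 * Real.pi ^ 2 / z))) = T' at *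
  generalize euler (exp (-(4 * Real.pi ^ 2 / z))) = P' at *
  generalize euler (exp (-z)) = P at *
  generalize sinh (2 * Real.pi ^ 2 * w / z) = S at *
  generalize exp (2 * Real.pi ^ 2 * w ^ 2 / z) = E at *
  rw [div_eq_div_iff (mul_ne_zero hS hT') (pow_ne_zero 2 hE), hτdef] at hmain
  have hI := I_sq
  have h2 : I * z / (2 * Real.pi) * P ^ 2 * (-(S * I) * T') = z / (2 * Real.pi) * P ^ 2 * S * T' := by
    linear_combination (-(z / (2 * Real.pi) * P ^ 2 * S * T')) * hI
  rw [h2] at hmain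
  field_simp at hmain ⊢
  linear_combination -hmain

/-- Inversion formula of the Dedekind eta function in terms of `q = e^{-z}`. -/
lemma exp_div_euler_pow_eq (k : ℕ) {z : ℂ} (hz : 0 < z.re) :
    exp (k * z / 24) / euler (exp (-z)) ^ k =
      (z / (2 * Real.pi)) ^ ((k : ℂ) / 2) * exp (k * Real.pi ^ 2 / (6 * z)) /
        euler (exp (-(4 * Real.pi ^ 2 / z))) ^ k := by
  have hz0 : z ≠ 0 := by rintro rfl; simp at hz
  have hpi0 : (Real.pi : ℂ) ≠ 0 := ofReal_ne_zero.2 Real.pi_ne_zero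
  set τ := I * z / (2 * Real.pi) with hτdef
  have hτ : 0 < τ.im := by
    rw [hτdef, tau_im]
    exact div_pos hz Real.two_pi_pos
  have h0 : τ ≠ 0 := by rintro h; simp [h] at hτ
  have hq : exp (2 * Real.pi * I * τ) = exp (-z) := by rw [hτdef, two_pi_mul_tau]
  have hinv : τ⁻¹ = -(2 * Real.pi * I / z) := by
    rw [hτdef]
    field_simp
    simp
  have hq' : 2 * Real.pi * I * (-1 / τ) = -(4 * Real.pi ^ 2 / z) := by
    rw [neg_div, one_div, hinv]
    linear_combination (4 * (Real.pi : ℂ) ^ 2 / z) * I_sq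
  have hv0 : z / (2 * Real.pi) ≠ 0 := div_ne_zero hz0 (mul_ne_zero two_ne_zero hpi0)
  have hvre : 0 < (z / (2 * Real.pi)).re := by
    have : z / (2 * Real.pi) = ((1 / (2 * Real.pi) : ℝ) : ℂ) * z := by push_cast; ring
    rw [this, re_ofReal_mul]
    exact mul_pos (by have := Real.two_pi_pos; positivity) hz
  -- Branch check: arg i = π/2 and |arg (z/2π)| < π/2, so the principal logarithms of i and z/2π add
  -- up without leaving (-π, π].
  have hsq : (sqrt I)⁻¹ * sqrt τ = (z / (2 * Real.pi)) ^ ((1 : ℂ) / 2) := by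
    rw [show τ = I * (z / (2 * Real.pi)) by rw [hτdef]; ring, sqrt_eq_exp I_ne_zero,
      sqrt_eq_exp (mul_ne_zero I_ne_zero hv0), Complex.log_mul I_ne_zero hv0, ← exp_neg, ← exp_add,
      cpow_def_of_ne_zero hv0]
    · congr 1; ring
    · rw [arg_I]
      have := abs_lt.1 (abs_arg_lt_pi_div_two_iff.2 (Or.inl hvre))
      constructor <;> linarith [Real.pi_pos]
  have heta : ModularForm.eta (-1 / τ) = (sqrt I)⁻¹ * (sqrt τ * ModularForm.eta τ) := by
    simpa using ModularForm.eta_comp_eq_csqrt_I_inv (show τ ∈ _ from hτ)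
  rw [← mul_assoc, hsq, eta_eq, eta_eq, hq, hq', two_pi_mul_tau] at heta
  have hE := euler_ne_zero (q := exp (-z)) (by
    rw [← hq]; exact norm_exp_tau_lt_one hτ)
  have hE' := euler_ne_zero (q := exp (-(4 * Real.pi ^ 2 / z))) (by
    rw [← hq']; exact norm_exp_tau_lt_one (im_neg_inv_pos hτ))
  have hk := congrArg (· ^ k) heta
  simp only [mul_pow, ← exp_nat_mul, ← cpow_nat_mul] at hk
  rw [div_eq_div_iff (pow_ne_zero _ hE) (pow_ne_zero _ hE')]
  have e1 : exp (k * z / 24) * exp (k * (-z / 24)) = 1 := by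
    rw [← exp_add, ← exp_zero]; congr 1; ring
  have e2 : exp (k * Real.pi ^ 2 / (6 * z)) * exp (k * (-(4 * Real.pi ^ 2 / z) / 24)) = 1 := by
    rw [← exp_add, ← exp_zero]; congr 1; field_simp; ring
  rw [show (k : ℂ) * (1 / 2) = k / 2 by ring] at hk
  generalize exp (k * z / 24) = A at *
  generalize exp (k * (-z / 24)) = A' at *
  generalize exp (k * Real.pi ^ 2 / (6 * z)) = B at *
  generalize exp (k * (-(4 * Real.pi ^ 2 / z) / 24)) = B' at *
  generalize (z / (2 * Real.pi)) ^ ((k : ℂ) / 2) = v at *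
  linear_combination (A * B) * hk - (euler (exp (-(4 * Real.pi ^ 2 / z))) ^ k * A) * e2 +
    (v * B * euler (exp (-z)) ^ k) * e1

end ChiGenus

/-! ### Partial fractions and a polynomial bound for g on |ζ| = 1 -/

namespace ChiGenus

open Complex MeasureTheory Filter Topology

/-- Partial fraction decomposition of `∏ vᵢ / (vᵢ - t)`. -/
lemma prod_div_sub_eq_sum {ι K : Type*} [DecidableEq ι] [Field K] {s : Finset ι} {v : ι → K}
    (hv : Set.InjOn v s) (hs : s.Nonempty) {t : K} (ht : ∀ i ∈ s, v i - t ≠ 0) :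
    ∏ i ∈ s, v i / (v i - t) =
      ∑ j ∈ s, (∏ i ∈ s.erase j, v i / (v i - v j)) * (v j / (v j - t)) := by
  -- The Lagrange basis at the nodes v sums to 1; evaluating at t and multiplying by the product
  -- gives the decomposition.
  have h1 := congrArg (Polynomial.eval t) (Lagrange.sum_basis hv hs)
  rw [Polynomial.eval_finsetSum, Polynomial.eval_one] at h1
  rw [← mul_one (∏ i ∈ s, v i / (v i - t)), ← h1, Finset.mul_sum]
  refine Finset.sum_congr rfl fun j hj => ?_
  rw [Lagrange.basis, Polynomial.eval_prod, ← Finset.mul_prod_erase s _ hj, mul_assoc,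
    ← Finset.prod_mul_distrib, mul_comm]
  congr 1
  refine Finset.prod_congr rfl fun i hi => ?_
  obtain ⟨hij, his⟩ := Finset.mem_erase.1 hi
  have h2 := ht i his
  have h3 : v i - v j ≠ 0 := sub_ne_zero.2 fun h => hij (hv his hj h)
  have h4 : v j - v i ≠ 0 := sub_ne_zero.2 fun h => hij (hv his hj h.symm)
  simp only [Lagrange.basisDivisor, Polynomial.eval_mul, Polynomial.eval_C, Polynomial.eval_sub,
    Polynomial.eval_X]
  rw [← neg_sub (v i) (v j), ← neg_sub (v i) t, inv_neg, neg_mul_neg]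
  field_simp

/-- The finite Pochhammer symbol `(q; q)_n`. -/
noncomputable def qFac (q : ℂ) (n : ℕ) : ℂ := ∏ i ∈ Finset.range n, (1 - q ^ (i + 1))

section PartialFractions

variable {q : ℂ}

lemma one_sub_pow_ne_zero (hq : ‖q‖ < 1) (n : ℕ) : 1 - q ^ (n + 1) ≠ 0 := by
  rw [sub_ne_zero]
  intro h
  have := pow_lt_one₀ (norm_nonneg q) hq n.succ_ne_zero
  rw [← norm_pow, Nat.succ_eq_add_one, ← h] at this
  simp at this

lemma qFac_ne_zero (hq : ‖q‖ < 1) (n : ℕ) : qFac q n ≠ 0 :=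
  Finset.prod_ne_zero_iff.2 fun i _ => one_sub_pow_ne_zero hq i

lemma qFac_succ (q : ℂ) (n : ℕ) : qFac q (n + 1) = qFac q n * (1 - q ^ (n + 1)) :=
  Finset.prod_range_succ _ _

lemma qFac_add (q : ℂ) (n m : ℕ) :
    qFac q (n + m) = qFac q n * ∏ i ∈ Finset.range m, (1 - q ^ (n + i + 1)) :=
  Finset.prod_range_add _ _ _

lemma tendsto_prod_qPoch (x : ℂ) (hq : ‖q‖ < 1) :
    Tendsto (fun N : ℕ => ∏ i ∈ Finset.range N, (1 - x * q ^ i)) atTop (𝓝 (qPoch x q)) :=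
  (multipliable_qPoch x hq).hasProd.tendsto_prod_nat

lemma tendsto_qFac (hq : ‖q‖ < 1) : Tendsto (qFac q) atTop (𝓝 (euler q)) := by
  have := tendsto_prod_qPoch q hq
  simp only [← pow_succ'] at this
  exact this

/-- Convergence to a nonzero limit bounds both the sequence and its inverse. The uniform constant
provides the majorant when the number of nodes tends to infinity. -/
lemma exists_qFac_bounds (hq : ‖q‖ < 1) :
    ∃ C : ℝ, 0 < C ∧ ∀ n, ‖qFac q n‖ ≤ C ∧ ‖(qFac q n)⁻¹‖ ≤ C := by
  obtain ⟨C₁, h₁⟩ := (Metric.isBounded_range_of_tendsto _ (tendsto_qFac hq)).exists_norm_le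
  obtain ⟨C₂, h₂⟩ := (Metric.isBounded_range_of_tendsto _
    ((tendsto_qFac hq).inv₀ (euler_ne_zero hq))).exists_norm_le
  refine ⟨max 1 (max C₁ C₂), by positivity, fun n => ⟨?_, ?_⟩⟩
  · exact (h₁ _ ⟨n, rfl⟩).trans ((le_max_left _ _).trans (le_max_right _ _))
  · exact (h₂ _ ⟨n, rfl⟩).trans ((le_max_right _ _).trans (le_max_right _ _))

/-- The nodes of the partial fraction decomposition. -/
noncomputable def node (q : ℂ) (i : ℕ) : ℂ := (1 - q ^ (i + 1)) ^ 2 / q ^ (i + 1)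

/-- In the variable t = ζ + ζ⁻¹ - 2 each pair of theta factors becomes linear, so finite products
are rational functions of t with simple poles at the nodes. -/
lemma node_sub (hq0 : q ≠ 0) {ζ : ℂ} (hζ : ζ ≠ 0) (i : ℕ) :
    node q i - (ζ + ζ⁻¹ - 2) = (1 - ζ * q ^ (i + 1)) * (1 - ζ⁻¹ * q ^ (i + 1)) / q ^ (i + 1) := by
  have := pow_ne_zero (i + 1) hq0
  rw [node]
  field_simp
  ring

lemma node_div_sub (hq0 : q ≠ 0) {ζ : ℂ} (hζ : ζ ≠ 0) (i : ℕ) :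
    node q i / (node q i - (ζ + ζ⁻¹ - 2)) =
      (1 - q ^ (i + 1)) ^ 2 / ((1 - ζ * q ^ (i + 1)) * (1 - ζ⁻¹ * q ^ (i + 1))) := by
  rw [node_sub hq0 hζ, node, div_div_div_cancel_right₀ (pow_ne_zero _ hq0)]

/-- The node is the value of ζ + ζ⁻¹ - 2 at ζ = q^{j+1}, so `node_div_sub` also handles differences
of nodes. -/
lemma node_eq (hq0 : q ≠ 0) (j : ℕ) : node q j = q ^ (j + 1) + (q ^ (j + 1))⁻¹ - 2 := by
  have := pow_ne_zero (j + 1) hq0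
  rw [node]
  field_simp
  ring

lemma node_div_sub_of_lt (hq0 : q ≠ 0) (hq : ‖q‖ < 1) {i j : ℕ} (hij : i < j) :
    node q i / (node q i - node q j) = -(1 - q ^ (i + 1)) ^ 2 * q ^ (j - i) /
      ((1 - q ^ (j - i)) * (1 - q ^ (j + 1 + i + 1))) := by
  obtain ⟨l, rfl⟩ := Nat.exists_eq_add_of_lt hij
  rw [node_eq hq0 (i + l + 1), node_div_sub hq0 (pow_ne_zero _ hq0)]
  rw [show i + l + 1 - i = l + 1 by omega, ← inv_pow]
  have h1 := one_sub_pow_ne_zero hq l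
  have h2 := one_sub_pow_ne_zero hq (i + l + 1 + 1 + i)
  have h3 := pow_ne_zero (l + 1) hq0
  have e1 : q ^ (i + l + 1 + 1) * q ^ (i + 1) = q ^ (i + l + 1 + 1 + i + 1) := by
    rw [← pow_add]; congr 1
  have e2 : q⁻¹ ^ (i + l + 1 + 1) * q ^ (i + 1) = (q ^ (l + 1))⁻¹ := by
    have := pow_ne_zero (i + 1) hq0
    rw [show i + l + 1 + 1 = (l + 1) + (i + 1) by ring, inv_pow, pow_add]
    field_simp
  have h4 : 1 - (q ^ (l + 1))⁻¹ = -(1 - q ^ (l + 1)) / q ^ (l + 1) := by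
    field_simp
    ring
  rw [e1, e2, h4]
  field_simp

lemma node_div_sub_of_gt (hq0 : q ≠ 0) (j l : ℕ) :
    node q (j + 1 + l) / (node q (j + 1 + l) - node q j) = (1 - q ^ (j + 1 + l + 1)) ^ 2 /
      ((1 - q ^ (l + 1)) * (1 - q ^ (2 * j + 2 + l + 1))) := by
  rw [node_eq hq0 j, node_div_sub hq0 (pow_ne_zero _ hq0)]
  have e1 : q ^ (j + 1) * q ^ (j + 1 + l + 1) = q ^ (2 * j + 2 + l + 1) := by
    rw [← pow_add]; congr 1; ring
  have e2 : (q ^ (j + 1))⁻¹ * q ^ (j + 1 + l + 1) = q ^ (l + 1) := by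
    have := pow_ne_zero (j + 1) hq0
    rw [show j + 1 + l + 1 = (j + 1) + (l + 1) by ring, pow_add q (j + 1) (l + 1),
      inv_mul_cancel_left₀ this]
  rw [e1, e2, mul_comm]

/-- The factors assemble into q-factorials once the order is reversed in those with exponent j - i;
the numerators left over produce (-1)^j q^{j(j+1)/2}. -/
lemma prod_node_lt (hq0 : q ≠ 0) (hq : ‖q‖ < 1) (j : ℕ) :
    ∏ i ∈ Finset.range j, node q i / (node q i - node q j) =
      (∏ i ∈ Finset.range j, -q ^ (i + 1)) * (qFac q j * qFac q (j + 1) / qFac q (2 * j + 1)) := by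
  have h1 : ∏ i ∈ Finset.range j, node q i / (node q i - node q j) =
      ∏ i ∈ Finset.range j, ((-q ^ (j - i)) * ((1 - q ^ (i + 1)) ^ 2 *
        ((1 - q ^ (j - i))⁻¹ * (1 - q ^ (j + 1 + i + 1))⁻¹))) := by
    refine Finset.prod_congr rfl fun i hi => ?_
    rw [node_div_sub_of_lt hq0 hq (Finset.mem_range.1 hi), div_eq_mul_inv, mul_inv]
    ring
  have hrefl (F : ℕ → ℂ) : ∏ i ∈ Finset.range j, F (j - i) = ∏ i ∈ Finset.range j, F (i + 1) := by
    rw [← Finset.prod_range_reflect]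
    refine Finset.prod_congr rfl fun i hi => ?_
    have := Finset.mem_range.1 hi
    congr 1
    omega
  rw [h1]
  simp only [Finset.prod_mul_distrib, Finset.prod_inv_distrib, Finset.prod_pow]
  rw [hrefl (fun n => -q ^ n), hrefl (fun n => 1 - q ^ n)]
  change _ * (qFac q j ^ 2 * ((qFac q j)⁻¹ * _)) = _
  have h2 := qFac_add q (j + 1) j
  rw [show j + 1 + j = 2 * j + 1 by ring] at h2
  have h3 := qFac_ne_zero hq j
  have h4 := qFac_ne_zero hq (j + 1)
  have h5 := qFac_ne_zero hq (2 * j + 1)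
  rw [h2] at h5 ⊢
  obtain ⟨_, h6⟩ := mul_ne_zero_iff.1 h5
  congr 1
  field_simp

lemma prod_node_gt (hq0 : q ≠ 0) (hq : ‖q‖ < 1) (j M : ℕ) :
    ∏ l ∈ Finset.range M, node q (j + 1 + l) / (node q (j + 1 + l) - node q j) =
      qFac q (j + 1 + M) ^ 2 * qFac q (2 * j + 2) /
        (qFac q (j + 1) ^ 2 * qFac q M * qFac q (2 * j + 2 + M)) := by
  simp only [node_div_sub_of_gt hq0, Finset.prod_div_distrib, Finset.prod_mul_distrib,
    Finset.prod_pow]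
  rw [qFac_add q (j + 1) M]
  have h1 := qFac_add q (2 * j + 2) M
  have h2 := qFac_ne_zero hq (2 * j + 2 + M)
  have h3 := qFac_ne_zero hq (j + 1)
  have h4 := qFac_ne_zero hq M
  rw [h1] at h2 ⊢
  change _ / (qFac q M * _) = _
  obtain ⟨h5, h6⟩ := mul_ne_zero_iff.1 h2
  field_simp

/-- The coefficients of the partial fraction decomposition. -/
lemma prod_erase_node (hq0 : q ≠ 0) (hq : ‖q‖ < 1) (j M : ℕ) :
    ∏ i ∈ (Finset.range (j + 1 + M)).erase j, node q i / (node q i - node q j) =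
      (∏ i ∈ Finset.range j, -q ^ (i + 1)) * (1 + q ^ (j + 1)) *
        (qFac q (j + 1 + M) ^ 2 * ((qFac q M)⁻¹ * (qFac q (2 * j + 2 + M))⁻¹)) := by
  have hsplit : ∏ i ∈ (Finset.range (j + 1 + M)).erase j, node q i / (node q i - node q j) =
      (∏ i ∈ Finset.range j, node q i / (node q i - node q j)) *
        ∏ l ∈ Finset.range M, node q (j + 1 + l) / (node q (j + 1 + l) - node q j) := by
    let F : ℕ → ℂ := fun i => if i = j then 1 else node q i / (node q i - node q j)
    have h1 : ∏ i ∈ (Finset.range (j + 1 + M)).erase j, node q i / (node q i - node q j) =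
        ∏ i ∈ Finset.range (j + 1 + M), F i := by
      rw [← Finset.mul_prod_erase _ F (show j ∈ Finset.range (j + 1 + M) by
        rw [Finset.mem_range]; omega)]
      simp only [F, if_true, one_mul]
      refine Finset.prod_congr rfl fun i hi => ?_
      rw [if_neg (Finset.ne_of_mem_erase hi)]
    rw [h1, Finset.prod_range_add, Finset.prod_range_succ]
    simp only [F, if_true, mul_one]
    congr 1
    · refine Finset.prod_congr rfl fun i hi => ?_
      rw [if_neg (Finset.mem_range.1 hi).ne]
    · refine Finset.prod_congr rfl fun i _ => ?_
      rw [if_neg (by omega)]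
  rw [hsplit, prod_node_lt hq0 hq, prod_node_gt hq0 hq]
  -- Of the two factors of 1 - q^{2j+2}, the first cancels against `qFac q (j + 1)` and 1 + q^{j+1}
  -- survives in the coefficient.
  have e1 : qFac q (2 * j + 2) = qFac q (2 * j + 1) * ((1 - q ^ (j + 1)) * (1 + q ^ (j + 1))) := by
    rw [qFac_succ q (2 * j + 1)]
    congr 1
    ring
  have e2 := qFac_succ q j
  have h1 := qFac_ne_zero hq j
  have h2 := one_sub_pow_ne_zero hq j
  have h3 := qFac_ne_zero hq (2 * j + 1)
  have h4 := qFac_ne_zero hq (2 * j + 2 + M)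
  have h5 := qFac_ne_zero hq M
  rw [e1, e2]
  field_simp

lemma node_injective (hq0 : q ≠ 0) (hq : ‖q‖ < 1) : Function.Injective (node q) := by
  have hne (j l : ℕ) : node q (j + 1 + l) ≠ node q j := by
    intro h
    have h1 := node_div_sub_of_gt hq0 j l
    rw [h, sub_self, div_zero] at h1
    refine div_ne_zero (pow_ne_zero 2 ?_) (mul_ne_zero ?_ ?_) h1.symm
    all_goals exact one_sub_pow_ne_zero hq _
  intro i j hij
  rcases lt_trichotomy i j with h | h | h
  · obtain ⟨l, rfl⟩ := Nat.exists_eq_add_of_lt h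
    exact absurd hij.symm (by simpa [add_right_comm] using hne i l)
  · exact h
  · obtain ⟨l, rfl⟩ := Nat.exists_eq_add_of_lt h
    exact absurd hij (by simpa [add_right_comm] using hne j l)

lemma one_sub_norm_le_norm {ζ : ℂ} (hζ : ‖ζ‖ = 1) (hq : ‖q‖ < 1) (i : ℕ) :
    1 - ‖q‖ ≤ ‖1 - ζ * q ^ (i + 1)‖ := by
  have h1 : ‖ζ * q ^ (i + 1)‖ ≤ ‖q‖ := by
    rw [norm_mul, hζ, one_mul, norm_pow]
    exact pow_le_of_le_one (norm_nonneg q) hq.le i.succ_ne_zero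
  have h2 := norm_sub_norm_le (1 : ℂ) (ζ * q ^ (i + 1))
  rw [norm_one] at h2
  linarith

lemma norm_node_div_le {ζ : ℂ} (hζ : ‖ζ‖ = 1) (hq0 : q ≠ 0) (hq : ‖q‖ < 1) (i : ℕ) :
    ‖node q i / (node q i - (ζ + ζ⁻¹ - 2))‖ ≤ 4 / (1 - ‖q‖) ^ 2 := by
  have hζ0 : ζ ≠ 0 := by rintro rfl; simp at hζ
  have hpos : 0 < 1 - ‖q‖ := by linarith
  rw [node_div_sub hq0 hζ0, norm_div, norm_mul, norm_pow]
  have h1 : ‖1 - q ^ (i + 1)‖ ≤ 2 := by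
    refine (norm_sub_le _ _).trans ?_
    rw [norm_one, norm_pow]
    linarith [pow_le_one₀ (norm_nonneg q) hq.le (n := i + 1)]
  have h2 := one_sub_norm_le_norm hζ hq i
  have h3 := one_sub_norm_le_norm (ζ := ζ⁻¹) (by rw [norm_inv, hζ, inv_one]) hq i
  rw [sq (1 - ‖q‖)]
  gcongr
  calc ‖1 - q ^ (i + 1)‖ ^ 2 ≤ 2 ^ 2 := by gcongr
    _ = 4 := by norm_num

lemma norm_prod_neg_pow_le (hq : ‖q‖ < 1) (j : ℕ) :
    ‖∏ i ∈ Finset.range j, -q ^ (i + 1)‖ ≤ ‖q‖ ^ j := by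
  rw [norm_prod, Finset.pow_eq_prod_const ‖q‖ j]
  refine Finset.prod_le_prod (fun i _ => norm_nonneg _) fun i _ => ?_
  rw [norm_neg, norm_pow]
  exact pow_le_of_le_one (norm_nonneg q) hq.le i.succ_ne_zero

lemma norm_one_add_pow_le (hq : ‖q‖ < 1) (j : ℕ) : ‖1 + q ^ (j + 1)‖ ≤ 2 := by
  refine (norm_add_le _ _).trans ?_
  rw [norm_one, norm_pow]
  linarith [pow_le_one₀ (norm_nonneg q) hq.le (n := j + 1)]

/-- Partial fraction expansion of `∏_{n ≥ 1} (1 - q^n)² / ((1 - ζ q^n) (1 - ζ⁻¹ q^n))`. -/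
lemma euler_sq_div_thetaProd_eq_tsum {ζ : ℂ} (hζ : ‖ζ‖ = 1) (hq0 : q ≠ 0) (hq : ‖q‖ < 1) :
    euler q ^ 2 / thetaProd ζ q = ∑' j : ℕ, (∏ i ∈ Finset.range j, -q ^ (i + 1)) *
      (1 + q ^ (j + 1)) * (node q j / (node q j - (ζ + ζ⁻¹ - 2))) := by
  have hζ0 : ζ ≠ 0 := by rintro rfl; simp at hζ
  have hζ' : ‖ζ⁻¹‖ = 1 := by rw [norm_inv, hζ, inv_one]
  have hpos : 0 < 1 - ‖q‖ := by linarith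
  have hn0 (i : ℕ) : node q i - (ζ + ζ⁻¹ - 2) ≠ 0 := by
    rw [node_sub hq0 hζ0]
    have h1 := one_sub_norm_le_norm hζ hq i
    have h2 := one_sub_norm_le_norm hζ' hq i
    exact div_ne_zero (mul_ne_zero (norm_pos_iff.1 (by linarith)) (norm_pos_iff.1 (by linarith)))
      (pow_ne_zero _ hq0)
  have hlim : Tendsto (fun N : ℕ => ∏ i ∈ Finset.range N,
      node q i / (node q i - (ζ + ζ⁻¹ - 2))) atTop (𝓝 (euler q ^ 2 / thetaProd ζ q)) := by
    have hT : thetaProd ζ q ≠ 0 := by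
      refine thetaProd_ne_zero hq ?_ ?_
      · rwa [norm_mul, hζ, one_mul]
      · rwa [norm_mul, hζ', one_mul]
    have h := ((tendsto_qFac hq).pow 2).div
      ((tendsto_prod_qPoch (ζ * q) hq).mul (tendsto_prod_qPoch (ζ⁻¹ * q) hq)) hT
    refine h.congr fun N => ?_
    simp only [node_div_sub hq0 hζ0, Finset.prod_div_distrib, Finset.prod_mul_distrib,
      Finset.prod_pow, mul_assoc, ← pow_succ']
    rfl
  obtain ⟨C, hC, hCb⟩ := exists_qFac_bounds hq
  -- Tannery's theorem is applied to the j-th term of the decomposition with N nodes. Its dependence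
  -- on N is a quotient of q-factorials that is bounded and tends to E²/(E·E) = 1, while |q|^j gives
  -- a summable majorant.
  let F : ℕ → ℕ → ℂ := fun N j => if j < N then
    (∏ i ∈ (Finset.range N).erase j, node q i / (node q i - node q j)) *
      (node q j / (node q j - (ζ + ζ⁻¹ - 2))) else 0
  have hF (j M : ℕ) : F (j + 1 + M) j = (∏ i ∈ Finset.range j, -q ^ (i + 1)) * (1 + q ^ (j + 1)) *
      (qFac q (j + 1 + M) ^ 2 * ((qFac q M)⁻¹ * (qFac q (2 * j + 2 + M))⁻¹)) *
      (node q j / (node q j - (ζ + ζ⁻¹ - 2))) := by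
    simp only [F]
    rw [if_pos (by omega), prod_erase_node hq0 hq]
  have hsum (N : ℕ) (hN : 1 ≤ N) : ∑' j, F N j =
      ∏ i ∈ Finset.range N, node q i / (node q i - (ζ + ζ⁻¹ - 2)) := by
    rw [prod_div_sub_eq_sum ((node_injective hq0 hq).injOn) ⟨0, Finset.mem_range.2 hN⟩
      (fun i _ => hn0 i), tsum_eq_sum (s := Finset.range N)]
    · refine Finset.sum_congr rfl fun j hj => ?_
      simp only [F]
      rw [if_pos (Finset.mem_range.1 hj)]
    · intro j hj
      simp only [F]
      rw [if_neg (by simpa using hj)]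
  have hdom : Tendsto (fun N => ∑' j, F N j) atTop (𝓝 (∑' j : ℕ,
      (∏ i ∈ Finset.range j, -q ^ (i + 1)) * (1 + q ^ (j + 1)) *
        (node q j / (node q j - (ζ + ζ⁻¹ - 2))))) := by
    refine tendsto_tsum_of_dominated_convergence
      (bound := fun j => ‖q‖ ^ j * (2 * (C ^ 2 * (C * C)) * (4 / (1 - ‖q‖) ^ 2))) ?_ ?_ ?_
    · exact (summable_geometric_of_lt_one (norm_nonneg q) hq).mul_right _
    · intro j
      rw [← tendsto_add_atTop_iff_nat (j + 1)]
      have h1 : Tendsto (fun M => qFac q (j + 1 + M) ^ 2 *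
          ((qFac q M)⁻¹ * (qFac q (2 * j + 2 + M))⁻¹)) atTop
          (𝓝 (euler q ^ 2 * ((euler q)⁻¹ * (euler q)⁻¹))) := by
        have hs (a : ℕ) : Tendsto (fun M => qFac q (a + M)) atTop (𝓝 (euler q)) := by
          simpa only [add_comm a] using (tendsto_add_atTop_iff_nat a).2 (tendsto_qFac hq)
        exact ((hs (j + 1)).pow 2).mul (((tendsto_qFac hq).inv₀ (euler_ne_zero hq)).mul
          ((hs (2 * j + 2)).inv₀ (euler_ne_zero hq)))
      have h2 : euler q ^ 2 * ((euler q)⁻¹ * (euler q)⁻¹) = 1 := by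
        have := euler_ne_zero hq
        field_simp
      rw [h2] at h1
      have h3 := (h1.const_mul ((∏ i ∈ Finset.range j, -q ^ (i + 1)) *
        (1 + q ^ (j + 1)))).mul_const (node q j / (node q j - (ζ + ζ⁻¹ - 2)))
      rw [mul_one] at h3
      refine h3.congr fun M => ?_
      rw [add_comm M, hF]
    · refine .of_forall fun N j => ?_
      by_cases hj : j < N
      · obtain ⟨M, rfl⟩ := Nat.exists_eq_add_of_lt hj
        rw [show j + M + 1 = j + 1 + M by ring, hF]
        simp only [norm_mul, norm_pow, mul_assoc]
        gcongr
        · exact norm_prod_neg_pow_le hq j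
        · exact norm_one_add_pow_le hq j
        · exact (hCb _).1
        · exact (hCb _).2
        · exact (hCb _).2
        · exact norm_node_div_le hζ hq0 hq j
      · simp only [F]
        rw [if_neg hj, norm_zero]
        positivity
  refine tendsto_nhds_unique hlim (hdom.congr' ?_)
  filter_upwards [eventually_ge_atTop 1] with N hN
  exact hsum N hN

/-- Termwise estimate of the partial fractions: 2 · 4/(1-|q|)² from each term and one more 1/(1-|q|)
from the geometric sum. Estimating the product factor by factor would allow exponential growth and
destroy the saving on the minor arcs. -/
lemma norm_euler_sq_div_thetaProd_le {ζ : ℂ} (hζ : ‖ζ‖ = 1) (hq0 : q ≠ 0) (hq : ‖q‖ < 1) :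
    ‖euler q ^ 2 / thetaProd ζ q‖ ≤ 8 / (1 - ‖q‖) ^ 3 := by
  have hpos : 0 < 1 - ‖q‖ := by linarith
  rw [euler_sq_div_thetaProd_eq_tsum hζ hq0 hq]
  have h := (hasSum_geometric_of_lt_one (norm_nonneg q) hq).mul_right (2 * (4 / (1 - ‖q‖) ^ 2))
  refine (tsum_of_norm_bounded h fun j => ?_).trans_eq ?_
  · rw [norm_mul, norm_mul, mul_assoc]
    gcongr
    · exact norm_prod_neg_pow_le hq j
    · exact norm_one_add_pow_le hq j
    · exact norm_node_div_le hζ hq0 hq j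
  · field_simp
    norm_num

end PartialFractions

end ChiGenus

/-! ### Minor arcs -/

namespace ChiGenus

open Complex MeasureTheory Filter Topology

lemma norm_exp_neg (z : ℂ) : ‖exp (-z)‖ = Real.exp (-z.re) := by
  rw [Complex.norm_exp, neg_re]

lemma norm_exp_neg_lt_one {z : ℂ} (hz : 0 < z.re) : ‖exp (-z)‖ < 1 := by
  rw [norm_exp_neg, Real.exp_lt_one_iff]
  linarith

/-- The logarithm of the inverse Euler product as a Lambert series. -/
lemma hasSum_lambert {q : ℂ} (hq : ‖q‖ < 1) :
    HasSum (fun r : ℕ => q ^ (r + 1) / (1 - q ^ (r + 1)) / ((r : ℂ) + 1))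
      (∑' p, logTerm q q p) := by
  have hs := (summable_norm_logTerm hq hq).of_norm
  have hs' : HasSum (fun p : ℕ × ℕ => logTerm q q p.swap) (∑' p, logTerm q q p) :=
    (Equiv.prodComm ℕ ℕ).hasSum_iff.2 hs.hasSum
  refine hs'.prod_fiberwise fun r => ?_
  have hlt : ‖q ^ (r + 1)‖ < 1 := by
    rw [norm_pow]
    exact pow_lt_one₀ (norm_nonneg q) hq r.succ_ne_zero
  have h := ((hasSum_geometric_of_norm_lt_one hlt).mul_left (q ^ (r + 1))).div_const ((r : ℂ) + 1)
  rw [← div_eq_mul_inv] at h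
  refine h.congr_fun fun n => ?_
  simp only [logTerm, Prod.swap_prod_mk]
  rw [mul_pow]
  congr 2
  rw [← pow_mul, ← pow_mul, mul_comm]

/-- With s = (r+1) Re z this is s e^{-s} ≤ 1 - e^{-s}, that is, 1 + s ≤ e^s. -/
lemma norm_lambert_le {z : ℂ} (hz : 0 < z.re) (r : ℕ) :
    ‖exp (-z) ^ (r + 1) / (1 - exp (-z) ^ (r + 1))‖ ≤ 1 / (((r : ℝ) + 1) * z.re) := by
  have hs : 0 < ((r : ℝ) + 1) * z.re := by positivity
  set s := ((r : ℝ) + 1) * z.re with hsdef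
  have hn : ‖exp (-z) ^ (r + 1)‖ = Real.exp (-s) := by
    rw [norm_pow, norm_exp_neg, ← Real.exp_nat_mul]
    congr 1
    push_cast
    ring
  have hlt : Real.exp (-s) < 1 := by rw [Real.exp_lt_one_iff]; linarith
  have h1 : 1 - Real.exp (-s) ≤ ‖1 - exp (-z) ^ (r + 1)‖ := by
    have := norm_sub_norm_le (1 : ℂ) (exp (-z) ^ (r + 1))
    rwa [norm_one, hn] at this
  rw [norm_div, hn]
  have h2 : Real.exp (-s) * s ≤ 1 - Real.exp (-s) := by
    have h3 := Real.add_one_le_exp s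
    have h4 : Real.exp (-s) * Real.exp s = 1 := by rw [← Real.exp_add]; simp
    nlinarith [Real.exp_pos (-s)]
  rw [div_le_div_iff₀ (by linarith) hs]
  linarith

/-- For z = x + iy, |e^z - 1|² = (e^x - 1)² + 2e^x (1 - cos y). The first term is at least x², the
second at least (4/π²) y² ≥ (2/5) x², and 1 + 2/5 exceeds (10/9)². -/
lemma norm_lambert_zero_le {z : ℂ} (hz : 0 < z.re) (h1 : z.re ≤ |z.im|) (h2 : |z.im| ≤ Real.pi) :
    ‖exp (-z) / (1 - exp (-z))‖ ≤ 9 / 10 / z.re := by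
  have hcos := Real.cos_le_one_sub_mul_cos_sq h2
  have hpi : Real.pi ^ 2 < 10 := by
    have := Real.pi_lt_d2
    nlinarith [Real.pi_pos]
  have hsq : (10 / 9 * z.re) ^ 2 ≤ ‖exp z - 1‖ ^ 2 := by
    rw [← Complex.normSq_eq_norm_sq, Complex.normSq_apply]
    simp only [sub_re, sub_im, one_re, one_im, exp_re, exp_im, sub_zero]
    have hs := Real.sin_sq_add_cos_sq z.im
    have he := Real.add_one_le_exp z.re
    have hy : z.re ^ 2 ≤ z.im ^ 2 := by rw [← sq_abs z.im]; gcongr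
    have h4 : (2 / 5) * z.re ^ 2 ≤ 2 * (1 - Real.cos z.im) := by
      have : 2 / 10 * z.im ^ 2 ≤ 2 / Real.pi ^ 2 * z.im ^ 2 := by gcongr
      nlinarith
    have h5 : 2 * (1 - Real.cos z.im) ≤ Real.exp z.re * (2 * (1 - Real.cos z.im)) := by
      have : 0 ≤ 1 - Real.cos z.im := by linarith [Real.cos_le_one z.im]
      nlinarith
    have h6 : z.re ^ 2 ≤ (Real.exp z.re - 1) ^ 2 := by
      gcongr; linarith
    have h7 : (Real.exp z.re * Real.cos z.im - 1) * (Real.exp z.re * Real.cos z.im - 1) +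
        Real.exp z.re * Real.sin z.im * (Real.exp z.re * Real.sin z.im) =
        (Real.exp z.re - 1) ^ 2 + Real.exp z.re * (2 * (1 - Real.cos z.im)) := by
      linear_combination (Real.exp z.re ^ 2) * hs
    rw [h7]
    nlinarith
  have hle : 10 / 9 * z.re ≤ ‖exp z - 1‖ := 
    (pow_le_pow_iff_left₀ (by positivity) (norm_nonneg _) two_ne_zero).1 hsq
  have heq : exp (-z) / (1 - exp (-z)) = 1 / (exp z - 1) := by
    rw [exp_neg]
    have := exp_ne_zero z
    field_simp
  rw [heq, norm_div, norm_one, div_le_div_iff₀ (by nlinarith) hz]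
  linarith

/-- On the minor arcs the inverse Euler product is exponentially smaller than on the real axis. -/
lemma norm_inv_euler_le {z : ℂ} (hz : 0 < z.re) (h1 : z.re ≤ |z.im|) (h2 : |z.im| ≤ Real.pi) :
    ‖(euler (exp (-z)))⁻¹‖ ≤ Real.exp ((Real.pi ^ 2 / 6 - 1 / 10) / z.re) := by
  have hq := norm_exp_neg_lt_one hz
  rw [euler, qPoch_eq_exp hq hq, ← exp_neg, neg_neg]
  refine (Complex.norm_exp_le_exp_norm _).trans (Real.exp_le_exp.2 ?_)
  rw [← (hasSum_lambert hq).tsum_eq]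
  have hzeta : HasSum (fun r : ℕ => 1 / ((r : ℝ) + 1) ^ 2) (Real.pi ^ 2 / 6) := by
    have := (hasSum_nat_add_iff' 1).2 hasSum_zeta_two
    simpa using this
  -- Without the correction the majorant sums to ζ(2)/Re z; gaining 1/10 in the single term r = 0 is
  -- enough to lower the exponent.
  have hb : HasSum (fun r : ℕ => (1 / ((r : ℝ) + 1) ^ 2 - if r = 0 then 1 / 10 else 0) / z.re)
      ((Real.pi ^ 2 / 6 - 1 / 10) / z.re) :=
    (hzeta.sub (hasSum_ite_eq 0 (1 / 10))).div_const _
  refine tsum_of_norm_bounded hb fun r => ?_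
  rw [norm_div]
  have hr : ‖((r : ℂ) + 1)‖ = (r : ℝ) + 1 := by
    rw [show ((r : ℂ) + 1) = ((r + 1 : ℕ) : ℂ) by push_cast; ring, Complex.norm_natCast]
    push_cast; ring
  rw [hr]
  by_cases h0 : r = 0
  · subst h0
    have := norm_lambert_zero_le hz h1 h2
    simp only [zero_add, pow_one, CharP.cast_eq_zero, div_one, if_true, one_pow]
    convert this using 2
    norm_num
  · rw [if_neg h0, sub_zero, div_div, sq]
    refine (div_le_div_of_nonneg_right (norm_lambert_le hz r) (by positivity)).trans_eq ?_
    rw [div_div]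
    congr 1
    ring

lemma norm_fourierF_le (k : ℕ) (m : ℤ) {z : ℂ} (hz : 0 < z.re) (h1 : z.re ≤ |z.im|)
    (h2 : |z.im| ≤ Real.pi) :
    ‖fourierF k m z‖ ≤ Real.exp (k * z.re / 24) * ((8 / (1 - Real.exp (-z.re)) ^ 3) ^ 2 *
      Real.exp (k * ((Real.pi ^ 2 / 6 - 1 / 10) / z.re))) := by
  have hq := norm_exp_neg_lt_one hz
  have hb := intervalIntegral.norm_integral_le_of_norm_le_const (a := (-(1 / 2) : ℝ)) (b := 1 / 2)
    (f := fun w : ℝ => fz k z w * exp (-(2 * Real.pi * I * m * w)))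
    (C := Real.exp (k * z.re / 24) * ((8 / (1 - Real.exp (-z.re)) ^ 3) ^ 2 *
      Real.exp (k * ((Real.pi ^ 2 / 6 - 1 / 10) / z.re)))) ?_
  · rw [fourierF]
    refine hb.trans_eq ?_
    norm_num
  · intro w _
    have e1 : ‖exp (-(2 * Real.pi * I * m * w))‖ = 1 := by rw [Complex.norm_exp]; simp
    have e2 : ‖exp (k * z / 24)‖ = Real.exp (k * z.re / 24) := by
      rw [Complex.norm_exp]
      congr 1
      rw [show (k * z / 24 : ℂ) = ((k / 24 : ℝ) : ℂ) * z by push_cast; ring, re_ofReal_mul]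
      ring
    rw [norm_mul, e1, mul_one, fz, norm_mul, e2, core, div_eq_mul_inv _ (euler _ ^ k), norm_mul,
      norm_pow, ← inv_pow, norm_pow]
    have h3 := norm_euler_sq_div_thetaProd_le (norm_exp_two_pi_ofReal w) (exp_ne_zero (-z)) hq
    rw [norm_exp_neg] at h3
    have h4 := norm_inv_euler_le hz h1 h2
    have h5 : ‖(euler (exp (-z)))⁻¹‖ ^ k ≤
        Real.exp (k * ((Real.pi ^ 2 / 6 - 1 / 10) / z.re)) := by
      rw [Real.exp_nat_mul]
      gcongr
    gcongr

end ChiGenus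

/-! ### Laplace integrals and moments of 1/sinh² -/

namespace ChiGenus

open Complex MeasureTheory Filter Topology

section LaplaceIntegrals

lemma integrableOn_pow_mul_exp (n : ℕ) {b : ℝ} (hb : 0 < b) :
    IntegrableOn (fun x : ℝ => x ^ n * Real.exp (-(b * x))) (Set.Ioi 0) := by
  have h := integrableOn_rpow_mul_exp_neg_mul_rpow (p := 1) (s := n) (b := b)
    (by have : (0 : ℝ) ≤ n := Nat.cast_nonneg n
        linarith) one_pos hb
  simpa using h

lemma integrableOn_pow_mul_cexp (n : ℕ) {c : ℂ} (hc : 0 < c.re) :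
    IntegrableOn (fun x : ℝ => (x : ℂ) ^ n * exp (-(c * x))) (Set.Ioi 0) := by
  refine Integrable.mono' (integrableOn_pow_mul_exp n hc)
    (Continuous.aestronglyMeasurable (by fun_prop)) ?_
  refine (ae_restrict_iff' measurableSet_Ioi).2 (.of_forall fun x hx => ?_)
  rw [norm_mul, norm_pow, norm_real, Complex.norm_exp, Real.norm_of_nonneg (le_of_lt hx)]
  simp

lemma integral_pow_mul_cexp (n : ℕ) {c : ℂ} (hc : 0 < c.re) :
    ∫ x : ℝ in Set.Ioi 0, (x : ℂ) ^ n * exp (-(c * x)) = n.factorial / c ^ (n + 1) := by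
  have hc0 : c ≠ 0 := by rintro rfl; simp at hc
  induction n with
  | zero =>
    have h := integral_exp_mul_complex_Ioi (a := -c) (by simpa using hc) 0
    simp only [neg_mul, ofReal_zero, mul_zero, exp_zero] at h
    simp [h]
  | succ n ih =>
    have hderiv (x : ℝ) : HasDerivAt (fun x : ℝ => (x : ℂ) ^ (n + 1) * exp (-(c * x)))
        (((n + 1 : ℕ) : ℂ) * ((x : ℂ) ^ n * exp (-(c * x))) -
          c * ((x : ℂ) ^ (n + 1) * exp (-(c * x)))) x := by
      have h1 : HasDerivAt (fun x : ℂ => x ^ (n + 1) * exp (-(c * x)))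
          (((n + 1 : ℕ) : ℂ) * (x : ℂ) ^ n * exp (-(c * x)) +
            (x : ℂ) ^ (n + 1) * (exp (-(c * x)) * -(c * 1))) x := by
        have := (hasDerivAt_pow (n + 1) (x : ℂ)).mul
          (((hasDerivAt_id (x : ℂ)).const_mul c).neg.cexp)
        refine this.congr_deriv ?_
        simp
      have h2 := h1.comp_ofReal
      convert h2 using 1
      ring
    have hinteg := ((integrableOn_pow_mul_cexp n hc).const_mul ((n + 1 : ℕ) : ℂ)).sub
      ((integrableOn_pow_mul_cexp (n + 1) hc).const_mul c)
    have hlim : Tendsto (fun x : ℝ => (x : ℂ) ^ (n + 1) * exp (-(c * x))) atTop (𝓝 0) := by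
      rw [tendsto_zero_iff_norm_tendsto_zero]
      have h : Tendsto (fun x : ℝ => x ^ (n + 1) * Real.exp (-(c.re * x))) atTop (𝓝 0) := by
        have h1 := ((Real.tendsto_pow_mul_exp_neg_atTop_nhds_zero (n + 1)).comp
          (tendsto_id.const_mul_atTop hc)).const_mul ((c.re ^ (n + 1))⁻¹)
        rw [mul_zero] at h1
        refine h1.congr fun x => ?_
        have := (pow_pos hc (n + 1)).ne'
        simp only [Function.comp_def, id, mul_pow]
        field_simp
      refine h.congr' ?_
      filter_upwards [eventually_ge_atTop 0] with x hx
      rw [norm_mul, norm_pow, norm_real, Complex.norm_exp, Real.norm_of_nonneg hx]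
      simp
    have h := integral_Ioi_of_hasDerivAt_of_tendsto
      (hderiv 0).continuousAt.continuousWithinAt (fun x _ => hderiv x) hinteg hlim
    rw [integral_sub ((integrableOn_pow_mul_cexp n hc).const_mul _)
      ((integrableOn_pow_mul_cexp (n + 1) hc).const_mul c), integral_const_mul,
      integral_const_mul, ih] at h
    simp only [ofReal_zero, ne_eq, Nat.add_eq_zero_iff, one_ne_zero, and_false, not_false_eq_true,
      zero_pow, zero_mul, sub_zero] at h
    have h3 : c * ∫ x : ℝ in Set.Ioi 0, (x : ℂ) ^ (n + 1) * exp (-(c * x)) =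
        ((n + 1 : ℕ) : ℂ) * (n.factorial / c ^ (n + 1)) := by linear_combination -h
    rw [eq_div_iff (pow_ne_zero _ hc0), Nat.factorial_succ, Nat.cast_mul, pow_succ, pow_succ] at *
    field_simp at h3
    linear_combination h3

lemma integral_pow_mul_exp (n : ℕ) {b : ℝ} (hb : 0 < b) :
    ∫ x : ℝ in Set.Ioi 0, x ^ n * Real.exp (-(b * x)) = n.factorial / b ^ (n + 1) := by
  have h := integral_pow_mul_cexp n (c := b) (by simpa using hb)
  have h2 : (fun x : ℝ => (x : ℂ) ^ n * exp (-((b : ℂ) * x))) =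
      fun x : ℝ => ((x ^ n * Real.exp (-(b * x)) : ℝ) : ℂ) := by
    funext x; push_cast; ring
  rw [h2, integral_complex_ofReal] at h
  exact_mod_cast h

end LaplaceIntegrals

section Sinh

lemma sinh_re_le_norm_sinh (u : ℂ) : Real.sinh u.re ≤ ‖sinh u‖ := by
  have h1 : ‖sinh u‖ = ‖exp u - exp (-u)‖ / 2 := by
    rw [sinh, norm_div]; simp
  have h2 := norm_sub_norm_le (exp u) (exp (-u))
  rw [Complex.norm_exp, Complex.norm_exp, neg_re] at h2
  rw [h1, Real.sinh_eq]
  linarith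

/-- A quarter of the exponent pays for the linear factor: sinh a ≥ e^{3a/4} sinh (a/4) and sinh
(a/4) ≥ a/4. -/
lemma mul_exp_le_sinh {a : ℝ} (ha : 0 ≤ a) : a * Real.exp (3 * a / 4) / 4 ≤ Real.sinh a := by
  have h1 : a / 4 ≤ Real.sinh (a / 4) := Real.self_le_sinh_iff.2 (by linarith)
  rw [Real.sinh_eq] at h1 ⊢
  have e1 : Real.exp a = Real.exp (3 * a / 4) * Real.exp (a / 4) := by
    rw [← Real.exp_add]; congr 1; ring
  have e2 : Real.exp (-a) ≤ Real.exp (3 * a / 4) * Real.exp (-(a / 4)) := by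
    rw [← Real.exp_add]; apply Real.exp_le_exp.2; linarith
  have hp := Real.exp_pos (3 * a / 4)
  nlinarith

/-- Records both the double pole at 0 and the decay. For u = 2π²w/z the rate 3/2 still beats the
factor e^{4π²w²/z} of `gMain`, whose norm is at most e^{Re u} for 0 < w ≤ 1/2. -/
lemma norm_inv_sinh_sq_le {u : ℂ} (hu : 0 < u.re) :
    ‖(sinh u ^ 2)⁻¹‖ ≤ 16 / u.re ^ 2 * Real.exp (-(3 * u.re / 2)) := by
  have h := (mul_exp_le_sinh hu.le).trans (sinh_re_le_norm_sinh u)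
  have hpos : 0 < u.re * Real.exp (3 * u.re / 4) / 4 := by positivity
  rw [norm_inv, norm_pow]
  have h2 : (u.re * Real.exp (3 * u.re / 4) / 4) ^ 2 ≤ ‖sinh u‖ ^ 2 := by gcongr
  refine (inv_anti₀ (by positivity) h2).trans_eq ?_
  have e : Real.exp (3 * u.re / 4) ^ 2 = Real.exp (3 * u.re / 2) := by
    rw [← Real.exp_nat_mul]; congr 1; push_cast; ring
  rw [div_pow, mul_pow, e, Real.exp_neg]
  field_simp
  norm_num

/-- With x = e^{-2u} one has 1/sinh² u = 4x/(1-x)² = 4 ∑ n xⁿ; the vanishing term n = 0 is shifted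
away. -/
lemma hasSum_inv_sinh_sq {u : ℂ} (hu : 0 < u.re) :
    HasSum (fun j : ℕ => 4 * ((j : ℂ) + 1) * exp (-(2 * ((j : ℂ) + 1) * u))) (sinh u ^ 2)⁻¹ := by
  have hlt : ‖exp (-(2 * u))‖ < 1 := norm_exp_neg_lt_one (by simpa using hu)
  have h := (hasSum_nat_add_iff' (f := fun n : ℕ => (n : ℂ) * exp (-(2 * u)) ^ n) 1).2
    (hasSum_coe_mul_geometric_of_norm_lt_one hlt)
  have h2 := h.mul_left 4
  have hu0 : sinh u ≠ 0 := by
    intro h0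
    have h1 := sinh_re_le_norm_sinh u
    rw [h0, norm_zero] at h1
    exact absurd (Real.sinh_pos_iff.2 hu) (not_lt.2 h1)
  have hval : 4 * (exp (-(2 * u)) / (1 - exp (-(2 * u))) ^ 2 -
      ∑ i ∈ Finset.range 1, (i : ℂ) * exp (-(2 * u)) ^ i) = (sinh u ^ 2)⁻¹ := by
    have e1 : 1 - exp (-(2 * u)) = exp (-u) * (2 * sinh u) := by
      rw [two_sinh, mul_sub, ← exp_add, ← exp_add, neg_add_cancel, exp_zero]
      ring_nf
    have e2 : exp (-(2 * u)) = exp (-u) ^ 2 := by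
      rw [← exp_nat_mul]; push_cast; ring_nf
    have e3 := exp_ne_zero (-u)
    rw [e1, e2]
    simp only [Finset.range_one, Finset.sum_singleton, Nat.cast_zero, zero_mul, sub_zero]
    field_simp
    norm_num
  rw [hval] at h2
  refine h2.congr_fun fun j => ?_
  rw [← exp_nat_mul]
  push_cast
  ring_nf

/-- The moments of `1 / sinh²`. -/
lemma integral_pow_div_sinh_sq {L : ℕ} (hL : 1 ≤ L) {c : ℂ} (hc : 0 < c.re) :
    ∫ x : ℝ in Set.Ioi 0, (x : ℂ) ^ (2 * L) * (sinh (c * x) ^ 2)⁻¹ =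
      (-1) ^ (L + 1) * Real.pi ^ (2 * L) * ((bernoulli (2 * L) : ℚ) : ℂ) / c ^ (2 * L + 1) := by
  have hc0 : c ≠ 0 := by rintro rfl; simp at hc
  have hre (j : ℕ) : 0 < (2 * ((j : ℂ) + 1) * c).re := by
    rw [show (2 * ((j : ℂ) + 1) * c) = ((2 * ((j : ℝ) + 1) : ℝ) : ℂ) * c by push_cast; ring,
      re_ofReal_mul]
    positivity
  have hre' (j : ℕ) : (2 * ((j : ℂ) + 1) * c).re = 2 * ((j : ℝ) + 1) * c.re := by
    rw [show (2 * ((j : ℂ) + 1) * c) = ((2 * ((j : ℝ) + 1) : ℝ) : ℂ) * c by push_cast; ring,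
      re_ofReal_mul]
  let F : ℕ → ℝ → ℂ := fun j x =>
    4 * ((j : ℂ) + 1) * ((x : ℂ) ^ (2 * L) * exp (-(2 * ((j : ℂ) + 1) * c * x)))
  have hFint (j : ℕ) : Integrable (F j) (volume.restrict (Set.Ioi 0)) :=
    (integrableOn_pow_mul_cexp (2 * L) (hre j)).const_mul _
  -- Termwise integration produces ∑ (j+1)^{-2L}, and Euler's formula for ζ(2L) brings in the
  -- Bernoulli number. The same series bounds the L¹ norms and so permits the interchange.
  have hzeta := (hasSum_nat_add_iff' 1).2 (hasSum_zeta_nat (k := L) (by omega))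
  simp only [Finset.range_one, Finset.sum_singleton, Nat.cast_zero,
    zero_pow (show 2 * L ≠ 0 by omega), div_zero, sub_zero] at hzeta
  have hnorm (j : ℕ) : ∫ x : ℝ in Set.Ioi 0, ‖F j x‖ =
      4 * ((2 * L).factorial / (2 * c.re) ^ (2 * L + 1)) * (1 / ((j + 1 : ℕ) : ℝ) ^ (2 * L)) := by
    have h1 : ∫ x : ℝ in Set.Ioi 0, ‖F j x‖ = ∫ x : ℝ in Set.Ioi 0,
        4 * ((j : ℝ) + 1) * (x ^ (2 * L) * Real.exp (-(2 * ((j : ℝ) + 1) * c.re * x))) := by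
      refine setIntegral_congr_fun measurableSet_Ioi fun x hx => ?_
      have hj : ‖((j : ℂ) + 1)‖ = (j : ℝ) + 1 := by
        rw [show ((j : ℂ) + 1) = ((j + 1 : ℕ) : ℂ) by push_cast; ring, Complex.norm_natCast]
        push_cast; ring
      simp only [F]
      rw [norm_mul, norm_mul, hj, norm_mul, norm_pow, norm_real, Complex.norm_exp,
        Real.norm_of_nonneg (le_of_lt hx), neg_re, re_mul_ofReal, hre']
      simp
    have hpos : (0 : ℝ) < (j : ℝ) + 1 := by positivity
    rw [h1, integral_const_mul, integral_pow_mul_exp _ (by positivity)]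
    push_cast
    rw [mul_right_comm 2 _ c.re, mul_pow (2 * c.re), pow_succ ((j : ℝ) + 1)]
    field_simp
  have hsum := hasSum_integral_of_summable_integral_norm hFint (by
    simp only [hnorm]
    exact hzeta.summable.mul_left _)
  have hval (x : ℝ) (hx : x ∈ Set.Ioi (0 : ℝ)) :
      ∑' j, F j x = (x : ℂ) ^ (2 * L) * (sinh (c * x) ^ 2)⁻¹ := by
    have h := (hasSum_inv_sinh_sq (u := c * x) (by
      rw [re_mul_ofReal]; exact mul_pos hc hx)).mul_left ((x : ℂ) ^ (2 * L))
    rw [← h.tsum_eq]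
    refine tsum_congr fun j => ?_
    simp only [F]
    ring_nf
  rw [setIntegral_congr_fun measurableSet_Ioi hval] at hsum
  have hterm (j : ℕ) : ∫ x : ℝ in Set.Ioi 0, F j x =
      4 * ((2 * L).factorial / (2 * c) ^ (2 * L + 1)) *
        ((1 / ((j + 1 : ℕ) : ℝ) ^ (2 * L) : ℝ) : ℂ) := by
    have hj : ((j : ℂ) + 1) ≠ 0 := Nat.cast_add_one_ne_zero j
    simp only [F]
    rw [integral_const_mul, integral_pow_mul_cexp _ (hre j)]
    push_cast
    rw [mul_right_comm 2 _ c, mul_pow (2 * c), pow_succ ((j : ℂ) + 1)]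
    field_simp
  simp only [hterm] at hsum
  have h2 := (Complex.hasSum_ofReal.2 hzeta).mul_left
    (4 * (((2 * L).factorial : ℂ) / (2 * c) ^ (2 * L + 1)))
  rw [hsum.unique h2]
  have hf : ((2 * L).factorial : ℂ) ≠ 0 := Nat.cast_ne_zero.2 (Nat.factorial_ne_zero _)
  obtain ⟨L, rfl⟩ := Nat.exists_eq_add_of_le' hL
  rw [show 2 * (L + 1) - 1 = 2 * L + 1 by omega]
  push_cast
  rw [mul_pow 2 c, show 2 * (L + 1) + 1 = (2 * L + 1) + 2 by ring, pow_add (2 : ℂ) (2 * L + 1) 2]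
  field_simp
  norm_num

end Sinh

end ChiGenus

/-! ### Taylor estimates, the kernel majorant and sectors -/

namespace ChiGenus

open Complex MeasureTheory Filter Topology Asymptotics

section Taylor

/-- Taylor's formula for the exponential function, with a bound in terms of the real part. -/
lemma norm_exp_sub_sum_le (J : ℕ) {v : ℂ} (hv : 0 ≤ v.re) :
    ‖exp v - ∑ j ∈ Finset.range J, v ^ j / j.factorial‖ ≤ ‖v‖ ^ J * Real.exp v.re := by
  induction J generalizing v with
  | zero => simp [Complex.norm_exp]
  | succ J ih =>
    -- Along t ↦ tv the remainder of order J + 1 has derivative v times the remainder of order J, so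
    -- the mean value inequality on [0, 1] closes the induction. The exponent Re v, not ‖v‖, is what
    -- the decay of the kernel can absorb.
    have hderiv (t : ℝ) : HasDerivAt (fun t : ℝ => exp (t * v) -
        ∑ j ∈ Finset.range (J + 1), (t * v) ^ j / j.factorial)
        (v * (exp (t * v) - ∑ j ∈ Finset.range J, (t * v) ^ j / j.factorial)) t := by
      have h1 : HasDerivAt (fun t : ℂ => t * v) v t := by
        simpa using (hasDerivAt_id (t : ℂ)).mul_const v
      have h2 : HasDerivAt (fun t : ℂ => ∑ j ∈ Finset.range (J + 1), (t * v) ^ j / j.factorial)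
          (v * ∑ j ∈ Finset.range J, ((t : ℂ) * v) ^ j / j.factorial) t := by
        have h3 : HasDerivAt (fun t : ℂ => ∑ j ∈ Finset.range (J + 1), (t * v) ^ j / j.factorial)
            (∑ j ∈ Finset.range (J + 1),
              ((j : ℂ) * ((t : ℂ) * v) ^ (j - 1) * v) / j.factorial) t := by
          refine HasDerivAt.fun_sum fun j _ => ?_
          exact (h1.pow j).div_const _
        refine h3.congr_deriv ?_
        rw [Finset.sum_range_succ', Finset.mul_sum]
        simp only [CharP.cast_eq_zero, zero_mul, zero_div, add_zero, Nat.add_sub_cancel]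
        refine Finset.sum_congr rfl fun j _ => ?_
        rw [Nat.factorial_succ]
        have : ((j : ℂ) + 1) ≠ 0 := Nat.cast_add_one_ne_zero j
        push_cast
        field_simp
      have h4 := (h1.cexp.sub h2).comp_ofReal
      refine h4.congr_deriv ?_
      ring
    have hb (t : ℝ) (ht : t ∈ Set.Ico (0 : ℝ) 1) :
        ‖v * (exp (t * v) - ∑ j ∈ Finset.range J, (t * v) ^ j / j.factorial)‖ ≤
          ‖v‖ ^ (J + 1) * Real.exp v.re := by
      have hre : ((t : ℂ) * v).re = t * v.re := re_ofReal_mul _ _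
      have h5 := ih (v := t * v) (by rw [hre]; exact mul_nonneg ht.1 hv)
      rw [norm_mul, pow_succ', mul_assoc]
      refine mul_le_mul_of_nonneg_left (h5.trans ?_) (norm_nonneg v)
      rw [hre, norm_mul, norm_real, Real.norm_of_nonneg ht.1]
      have h6 : t * ‖v‖ ≤ ‖v‖ := mul_le_of_le_one_left (norm_nonneg v) ht.2.le
      have h7 : t * v.re ≤ v.re := mul_le_of_le_one_left hv ht.2.le
      have h8 : 0 ≤ t * ‖v‖ := mul_nonneg ht.1 (norm_nonneg v)
      gcongr
    have h := norm_image_sub_le_of_norm_deriv_le_segment_01'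
      (fun t _ => (hderiv t).hasDerivWithinAt) hb
    simpa [Finset.sum_range_succ'] using h

/-- The Taylor polynomial of the cosine. -/
noncomputable def cosPoly (N : ℕ) (x : ℝ) : ℝ :=
  ∑ l ∈ Finset.range (N + 1), (-1) ^ l * x ^ (2 * l) / (2 * l).factorial

/-- The tail of the cosine series is compared with |x|^{2N+2} times the series of cosh, using (2l)!
≤ (2l+2N+2)!. -/
lemma abs_cos_sub_cosPoly_le (N : ℕ) (x : ℝ) :
    |Real.cos x - cosPoly N x| ≤ |x| ^ (2 * N + 2) * Real.cosh x := by
  have h := (hasSum_nat_add_iff'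
    (f := fun l : ℕ => (-1 : ℝ) ^ l * x ^ (2 * l) / (2 * l).factorial) (N + 1)).2
    (Real.hasSum_cos x)
  have hc := (Real.hasSum_cosh x).mul_left (|x| ^ (2 * N + 2))
  change HasSum _ (Real.cos x - cosPoly N x) at h
  rw [← Real.norm_eq_abs, ← h.tsum_eq]
  refine tsum_of_norm_bounded hc fun l => ?_
  rw [norm_div, norm_mul, norm_pow, norm_neg, norm_one, one_pow, one_mul, norm_pow,
    Real.norm_eq_abs, Real.norm_natCast]
  have e1 : |x| ^ (2 * (l + (N + 1))) = |x| ^ (2 * N + 2) * x ^ (2 * l) := by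
    rw [← (even_two_mul l).pow_abs x, ← pow_add]
    congr 1
    ring
  have e2 : ((2 * l).factorial : ℝ) ≤ (2 * (l + (N + 1))).factorial := by
    exact_mod_cast Nat.factorial_le (by omega)
  have e3 : (0 : ℝ) < (2 * l).factorial := by exact_mod_cast Nat.factorial_pos _
  have e4 : 0 ≤ x ^ (2 * l) := (even_two_mul l).pow_nonneg x
  rw [e1, mul_div_assoc]
  gcongr

lemma exists_cos_sub_cosPoly_le (N : ℕ) (b : ℝ) : ∃ C : ℝ, 0 ≤ C ∧ ∀ w : ℝ, 0 ≤ w → w ≤ 1 / 2 →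
    |Real.cos (b * w) - cosPoly N (b * w)| ≤ C * w ^ (2 * N + 2) := by
  refine ⟨|b| ^ (2 * N + 2) * Real.cosh b, by positivity, fun w h0 h1 => ?_⟩
  refine (abs_cos_sub_cosPoly_le N (b * w)).trans ?_
  have h2 : Real.cosh (b * w) ≤ Real.cosh b := by
    rw [Real.cosh_le_cosh, abs_mul, abs_of_nonneg h0]
    exact mul_le_of_le_one_right (abs_nonneg b) (by linarith)
  rw [abs_mul, abs_of_nonneg h0, mul_pow]
  have : |b| ^ (2 * N + 2) * w ^ (2 * N + 2) * Real.cosh (b * w) ≤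
      |b| ^ (2 * N + 2) * w ^ (2 * N + 2) * Real.cosh b := by gcongr
  linarith

end Taylor

section Kernel

/-- The majorant of the kernel `e^{4π²w²/z} / sinh (2π²w/z)²`, with `ρ = Re (1/z)`. -/
noncomputable def kernelBound (ρ w : ℝ) : ℝ :=
  16 / (2 * Real.pi ^ 2 * ρ * w) ^ 2 * Real.exp (-(Real.pi ^ 2 * ρ * w))

lemma kernelBound_nonneg (ρ w : ℝ) : 0 ≤ kernelBound ρ w := by
  rw [kernelBound]; positivity

/-- The kernel `1 / sinh (2π²w/z)²`. -/
noncomputable def kernel (z : ℂ) (w : ℝ) : ℂ := (sinh (2 * (Real.pi : ℂ) ^ 2 * w / z) ^ 2)⁻¹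

lemma inv_re_pos {z : ℂ} (hz : 0 < z.re) : 0 < (z⁻¹).re := by
  have h0 : z ≠ 0 := by rintro rfl; simp at hz
  rw [inv_re]
  exact div_pos hz (normSq_pos.2 h0)

lemma ofReal_div_re (b : ℝ) (z : ℂ) : ((b : ℂ) / z).re = b * (z⁻¹).re := by
  rw [div_eq_mul_inv, re_ofReal_mul]

lemma norm_kernel_mul_exp_le {z : ℂ} (hz : 0 < z.re) {w : ℝ} (hw : 0 < w) :
    ‖kernel z w‖ * Real.exp (2 * Real.pi ^ 2 * (z⁻¹).re * w) ≤ kernelBound (z⁻¹).re w := by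
  have hρ := inv_re_pos hz
  have hre : (2 * (Real.pi : ℂ) ^ 2 * w / z).re = 2 * Real.pi ^ 2 * (z⁻¹).re * w := by
    have := ofReal_div_re (2 * Real.pi ^ 2 * w) z
    push_cast at this
    rw [this]; ring
  have h := norm_inv_sinh_sq_le (u := 2 * (Real.pi : ℂ) ^ 2 * w / z) (by rw [hre]; positivity)
  rw [hre] at h
  refine (mul_le_mul_of_nonneg_right h (Real.exp_pos _).le).trans_eq ?_
  rw [kernelBound, mul_assoc, ← Real.exp_add]
  congr 2
  ring

lemma norm_kernel_le {z : ℂ} (hz : 0 < z.re) {w : ℝ} (hw : 0 < w) :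
    ‖kernel z w‖ ≤ kernelBound (z⁻¹).re w := by
  have hρ := inv_re_pos hz
  refine le_trans ?_ (norm_kernel_mul_exp_le hz hw)
  exact le_mul_of_one_le_right (norm_nonneg _) (Real.one_le_exp (by positivity))

/-- Two powers of w cancel the double pole, which leaves a Laplace integrand. -/
lemma pow_mul_kernelBound (K : ℕ) {ρ w : ℝ} (hw : 0 < w) :
    w ^ (K + 2) * kernelBound ρ w =
      4 / (Real.pi ^ 4 * ρ ^ 2) * (w ^ K * Real.exp (-(Real.pi ^ 2 * ρ * w))) := by
  rw [kernelBound]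
  have := Real.pi_pos
  field_simp
  ring

lemma integrableOn_kernelBound (K : ℕ) {ρ : ℝ} (hρ : 0 < ρ) :
    IntegrableOn (fun w => w ^ (K + 2) * kernelBound ρ w) (Set.Ioi 0) := by
  have h := (integrableOn_pow_mul_exp K (b := Real.pi ^ 2 * ρ) (by positivity)).const_mul
    (4 / (Real.pi ^ 4 * ρ ^ 2))
  exact IntegrableOn.congr_fun h (fun w hw => (pow_mul_kernelBound K hw).symm) measurableSet_Ioi

lemma integral_kernelBound (K : ℕ) {ρ : ℝ} (hρ : 0 < ρ) :
    ∫ w in Set.Ioi 0, w ^ (K + 2) * kernelBound ρ w =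
      4 * K.factorial / Real.pi ^ (2 * K + 6) * ρ⁻¹ ^ (K + 3) := by
  rw [setIntegral_congr_fun measurableSet_Ioi (fun w hw => pow_mul_kernelBound K hw),
    integral_const_mul, integral_pow_mul_exp K (by positivity)]
  have := Real.pi_pos
  rw [mul_pow, ← pow_mul, inv_pow]
  field_simp
  ring

variable {G : ℝ → ℂ} {S : Set ℝ}

lemma integrableOn_of_kernelBound (hS : MeasurableSet S) (hS0 : S ⊆ Set.Ioi 0) {D ρ : ℝ} {K : ℕ}
    (hρ : 0 < ρ) (hm : Measurable G) (hG : ∀ w ∈ S, ‖G w‖ ≤ D * (w ^ (K + 2) * kernelBound ρ w)) :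
    IntegrableOn G S :=
  Integrable.mono' (((integrableOn_kernelBound K hρ).mono_set hS0).const_mul D)
    hm.aestronglyMeasurable ((ae_restrict_iff' hS).2 (.of_forall hG))

lemma norm_setIntegral_le_of_kernelBound (hS : MeasurableSet S) (hS0 : S ⊆ Set.Ioi 0) {D ρ : ℝ}
    (hD : 0 ≤ D) {K : ℕ} (hρ : 0 < ρ)
    (hG : ∀ w ∈ S, ‖G w‖ ≤ D * (w ^ (K + 2) * kernelBound ρ w)) :
    ‖∫ w in S, G w‖ ≤ D * (4 * K.factorial / Real.pi ^ (2 * K + 6) * ρ⁻¹ ^ (K + 3)) := by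
  have hinteg := integrableOn_kernelBound K hρ
  have h1 := norm_integral_le_of_norm_le ((hinteg.mono_set hS0).const_mul D)
    ((ae_restrict_iff' hS).2 (.of_forall hG))
  refine h1.trans ?_
  rw [integral_const_mul, ← integral_kernelBound K hρ]
  refine mul_le_mul_of_nonneg_left (setIntegral_mono_set hinteg ?_ hS0.eventuallyLE) hD
  refine (ae_restrict_iff' measurableSet_Ioi).2 (.of_forall fun w hw => ?_)
  exact mul_nonneg (pow_nonneg (le_of_lt hw) _) (kernelBound_nonneg _ _)

end Kernel

section Sector

/-- The sector `κ |z| ≤ Re z`, `Re z > 0`. -/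
def sector (κ : ℝ) : Set ℂ := {z | 0 < z.re ∧ κ * ‖z‖ ≤ z.re}

/-- Re (1/z) = Re z / |z|², and Re z ≥ κ|z| in the sector. -/
lemma inv_re_inv_le {κ : ℝ} (hκ : 0 < κ) {z : ℂ} (hz : z ∈ sector κ) :
    ((z⁻¹).re)⁻¹ ≤ ‖z‖ / κ := by
  obtain ⟨h1, h2⟩ := hz
  have h0 : z ≠ 0 := by rintro rfl; simp at h1
  have h3 : 0 < ‖z‖ := norm_pos_iff.2 h0
  rw [inv_re, inv_div, normSq_eq_norm_sq, div_le_div_iff₀ h1 hκ]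
  nlinarith

lemma eventually_sector (κ : ℝ) : ∀ᶠ z in 𝓝[sector κ] (0 : ℂ), z ∈ sector κ ∧ ‖z‖ ≤ 1 := by
  refine (eventually_mem_nhdsWithin).and (nhdsWithin_le_nhds ?_)
  filter_upwards [Metric.closedBall_mem_nhds (0 : ℂ) one_pos] with z hz
  simpa using hz

/-- Power counting: the majorant integral contributes |z|^{K+3}, the prefactor |z|^{-2}, and the
extra factors |z|^{s-e}. The condition e + N ≤ K + s leaves at least |z|^{N+1}. -/
lemma isBigO_integral_of_kernelBound {κ : ℝ} (hκ : 0 < κ) {S : Set ℝ} (hS : MeasurableSet S)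
    (hS0 : S ⊆ Set.Ioi 0) {G : ℂ → ℝ → ℂ} {D : ℝ} (hD : 0 ≤ D) {K s e N : ℕ}
    (hN : e + N ≤ K + s)
    (hG : ∀ z ∈ sector κ, ‖z‖ ≤ 1 → ∀ w ∈ S,
      ‖G z w‖ ≤ D * (‖z‖ ^ s * ‖z‖⁻¹ ^ e) * (w ^ (K + 2) * kernelBound (z⁻¹).re w)) :
    (fun z : ℂ => 8 * (Real.pi : ℂ) ^ 2 / z ^ 2 * ∫ w in S, G z w)
      =O[𝓝[sector κ] 0] fun z : ℂ => z ^ (N + 1) := by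
  set C := 4 * K.factorial / Real.pi ^ (2 * K + 6) with hC
  have hC0 : 0 ≤ C := by have := Real.pi_pos; positivity
  refine IsBigO.of_bound (8 * Real.pi ^ 2 * (D * (C * κ⁻¹ ^ (K + 3)))) ?_
  filter_upwards [eventually_sector κ] with z hz
  obtain ⟨hz, hz1⟩ := hz
  have h0 : z ≠ 0 := by rintro rfl; simp [sector] at hz
  have hpos : 0 < ‖z‖ := norm_pos_iff.2 h0
  have hρ := inv_re_pos hz.1
  have h1 := norm_setIntegral_le_of_kernelBound hS hS0 (by positivity) hρ (hG z hz hz1)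
  rw [← hC] at h1
  have h2 : (z⁻¹).re⁻¹ ^ (K + 3) ≤ (‖z‖ / κ) ^ (K + 3) := by
    have := inv_re_inv_le hκ hz
    gcongr
  have h3 : ‖8 * (Real.pi : ℂ) ^ 2 / z ^ 2‖ = 8 * Real.pi ^ 2 / ‖z‖ ^ 2 := by
    rw [norm_div, norm_mul, norm_pow, norm_pow, norm_real, Real.norm_of_nonneg Real.pi_pos.le]
    norm_num
  rw [norm_mul, h3, norm_pow]
  have h4 : ‖z‖ ^ s * ‖z‖⁻¹ ^ e * ‖z‖ ^ (K + 3) / ‖z‖ ^ 2 ≤ ‖z‖ ^ (N + 1) := by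
    have h5 : ‖z‖ ^ s * ‖z‖⁻¹ ^ e * ‖z‖ ^ (K + 3) / ‖z‖ ^ 2 =
        ‖z‖ ^ (K + s - e + 1) := by
      obtain ⟨d, hd⟩ := Nat.exists_eq_add_of_le (show e ≤ K + s by omega)
      have e1 : ‖z‖ ^ s * ‖z‖ ^ (K + 3) = ‖z‖ ^ e * ‖z‖ ^ (d + 1) * ‖z‖ ^ 2 := by
        rw [← pow_add, ← pow_add, ← pow_add]; congr 1; omega
      rw [hd, Nat.add_sub_cancel_left, inv_pow, mul_right_comm, e1]
      field_simp
    rw [h5]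
    exact pow_le_pow_of_le_one hpos.le hz1 (by omega)
  calc 8 * Real.pi ^ 2 / ‖z‖ ^ 2 * ‖∫ w in S, G z w‖
      ≤ 8 * Real.pi ^ 2 / ‖z‖ ^ 2 *
        (D * (‖z‖ ^ s * ‖z‖⁻¹ ^ e) * (C * (‖z‖ / κ) ^ (K + 3))) := by
        gcongr
        exact h1.trans (by gcongr)
    _ = 8 * Real.pi ^ 2 * (D * (C * κ⁻¹ ^ (K + 3))) *
        (‖z‖ ^ s * ‖z‖⁻¹ ^ e * ‖z‖ ^ (K + 3) / ‖z‖ ^ 2) := by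
        rw [div_pow, inv_pow κ]; ring
    _ ≤ 8 * Real.pi ^ 2 * (D * (C * κ⁻¹ ^ (K + 3))) * ‖z‖ ^ (N + 1) := by
        gcongr

end Sector

end ChiGenus

/-! ### Expansion of g_{m,1} in sectors -/

namespace ChiGenus

open Complex MeasureTheory Filter Topology Asymptotics

section MainIntegral

/-- The integrand of `gMain`. -/
noncomputable def mainIntegrand (m : ℤ) (z : ℂ) (w : ℝ) : ℂ :=
  sin (Real.pi * w) ^ 2 / sinh (2 * (Real.pi : ℂ) ^ 2 * w / z) ^ 2 *
    exp (4 * (Real.pi : ℂ) ^ 2 * (w : ℂ) ^ 2 / z) * cos (2 * Real.pi * m * w)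

lemma gMain_eq (m : ℤ) (z : ℂ) : gMain m z =
    8 * (Real.pi : ℂ) ^ 2 / z ^ 2 * ∫ w in Set.Ioc (0 : ℝ) (1 / 2), mainIntegrand m z w := by
  rw [gMain, intervalIntegral.integral_of_le (by norm_num)]
  rfl

lemma mainIntegrand_eq (m : ℤ) (z : ℂ) (w : ℝ) : mainIntegrand m z w =
    ((Real.sin (Real.pi * w) ^ 2 * Real.cos (2 * Real.pi * m * w) : ℝ) : ℂ) *
      (kernel z w * exp (4 * (Real.pi : ℂ) ^ 2 * (w : ℂ) ^ 2 / z)) := by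
  rw [mainIntegrand, kernel]
  push_cast
  ring

lemma measurable_kernel (z : ℂ) : Measurable (kernel z) := by
  unfold kernel
  fun_prop

lemma measurable_mainIntegrand (m : ℤ) (z : ℂ) : Measurable (mainIntegrand m z) := by
  unfold mainIntegrand
  fun_prop

lemma exp_arg_re (z : ℂ) (w : ℝ) :
    (4 * (Real.pi : ℂ) ^ 2 * (w : ℂ) ^ 2 / z).re = 4 * Real.pi ^ 2 * w ^ 2 * (z⁻¹).re := by
  have := ofReal_div_re (4 * Real.pi ^ 2 * w ^ 2) z
  push_cast at this
  exact this

/-- For w ≤ 1/2 one has 4π²w² ≤ 2π²w, so the growing exponential is no larger than the one already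
absorbed by the kernel. -/
lemma norm_kernel_mul_exp_re_le {z : ℂ} (hz : 0 < z.re) {w : ℝ}
    (hw : w ∈ Set.Ioc (0 : ℝ) (1 / 2)) :
    ‖kernel z w‖ * Real.exp (4 * (Real.pi : ℂ) ^ 2 * (w : ℂ) ^ 2 / z).re ≤
      kernelBound (z⁻¹).re w := by
  obtain ⟨h0, h1⟩ := hw
  have hρ := inv_re_pos hz
  refine le_trans (mul_le_mul_of_nonneg_left (Real.exp_le_exp.2 ?_) (norm_nonneg _))
    (norm_kernel_mul_exp_le hz h0)
  rw [exp_arg_re]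
  have h2 : 0 ≤ 2 * Real.pi ^ 2 * (z⁻¹).re * w := by positivity
  nlinarith

lemma norm_kernel_mul_cexp_le {z : ℂ} (hz : 0 < z.re) {w : ℝ} (hw : w ∈ Set.Ioc (0 : ℝ) (1 / 2)) :
    ‖kernel z w * exp (4 * (Real.pi : ℂ) ^ 2 * (w : ℂ) ^ 2 / z)‖ ≤ kernelBound (z⁻¹).re w := by
  rw [norm_mul, Complex.norm_exp]
  exact norm_kernel_mul_exp_re_le hz hw

lemma norm_mainIntegrand_le (m : ℤ) {z : ℂ} (hz : 0 < z.re) {w : ℝ}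
    (hw : w ∈ Set.Ioc (0 : ℝ) (1 / 2)) :
    ‖mainIntegrand m z w‖ ≤ Real.pi ^ 2 * (w ^ (0 + 2) * kernelBound (z⁻¹).re w) := by
  rw [mainIntegrand_eq, norm_mul, norm_real, Real.norm_eq_abs, abs_mul, ← mul_assoc]
  have h1 : |Real.sin (Real.pi * w) ^ 2| ≤ Real.pi ^ 2 * w ^ 2 := by
    rw [abs_of_nonneg (sq_nonneg _), ← mul_pow, sq_le_sq]
    exact Real.abs_sin_le_abs
  have h2 := Real.abs_cos_le_one (2 * Real.pi * m * w)
  have h3 := norm_kernel_mul_cexp_le hz hw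
  have h4 : |Real.sin (Real.pi * w) ^ 2| * |Real.cos (2 * Real.pi * m * w)| ≤
      Real.pi ^ 2 * w ^ 2 * 1 := by gcongr
  rw [mul_one] at h4
  exact mul_le_mul h4 h3 (norm_nonneg _) (by have := hw.1; positivity)

/-- The indices of the truncated triple series. -/
def tripleIndex (N : ℕ) : Finset (ℕ × ℕ × ℕ) :=
  Finset.Icc 1 N ×ˢ (Finset.range (N + 1) ×ˢ Finset.range (N + 1))

/-- The coefficient of `w ^ (2 (l₁ + l₂ + j)) z ^ (-j)` in the Taylor series of
`sin (π w)² cos (2 π m w) e^{4π²w²/z}`. -/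
noncomputable def taylorCoeff (m : ℤ) (t : ℕ × ℕ × ℕ) : ℝ :=
  -(1 / 2) * ((-1) ^ t.1 * (2 * Real.pi) ^ (2 * t.1) / (2 * t.1).factorial) *
    (((-1) ^ t.2.1 * (2 * Real.pi * m) ^ (2 * t.2.1) / (2 * t.2.1).factorial) *
      ((4 * Real.pi ^ 2) ^ t.2.2 / t.2.2.factorial))

/-- The coefficients of the triple series of `gMain`. -/
noncomputable def seriesCoeff (m : ℤ) (t : ℕ × ℕ × ℕ) : ℝ :=
  2 * ((-1) ^ t.2.2 * (m : ℝ) ^ (2 * t.2.1) /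
    (((2 * t.1).factorial : ℝ) * (2 * t.2.1).factorial * t.2.2.factorial) *
    ((bernoulli (2 * (t.1 + t.2.1 + t.2.2)) : ℚ) : ℝ))

/-- The Taylor polynomial of `sin (π w)²`. -/
noncomputable def sinSqPoly (N : ℕ) (w : ℝ) : ℝ :=
  ∑ l ∈ Finset.Icc 1 N, -(1 / 2) * ((-1) ^ l * (2 * Real.pi) ^ (2 * l) / (2 * l).factorial) *
    w ^ (2 * l)

/-- From sin² (πw) = (1 - cos (2πw))/2: the constant terms cancel, which is why l₁ starts at 1 in
the triple series. -/
lemma sinSqPoly_eq (N : ℕ) (w : ℝ) : sinSqPoly N w = (1 - cosPoly N (2 * Real.pi * w)) / 2 := by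
  have h : Finset.range (N + 1) = insert 0 (Finset.Icc 1 N) := by
    ext i; simp only [Finset.mem_range, Finset.mem_insert, Finset.mem_Icc]; omega
  rw [cosPoly, h, Finset.sum_insert (by simp), sinSqPoly]
  simp only [pow_zero, mul_zero, Nat.factorial_zero, Nat.cast_one, mul_one, div_one,
    sub_add_cancel_left]
  rw [neg_div, Finset.sum_div, ← Finset.sum_neg_distrib]
  refine Finset.sum_congr rfl fun l _ => ?_
  rw [mul_pow]
  ring

lemma sin_sq_sub_sinSqPoly (N : ℕ) (w : ℝ) : Real.sin (Real.pi * w) ^ 2 - sinSqPoly N w =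
    -(Real.cos (2 * Real.pi * w) - cosPoly N (2 * Real.pi * w)) / 2 := by
  rw [sinSqPoly_eq, show 2 * Real.pi * w = 2 * (Real.pi * w) by ring, Real.cos_two_mul,
    Real.cos_sq']
  ring

lemma sum_taylorCoeff (m : ℤ) (N : ℕ) (z : ℂ) (w : ℝ) :
    ((sinSqPoly N w * cosPoly N (2 * Real.pi * m * w) : ℝ) : ℂ) *
      ∑ j ∈ Finset.range (N + 1), (4 * (Real.pi : ℂ) ^ 2 * (w : ℂ) ^ 2 / z) ^ j / j.factorial =
    ∑ t ∈ tripleIndex N, (taylorCoeff m t : ℂ) * (z⁻¹ ^ t.2.2 *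
      (w : ℂ) ^ (2 * (t.1 + t.2.1 + t.2.2))) := by
  rw [tripleIndex, Finset.sum_product]
  simp_rw [Finset.sum_product]
  rw [sinSqPoly, cosPoly]
  push_cast
  rw [mul_assoc, Finset.sum_mul]
  refine Finset.sum_congr rfl fun l₁ _ => ?_
  rw [Finset.sum_mul_sum, Finset.mul_sum]
  refine Finset.sum_congr rfl fun l₂ _ => ?_
  rw [Finset.mul_sum]
  refine Finset.sum_congr rfl fun j _ => ?_
  simp only [taylorCoeff]
  push_cast
  rw [show 2 * (l₁ + l₂ + j) = 2 * l₁ + 2 * l₂ + 2 * j by ring, pow_add, pow_add,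
    div_eq_mul_inv _ z, mul_pow _ z⁻¹ j, mul_pow (4 * (Real.pi : ℂ) ^ 2), ← pow_mul,
    mul_pow (2 * (Real.pi : ℂ) * m) (w : ℂ)]
  ring

/-- The first bound controls the truncation of sin² and cos. The second supplies the double zero
needed against the pole of the kernel when the exponential is truncated. -/
lemma exists_taylor_bounds (m : ℤ) (N : ℕ) : ∃ C : ℝ, 0 ≤ C ∧ ∀ w ∈ Set.Ioc (0 : ℝ) (1 / 2),
    |Real.sin (Real.pi * w) ^ 2 * Real.cos (2 * Real.pi * m * w) -
      sinSqPoly N w * cosPoly N (2 * Real.pi * m * w)| ≤ C * w ^ (2 * N + 2) ∧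
    |sinSqPoly N w * cosPoly N (2 * Real.pi * m * w)| ≤ C * w ^ 2 := by
  obtain ⟨C₁, hC₁, h₁⟩ := exists_cos_sub_cosPoly_le N (2 * Real.pi)
  obtain ⟨C₂, hC₂, h₂⟩ := exists_cos_sub_cosPoly_le N (2 * Real.pi * m)
  refine ⟨C₁ + (Real.pi ^ 2 + C₁) * (C₂ + 1), by positivity, fun w hw => ?_⟩
  obtain ⟨h0, h1⟩ := hw
  have hb₁ := h₁ w h0.le h1
  have hb₂ := h₂ w h0.le h1
  set s := Real.sin (Real.pi * w) ^ 2 with hs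
  set c := Real.cos (2 * Real.pi * m * w)
  set p := sinSqPoly N w
  set r := cosPoly N (2 * Real.pi * m * w)
  have hw1 : w ≤ 1 := by linarith
  have hwp : w ^ (2 * N + 2) ≤ w ^ 2 := pow_le_pow_of_le_one h0.le hw1 (by omega)
  have hwp1 : w ^ (2 * N + 2) ≤ 1 := pow_le_one₀ h0.le hw1
  have hw2 : w ^ 2 ≤ 1 := pow_le_one₀ h0.le hw1
  have hwpos : 0 < w ^ (2 * N + 2) := by positivity
  have hsp : |s - p| ≤ C₁ * w ^ (2 * N + 2) := by
    rw [hs, sin_sq_sub_sinSqPoly, abs_div, abs_neg, abs_two]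
    have := mul_nonneg hC₁ hwpos.le
    linarith
  have hsb : |s| ≤ Real.pi ^ 2 * w ^ 2 := by
    rw [hs, abs_of_nonneg (sq_nonneg _), ← mul_pow, sq_le_sq]
    exact Real.abs_sin_le_abs
  have hc : |c| ≤ 1 := Real.abs_cos_le_one _
  have hp : |p| ≤ (Real.pi ^ 2 + C₁) * w ^ 2 := by
    have h3 : |p| ≤ |s| + |s - p| := by
      have := abs_sub s (s - p)
      rwa [sub_sub_cancel] at this
    nlinarith
  have hr : |r| ≤ C₂ + 1 := by
    have h3 : |r| ≤ |c| + |c - r| := by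
      have := abs_sub c (c - r)
      rwa [sub_sub_cancel] at this
    nlinarith
  constructor
  · have h3 : s * c - p * r = (s - p) * c + p * (c - r) := by ring
    rw [h3]
    refine (abs_add_le _ _).trans ?_
    rw [abs_mul, abs_mul]
    have h4 : |s - p| * |c| ≤ C₁ * w ^ (2 * N + 2) * 1 := by gcongr
    have h5 : |p| * |c - r| ≤ (Real.pi ^ 2 + C₁) * w ^ 2 * (C₂ * w ^ (2 * N + 2)) := by gcongr
    have h6 : (Real.pi ^ 2 + C₁) * w ^ 2 * (C₂ * w ^ (2 * N + 2)) ≤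
        (Real.pi ^ 2 + C₁) * 1 * ((C₂ + 1) * w ^ (2 * N + 2)) := by
      gcongr; linarith
    linarith
  · rw [abs_mul]
    have h5 : |p| * |r| ≤ (Real.pi ^ 2 + C₁) * w ^ 2 * (C₂ + 1) := by gcongr
    have : 0 ≤ C₁ * w ^ 2 := by positivity
    linarith

lemma integrableOn_pow_mul_kernel {z : ℂ} (hz : 0 < z.re) {L : ℕ} (hL : 1 ≤ L) :
    IntegrableOn (fun w : ℝ => (w : ℂ) ^ (2 * L) * kernel z w) (Set.Ioi 0) := by
  obtain ⟨L, rfl⟩ := Nat.exists_eq_add_of_le' hL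
  refine integrableOn_of_kernelBound measurableSet_Ioi subset_rfl (D := 1) (K := 2 * L)
    (inv_re_pos hz) ((by fun_prop : Measurable fun w : ℝ => (w : ℂ) ^ (2 * (L + 1))).mul
      (measurable_kernel z)) fun w hw => ?_
  have hw' : (0 : ℝ) < w := hw
  rw [norm_mul, norm_pow, norm_real, Real.norm_of_nonneg hw'.le, one_mul]
  rw [show 2 * (L + 1) = 2 * L + 2 by ring]
  gcongr
  exact norm_kernel_le hz hw

/-- The contribution of one term of the triple series. -/
lemma mul_integral_pow_mul_kernel (m : ℤ) {z : ℂ} (hz : 0 < z.re) {t : ℕ × ℕ × ℕ}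
    (ht : 1 ≤ t.1) :
    8 * (Real.pi : ℂ) ^ 2 / z ^ 2 * ((taylorCoeff m t : ℂ) * (z⁻¹ ^ t.2.2 *
      ∫ w : ℝ in Set.Ioi 0, (w : ℂ) ^ (2 * (t.1 + t.2.1 + t.2.2)) * kernel z w)) =
    (seriesCoeff m t : ℂ) * z ^ (2 * (t.1 + t.2.1) + t.2.2 - 1) := by
  have h0 : z ≠ 0 := by rintro rfl; simp at hz
  have hpi0 : (Real.pi : ℂ) ≠ 0 := ofReal_ne_zero.2 Real.pi_ne_zero
  obtain ⟨l₁, l₂, j⟩ := t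
  simp only at ht ⊢
  have hre : 0 < (2 * (Real.pi : ℂ) ^ 2 / z).re := by
    have := ofReal_div_re (2 * Real.pi ^ 2) z
    push_cast at this
    rw [this]
    have := inv_re_pos hz
    positivity
  have hinteg := integral_pow_div_sinh_sq (L := l₁ + l₂ + j) (by omega) hre
  have hfun : (fun w : ℝ => (w : ℂ) ^ (2 * (l₁ + l₂ + j)) * kernel z w) = fun w : ℝ =>
      (w : ℂ) ^ (2 * (l₁ + l₂ + j)) * (sinh (2 * (Real.pi : ℂ) ^ 2 / z * w) ^ 2)⁻¹ := by
    funext w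
    rw [kernel, div_mul_eq_mul_div]
  rw [hfun, hinteg, taylorCoeff, seriesCoeff]
  push_cast
  have hsign : (-1 : ℂ) ^ l₁ * (-1) ^ l₂ * (-1) ^ (l₁ + l₂ + j + 1) = -(-1) ^ j := by
    rw [← pow_add, ← pow_add, show l₁ + l₂ + (l₁ + l₂ + j + 1) = 2 * (l₁ + l₂) + j + 1 by ring,
      pow_succ, pow_add, pow_mul]
    simp
  obtain ⟨l, rfl⟩ := Nat.exists_eq_add_of_le' ht
  -- With L the sum of the three indices, the moment at c = 2π²/z gives z^{2L+1}; the prefactor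
  -- takes away z² and the exponential series z^j. The natural subtraction is harmless because l₁ ≥
  -- 1.
  have hz1 : z ^ (2 * (l + 1 + l₂ + j) + 1) = z ^ 2 * z ^ j * z ^ (2 * (l + 1 + l₂) + j - 1) := by
    rw [← pow_add, ← pow_add]; congr 1; omega
  have hp : (2 * (Real.pi : ℂ)) ^ (2 * (l + 1)) * (2 * (Real.pi : ℂ)) ^ (2 * l₂) *
      (4 * (Real.pi : ℂ) ^ 2) ^ j * (Real.pi : ℂ) ^ (2 * (l + 1 + l₂ + j)) * (2 * Real.pi ^ 2) =
      (2 * (Real.pi : ℂ) ^ 2) ^ (2 * (l + 1 + l₂ + j) + 1) := by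
    rw [show 4 * (Real.pi : ℂ) ^ 2 = (2 * Real.pi) ^ 2 by ring, ← pow_mul, ← pow_add, ← pow_add,
      show 2 * (l + 1) + 2 * l₂ + 2 * j = 2 * (l + 1 + l₂ + j) by ring, ← mul_pow, pow_succ]
    congr 2
    ring
  have hP0 : (2 * (Real.pi : ℂ) ^ 2) ^ (2 * (l + 1 + l₂ + j) + 1) ≠ 0 :=
    pow_ne_zero _ (mul_ne_zero two_ne_zero (pow_ne_zero _ hpi0))
  have hf1 : ((2 * (l + 1)).factorial : ℂ) ≠ 0 := Nat.cast_ne_zero.2 (Nat.factorial_ne_zero _)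
  have hf2 : ((2 * l₂).factorial : ℂ) ≠ 0 := Nat.cast_ne_zero.2 (Nat.factorial_ne_zero _)
  have hf3 : (j.factorial : ℂ) ≠ 0 := Nat.cast_ne_zero.2 (Nat.factorial_ne_zero _)
  rw [mul_pow (2 * (Real.pi : ℂ)) (m : ℂ), div_pow, hz1, inv_pow]
  rw [← hp] at hP0 ⊢
  have hzz : z ^ 2 ≠ 0 := pow_ne_zero _ h0
  have hzj : z ^ j ≠ 0 := pow_ne_zero _ h0
  have ha : (2 * (Real.pi : ℂ)) ^ (2 * (l + 1)) ≠ 0 :=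
    pow_ne_zero _ (mul_ne_zero two_ne_zero hpi0)
  have hb : (2 * (Real.pi : ℂ)) ^ (2 * l₂) ≠ 0 := pow_ne_zero _ (mul_ne_zero two_ne_zero hpi0)
  have hc : (4 * (Real.pi : ℂ) ^ 2) ^ j ≠ 0 :=
    pow_ne_zero _ (mul_ne_zero (by norm_num) (pow_ne_zero _ hpi0))
  have hd : (Real.pi : ℂ) ^ (2 * (l + 1 + l₂ + j)) ≠ 0 := pow_ne_zero _ hpi0
  generalize (2 * (Real.pi : ℂ)) ^ (2 * (l + 1)) = a at *
  generalize (2 * (Real.pi : ℂ)) ^ (2 * l₂) = b at *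
  generalize (4 * (Real.pi : ℂ) ^ 2) ^ j = c at *
  generalize (Real.pi : ℂ) ^ (2 * (l + 1 + l₂ + j)) = d at *
  generalize z ^ (2 * (l + 1 + l₂) + j - 1) = Z
  generalize ((2 * (l + 1)).factorial : ℂ) = f1 at *
  generalize ((2 * l₂).factorial : ℂ) = f2 at *
  generalize (j.factorial : ℂ) = f3 at *
  generalize z ^ 2 = z2 at *
  generalize z ^ j = zj at *
  generalize ((bernoulli (2 * (l + 1 + l₂ + j)) : ℚ) : ℂ) = Be
  generalize (m : ℂ) ^ (2 * l₂) = mm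
  generalize (-1 : ℂ) ^ (l + 1) = s1 at *
  generalize (-1 : ℂ) ^ l₂ = s2 at *
  generalize (-1 : ℂ) ^ (l + 1 + l₂ + j + 1) = s3 at *
  generalize (-1 : ℂ) ^ j = s4 at *
  field_simp
  linear_combination (-8 * Be * mm * Z) * hsign

lemma gMainCoeff_eq (m : ℤ) {r N : ℕ} (hr : r ≤ N) : gMainCoeff m r =
    ∑ t ∈ tripleIndex N, if 2 * (t.1 + t.2.1) + t.2.2 = r + 1 then seriesCoeff m t else 0 := by
  have h1 : gMainCoeff m r = ∑ t ∈ tripleIndex r,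
      if 2 * (t.1 + t.2.1) + t.2.2 = r + 1 then seriesCoeff m t else 0 := by
    rw [gMainCoeff, tripleIndex, Finset.sum_product, Finset.mul_sum]
    refine Finset.sum_congr rfl fun l₁ _ => ?_
    rw [Finset.sum_product, Finset.mul_sum]
    refine Finset.sum_congr rfl fun l₂ _ => ?_
    rw [Finset.mul_sum]
    refine Finset.sum_congr rfl fun j _ => ?_
    simp only [seriesCoeff]
    split_ifs <;> simp
  rw [h1]
  refine Finset.sum_subset ?_ fun t ht ht' => ?_
  · intro t ht
    simp only [tripleIndex, Finset.mem_product, Finset.mem_Icc, Finset.mem_range] at ht ⊢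
    omega
  · rw [if_neg]
    intro h
    apply ht'
    simp only [tripleIndex, Finset.mem_product, Finset.mem_Icc, Finset.mem_range] at ht ⊢
    omega

lemma isBigO_pow_sector (κ : ℝ) {a b : ℕ} (h : b ≤ a) :
    (fun z : ℂ => z ^ a) =O[𝓝[sector κ] 0] fun z : ℂ => z ^ b := by
  refine IsBigO.of_bound 1 ?_
  filter_upwards [eventually_sector κ] with z hz
  rw [one_mul, norm_pow, norm_pow]
  exact pow_le_pow_of_le_one (norm_nonneg z) hz.2 h

/-- The box of indices contains every term with exponent at most N; its remaining terms have
exponent at least N + 1. -/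
lemma isBigO_sum_series (m : ℤ) (N : ℕ) (κ : ℝ) :
    (fun z : ℂ => ∑ t ∈ tripleIndex N, (seriesCoeff m t : ℂ) * z ^ (2 * (t.1 + t.2.1) + t.2.2 - 1) -
      ∑ r ∈ Finset.range (N + 1), (gMainCoeff m r : ℂ) * z ^ r)
      =O[𝓝[sector κ] 0] fun z : ℂ => z ^ (N + 1) := by
  have h (z : ℂ) : ∑ r ∈ Finset.range (N + 1), (gMainCoeff m r : ℂ) * z ^ r =
      ∑ t ∈ tripleIndex N, if 2 * (t.1 + t.2.1) + t.2.2 ≤ N + 1 then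
        (seriesCoeff m t : ℂ) * z ^ (2 * (t.1 + t.2.1) + t.2.2 - 1) else 0 := by
    have h1 : ∀ r ∈ Finset.range (N + 1), (gMainCoeff m r : ℂ) * z ^ r =
        ∑ t ∈ tripleIndex N, if r = 2 * (t.1 + t.2.1) + t.2.2 - 1 then
          (seriesCoeff m t : ℂ) * z ^ (2 * (t.1 + t.2.1) + t.2.2 - 1) else 0 := by
      intro r hr
      rw [gMainCoeff_eq m (N := N) (by simpa [Nat.lt_succ_iff] using hr)]
      push_cast
      rw [Finset.sum_mul]
      refine Finset.sum_congr rfl fun t ht => ?_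
      simp only [tripleIndex, Finset.mem_product, Finset.mem_Icc, Finset.mem_range] at ht
      by_cases h : 2 * (t.1 + t.2.1) + t.2.2 = r + 1
      · rw [if_pos h, if_pos (by omega), h, Nat.add_sub_cancel]
      · rw [if_neg h, if_neg (by omega)]
        simp
    rw [Finset.sum_congr rfl h1, Finset.sum_comm]
    refine Finset.sum_congr rfl fun t ht => ?_
    rw [Finset.sum_ite_eq']
    simp only [tripleIndex, Finset.mem_product, Finset.mem_Icc, Finset.mem_range] at ht ⊢
    by_cases h : 2 * (t.1 + t.2.1) + t.2.2 ≤ N + 1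
    · rw [if_pos h, if_pos (by omega)]
    · rw [if_neg h, if_neg (by omega)]
  simp_rw [h, ← Finset.sum_sub_distrib]
  refine IsBigO.fun_sum fun t _ => ?_
  by_cases h : 2 * (t.1 + t.2.1) + t.2.2 ≤ N + 1
  · simp only [if_pos h, sub_self]
    exact isBigO_zero _ _
  · simp only [if_neg h, sub_zero]
    exact (isBigO_pow_sector κ (by omega)).const_mul_left _

/-- The asymptotic expansion of `gMain` in sectors. -/
lemma gMain_isBigO (m : ℤ) (N : ℕ) {κ : ℝ} (hκ : 0 < κ) :
    (fun z : ℂ => gMain m z - ∑ r ∈ Finset.range (N + 1), (gMainCoeff m r : ℂ) * z ^ r)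
      =O[𝓝[sector κ] 0] fun z : ℂ => z ^ (N + 1) := by
  obtain ⟨C, hC, hb⟩ := exists_taylor_bounds m N
  have hS : MeasurableSet (Set.Ioc (0 : ℝ) (1 / 2)) := measurableSet_Ioc
  have hS0 : Set.Ioc (0 : ℝ) (1 / 2) ⊆ Set.Ioi 0 := Set.Ioc_subset_Ioi_self
  let v : ℂ → ℝ → ℂ := fun z w => 4 * (Real.pi : ℂ) ^ 2 * (w : ℂ) ^ 2 / z
  -- G₁ is the error of truncating the trigonometric factors, G₂ that of truncating the exponential,
  -- and the Q are the monomials that remain. Each Q is integrated over (0, ∞) and the tail beyond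
  -- 1/2 is subtracted.
  let G₁ : ℂ → ℝ → ℂ := fun z w => ((Real.sin (Real.pi * w) ^ 2 * Real.cos (2 * Real.pi * m * w) -
      sinSqPoly N w * cosPoly N (2 * Real.pi * m * w) : ℝ) : ℂ) * (kernel z w * exp (v z w))
  let G₂ : ℂ → ℝ → ℂ := fun z w => ((sinSqPoly N w * cosPoly N (2 * Real.pi * m * w) : ℝ) : ℂ) *
    (kernel z w * (exp (v z w) - ∑ j ∈ Finset.range (N + 1), v z w ^ j / j.factorial))
  let Q : ℂ → ℕ × ℕ × ℕ → ℝ → ℂ := fun z t w => (taylorCoeff m t : ℂ) * (z⁻¹ ^ t.2.2 *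
    ((w : ℂ) ^ (2 * (t.1 + t.2.1 + t.2.2)) * kernel z w))
  have hdec (z : ℂ) (w : ℝ) : mainIntegrand m z w =
      G₁ z w + G₂ z w + ∑ t ∈ tripleIndex N, Q z t w := by
    have h := sum_taylorCoeff m N z w
    have hQ : ∑ t ∈ tripleIndex N, Q z t w =
        (((sinSqPoly N w * cosPoly N (2 * Real.pi * m * w) : ℝ) : ℂ) *
          ∑ j ∈ Finset.range (N + 1), v z w ^ j / j.factorial) * kernel z w := by
      simp only [v, h, Q, Finset.sum_mul]
      refine Finset.sum_congr rfl fun t _ => ?_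
      ring
    rw [hQ, mainIntegrand_eq]
    simp only [G₁, G₂, v]
    push_cast
    ring
  have hG₁ : ∀ z ∈ sector κ, ‖z‖ ≤ 1 → ∀ w ∈ Set.Ioc (0 : ℝ) (1 / 2), ‖G₁ z w‖ ≤
      C * (‖z‖ ^ 0 * ‖z‖⁻¹ ^ 0) * (w ^ (2 * N + 2) * kernelBound (z⁻¹).re w) := by
    intro z hz _ w hw
    have hw0 : 0 < w := hw.1
    have h1 := (hb w hw).1
    have h2 := norm_kernel_mul_cexp_le hz.1 hw
    simp only [G₁, v]
    rw [norm_mul, norm_real, Real.norm_eq_abs, pow_zero, pow_zero, mul_one, mul_one, ← mul_assoc]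
    gcongr
  have hG₂ : ∀ z ∈ sector κ, ‖z‖ ≤ 1 → ∀ w ∈ Set.Ioc (0 : ℝ) (1 / 2), ‖G₂ z w‖ ≤
      C * (4 * Real.pi ^ 2) ^ (N + 1) * (‖z‖ ^ 0 * ‖z‖⁻¹ ^ (N + 1)) *
        (w ^ (2 * N + 2 + 2) * kernelBound (z⁻¹).re w) := by
    intro z hz _ w hw
    have hw0 : 0 < w := hw.1
    have hρ := inv_re_pos hz.1
    have h1 := (hb w hw).2
    have hre : 0 ≤ (v z w).re := by
      simp only [v]; rw [exp_arg_re]; positivity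
    have h2 := norm_exp_sub_sum_le (N + 1) hre
    have h3 := norm_kernel_mul_exp_re_le hz.1 hw
    have hv : ‖v z w‖ = 4 * Real.pi ^ 2 * w ^ 2 * ‖z‖⁻¹ := by
      simp only [v]
      rw [norm_div, norm_mul, norm_mul, norm_pow, norm_pow, norm_real, norm_real,
        Real.norm_of_nonneg Real.pi_pos.le, Real.norm_of_nonneg hw0.le, div_eq_mul_inv]
      norm_num
    simp only [G₂]
    rw [norm_mul, norm_real, Real.norm_eq_abs, norm_mul]
    calc |sinSqPoly N w * cosPoly N (2 * Real.pi * m * w)| * (‖kernel z w‖ *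
          ‖exp (v z w) - ∑ j ∈ Finset.range (N + 1), v z w ^ j / j.factorial‖)
        ≤ C * w ^ 2 * (‖kernel z w‖ * (‖v z w‖ ^ (N + 1) * Real.exp (v z w).re)) := by gcongr
      _ = C * w ^ 2 * ‖v z w‖ ^ (N + 1) * (‖kernel z w‖ * Real.exp (v z w).re) := by ring
      _ ≤ C * w ^ 2 * ‖v z w‖ ^ (N + 1) * kernelBound (z⁻¹).re w := by gcongr
      _ = _ := by
        rw [hv, mul_pow, mul_pow (4 * Real.pi ^ 2), ← pow_mul]
        ring
  have hQb (t : ℕ × ℕ × ℕ) (ht : 1 ≤ t.1) : ∀ z ∈ sector κ, ‖z‖ ≤ 1 → ∀ w ∈ Set.Ioi (1 / 2 : ℝ),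
      ‖Q z t w‖ ≤ |taylorCoeff m t| * 2 ^ N * (‖z‖ ^ 0 * ‖z‖⁻¹ ^ t.2.2) *
        (w ^ (2 * (t.1 + t.2.1 + t.2.2) + N - 2 + 2) * kernelBound (z⁻¹).re w) := by
    intro z hz _ w hw
    have hw' : (1 / 2 : ℝ) < w := hw
    have hw0 : 0 < w := by linarith
    have h1 := norm_kernel_le hz.1 hw0
    -- On the tail, inserting (2w)^N ≥ 1 raises the order of the moment and so gains N powers of
    -- |z|; exponential smallness is not needed.
    have h2 : 1 ≤ (2 * w) ^ N := one_le_pow₀ (by linarith)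
    simp only [Q]
    rw [norm_mul, norm_mul, norm_mul, norm_real, Real.norm_eq_abs, norm_pow, norm_inv, norm_pow,
      norm_real, Real.norm_of_nonneg hw0.le,
      show 2 * (t.1 + t.2.1 + t.2.2) + N - 2 + 2 = 2 * (t.1 + t.2.1 + t.2.2) + N by omega]
    calc |taylorCoeff m t| * (‖z‖⁻¹ ^ t.2.2 * (w ^ (2 * (t.1 + t.2.1 + t.2.2)) * ‖kernel z w‖))
        ≤ |taylorCoeff m t| * (‖z‖⁻¹ ^ t.2.2 * ((w ^ (2 * (t.1 + t.2.1 + t.2.2)) * (2 * w) ^ N) *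
          kernelBound (z⁻¹).re w)) := by
          have := kernelBound_nonneg (z⁻¹).re w
          gcongr
          exact le_mul_of_one_le_right (by positivity) h2
      _ = _ := by rw [mul_pow, pow_add]; ring
  have hO₁ := isBigO_integral_of_kernelBound hκ hS hS0 (N := N) hC (by omega) hG₁
  have hO₂ := isBigO_integral_of_kernelBound hκ hS hS0 (N := N) (by positivity) (by omega) hG₂
  have hO₃ : (fun z : ℂ => ∑ t ∈ tripleIndex N, 8 * (Real.pi : ℂ) ^ 2 / z ^ 2 *
      ∫ w in Set.Ioi (1 / 2 : ℝ), Q z t w) =O[𝓝[sector κ] 0] fun z : ℂ => z ^ (N + 1) := by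
    refine IsBigO.fun_sum fun t ht => ?_
    simp only [tripleIndex, Finset.mem_product, Finset.mem_Icc, Finset.mem_range] at ht
    exact isBigO_integral_of_kernelBound hκ measurableSet_Ioi
      (Set.Ioi_subset_Ioi (by norm_num)) (by positivity) (by omega) (hQb t ht.1.1)
  refine (((hO₁.add hO₂).sub hO₃).add (isBigO_sum_series m N κ)).congr' ?_ EventuallyEq.rfl
  filter_upwards [eventually_sector κ] with z hz
  obtain ⟨hz, hz1⟩ := hz
  have hρ := inv_re_pos hz.1
  have hvm : Measurable (v z) := by simp only [v]; fun_prop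
  have hpm : Measurable fun w : ℝ => sinSqPoly N w := by
    unfold sinSqPoly
    fun_prop
  have hcm : Measurable fun w : ℝ => cosPoly N (2 * Real.pi * m * w) := by
    unfold cosPoly
    fun_prop
  have hkm := measurable_kernel z
  have hi₁ : IntegrableOn (G₁ z) (Set.Ioc 0 (1 / 2)) :=
    integrableOn_of_kernelBound hS hS0 hρ (by simp only [G₁]; fun_prop) (hG₁ z hz hz1)
  have hi₂ : IntegrableOn (G₂ z) (Set.Ioc 0 (1 / 2)) :=
    integrableOn_of_kernelBound hS hS0 hρ (by simp only [G₂]; fun_prop) (hG₂ z hz hz1)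
  have hi₃ (t : ℕ × ℕ × ℕ) (ht : t ∈ tripleIndex N) : IntegrableOn (Q z t) (Set.Ioi 0) := by
    simp only [tripleIndex, Finset.mem_product, Finset.mem_Icc, Finset.mem_range] at ht
    exact ((integrableOn_pow_mul_kernel hz.1 (by omega)).const_mul _).const_mul _
  have hsplit (t : ℕ × ℕ × ℕ) (ht : t ∈ tripleIndex N) :
      8 * (Real.pi : ℂ) ^ 2 / z ^ 2 * ∫ w in Set.Ioc (0 : ℝ) (1 / 2), Q z t w =
        (seriesCoeff m t : ℂ) * z ^ (2 * (t.1 + t.2.1) + t.2.2 - 1) -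
          8 * (Real.pi : ℂ) ^ 2 / z ^ 2 * ∫ w in Set.Ioi (1 / 2 : ℝ), Q z t w := by
    have h1 : ∫ w in Set.Ioi (0 : ℝ), Q z t w = (∫ w in Set.Ioc (0 : ℝ) (1 / 2), Q z t w) +
        ∫ w in Set.Ioi (1 / 2 : ℝ), Q z t w := by
      rw [← Set.Ioc_union_Ioi_eq_Ioi (show (0 : ℝ) ≤ 1 / 2 by norm_num)]
      exact setIntegral_union (Set.Ioc_disjoint_Ioi le_rfl) measurableSet_Ioi
        ((hi₃ t ht).mono_set hS0) ((hi₃ t ht).mono_set (Set.Ioi_subset_Ioi (by norm_num)))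
    have h2 : ∫ w in Set.Ioi (0 : ℝ), Q z t w = (taylorCoeff m t : ℂ) * (z⁻¹ ^ t.2.2 *
        ∫ w : ℝ in Set.Ioi 0, (w : ℂ) ^ (2 * (t.1 + t.2.1 + t.2.2)) * kernel z w) := by
      simp only [Q]
      rw [integral_const_mul, integral_const_mul]
    have ht1 : 1 ≤ t.1 := by
      simp only [tripleIndex, Finset.mem_product, Finset.mem_Icc, Finset.mem_range] at ht
      exact ht.1.1
    rw [← mul_integral_pow_mul_kernel m hz.1 ht1, ← h2, h1]
    ring
  have hinteg : ∫ w in Set.Ioc (0 : ℝ) (1 / 2), mainIntegrand m z w =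
      (∫ w in Set.Ioc (0 : ℝ) (1 / 2), G₁ z w) + (∫ w in Set.Ioc (0 : ℝ) (1 / 2), G₂ z w) +
        ∑ t ∈ tripleIndex N, ∫ w in Set.Ioc (0 : ℝ) (1 / 2), Q z t w := by
    have hi₃' : ∀ t ∈ tripleIndex N, IntegrableOn (Q z t) (Set.Ioc 0 (1 / 2)) :=
      fun t ht => (hi₃ t ht).mono_set hS0
    have h12 : IntegrableOn (fun w => G₁ z w + G₂ z w) (Set.Ioc 0 (1 / 2)) := hi₁.add hi₂
    simp_rw [hdec]
    rw [integral_add h12 (integrable_finsetSum _ hi₃'), integral_add hi₁ hi₂,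
      integral_finsetSum _ hi₃']
  rw [gMain_eq, hinteg, mul_add, mul_add, Finset.mul_sum, Finset.sum_congr rfl hsplit,
    Finset.sum_sub_distrib]
  ring

end MainIntegral

end ChiGenus

/-! ### Multiplication by e^{-kz/24} -/

namespace ChiGenus

open Complex MeasureTheory Filter Topology Asymptotics

section ExpProduct

lemma exp_isBigO (c : ℂ) (n : ℕ) (l : Filter ℂ) (hl : l ≤ 𝓝 0) :
    (fun z : ℂ => exp (c * z) - ∑ j ∈ Finset.range n, (c * z) ^ j / j.factorial)
      =O[l] fun z : ℂ => z ^ n := by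
  refine IsBigO.of_bound (‖c‖ ^ n * Real.exp ‖c‖) ?_
  filter_upwards [hl (Metric.closedBall_mem_nhds (0 : ℂ) one_pos)] with z hz
  have hz1 : ‖z‖ ≤ 1 := by simpa using hz
  refine (Complex.norm_exp_sub_sum_le_norm_mul_exp _ n).trans ?_
  have h2 : ‖c * z‖ ≤ ‖c‖ := by
    rw [norm_mul]
    exact mul_le_of_le_one_right (norm_nonneg _) hz1
  have h3 : Real.exp ‖c * z‖ ≤ Real.exp ‖c‖ := Real.exp_le_exp.2 h2
  calc ‖c * z‖ ^ n * Real.exp ‖c * z‖ ≤ ‖c * z‖ ^ n * Real.exp ‖c‖ := by gcongr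
    _ = ‖c‖ ^ n * Real.exp ‖c‖ * ‖z ^ n‖ := by rw [norm_mul, mul_pow, norm_pow]; ring

lemma sum_d_mul_pow (m : ℤ) (k N : ℕ) (z : ℂ) :
    ∑ ℓ ∈ Finset.Icc 1 N, (d m k ℓ : ℂ) * z ^ ℓ = ∑ r ∈ Finset.range (N + 1),
      (gMainCoeff m r : ℂ) * z ^ r *
        ∑ j ∈ Finset.range (N + 1 - r), (-((k : ℂ) / 24) * z) ^ j / j.factorial := by
  -- The range of l₁ is empty for r = 0, so the series of g_{m,1} has no constant term and the sum
  -- may start at ℓ = 1.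
  have h0 : d m k 0 = 0 := by simp [d, gMainCoeff]
  have h1 : ∑ ℓ ∈ Finset.Icc 1 N, (d m k ℓ : ℂ) * z ^ ℓ =
      ∑ ℓ ∈ Finset.range (N + 1), (d m k ℓ : ℂ) * z ^ ℓ := by
    refine Finset.sum_subset (fun ℓ hℓ => ?_) fun ℓ hℓ hℓ' => ?_
    · rw [Finset.mem_Icc] at hℓ
      exact Finset.mem_range.2 (by omega)
    · have : ℓ = 0 := by
        rw [Finset.mem_Icc] at hℓ'
        rw [Finset.mem_range] at hℓ
        omega
      simp [this, h0]
  have h2 (ℓ : ℕ) : (d m k ℓ : ℂ) * z ^ ℓ = ∑ r ∈ Finset.range (ℓ + 1),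
      (gMainCoeff m r : ℂ) * z ^ r *
        ((-((k : ℂ) / 24) * z) ^ (ℓ - r) / (ℓ - r).factorial) := by
    rw [d, Finset.Nat.sum_antidiagonal_eq_sum_range_succ_mk]
    push_cast
    rw [Finset.sum_mul]
    refine Finset.sum_congr rfl fun r hr => ?_
    have : z ^ ℓ = z ^ r * z ^ (ℓ - r) := by
      rw [← pow_add, Nat.add_sub_cancel' (Nat.lt_succ_iff.1 (Finset.mem_range.1 hr))]
    rw [this, mul_pow]
    ring
  rw [h1]
  simp_rw [h2, Finset.mul_sum]
  exact Finset.sum_range_diag_flip (N + 1) fun r j => (gMainCoeff m r : ℂ) * z ^ r *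
        ((-((k : ℂ) / 24) * z) ^ j / j.factorial)

/-- Multiplication of an asymptotic expansion with coefficients `gMainCoeff` by the exponential
series. -/
lemma exp_mul_isBigO (m : ℤ) (k N : ℕ) {l : Filter ℂ} (hl : l ≤ 𝓝 0) {G : ℂ → ℂ}
    (hG : (fun z : ℂ => G z - ∑ r ∈ Finset.range (N + 1), (gMainCoeff m r : ℂ) * z ^ r)
      =O[l] fun z : ℂ => z ^ (N + 1)) :
    (fun z : ℂ => exp (-((k : ℂ) * z / 24)) * G z - ∑ ℓ ∈ Finset.Icc 1 N, (d m k ℓ : ℂ) * z ^ ℓ)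
      =O[l] fun z : ℂ => z ^ (N + 1) := by
  have hE : (fun z : ℂ => exp (-((k : ℂ) * z / 24))) =O[l] fun _ => (1 : ℂ) := by
    have : ContinuousAt (fun z : ℂ => exp (-((k : ℂ) * z / 24))) 0 := by fun_prop
    exact (this.isBigO_one ℂ).mono hl
  have h1 := hE.mul hG
  have h2 : (fun z : ℂ => ∑ r ∈ Finset.range (N + 1), (gMainCoeff m r : ℂ) * z ^ r *
      (exp (-((k : ℂ) / 24) * z) - ∑ j ∈ Finset.range (N + 1 - r),
        (-((k : ℂ) / 24) * z) ^ j / j.factorial)) =O[l] fun z : ℂ => z ^ (N + 1) := by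
    refine IsBigO.fun_sum fun r hr => ?_
    have h3 := ((isBigO_refl (fun z : ℂ => z ^ r) l).const_mul_left (gMainCoeff m r : ℂ)).mul
      (exp_isBigO (-((k : ℂ) / 24)) (N + 1 - r) l hl)
    refine h3.congr_right fun z => ?_
    rw [← pow_add, Nat.add_sub_cancel' (Finset.mem_range.1 hr).le]
  refine ((h1.congr_right fun z => one_mul _).add h2).congr_left fun z => ?_
  rw [sum_d_mul_pow]
  simp_rw [mul_sub, Finset.sum_sub_distrib]
  rw [← Finset.sum_mul, show -((k : ℂ) / 24) * z = -((k : ℂ) * z / 24) by ring]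
  ring

lemma exp_mul_gMain_isBigO (m : ℤ) (k N : ℕ) (M : ℝ) :
    (fun z : ℂ => exp (-((k : ℂ) * z / 24)) * gMain m z - ∑ ℓ ∈ Finset.Icc 1 N, (d m k ℓ : ℂ) * z ^ ℓ)
      =O[𝓝[{z : ℂ | 0 < z.re ∧ |z.im| ≤ M * z.re}] 0] fun z : ℂ => z ^ (N + 1) := by
  -- In the given sector |z| ≤ |Re z| + |Im z| ≤ (1 + |M|) Re z.
  have hκ : 0 < (1 + |M|)⁻¹ := by positivity
  refine (exp_mul_isBigO m k N nhdsWithin_le_nhds (gMain_isBigO m N hκ)).mono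
    (nhdsWithin_mono 0 fun z hz => ⟨hz.1, ?_⟩)
  rw [inv_mul_le_iff₀ (by positivity)]
  refine (norm_le_abs_re_add_abs_im z).trans ?_
  rw [abs_of_pos hz.1, add_mul, one_mul]
  gcongr
  exact hz.2.trans (mul_le_mul_of_nonneg_right (le_abs_self M) hz.1.le)

end ExpProduct

/-! ### The major arc after modular inversion -/

section MajorArc

/-- The factor of `core` that appears after the modular transformation. -/
noncomputable def dualCore (k : ℕ) (z : ℂ) (w : ℝ) : ℂ :=
  core k (exp (4 * Real.pi ^ 2 * w / z)) (exp (-(4 * Real.pi ^ 2 / z)))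

lemma fz_eq (k : ℕ) {z : ℂ} (hz : 0 < z.re) {w : ℝ} (hw : w ∈ Set.Ioc (0 : ℝ) (1 / 2)) :
    fz k z w = (z / (2 * Real.pi)) ^ ((k : ℂ) / 2) * exp (k * Real.pi ^ 2 / (6 * z)) *
      (4 * (Real.pi : ℂ) ^ 2 / z ^ 2 * (sin (Real.pi * w) ^ 2 /
        sinh (2 * (Real.pi : ℂ) ^ 2 * w / z) ^ 2 * exp (4 * (Real.pi : ℂ) ^ 2 * (w : ℂ) ^ 2 / z) *
          dualCore k z w)) := by
  have h : fz k z w = exp (k * z / 24) / euler (exp (-z)) ^ k *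
      (euler (exp (-z)) ^ 2 / thetaProd (exp (2 * Real.pi * I * w)) (exp (-z))) ^ 2 := by
    rw [fz, core]
    ring
  have he : exp (4 * (Real.pi : ℂ) ^ 2 * (w : ℂ) ^ 2 / z) =
      exp (2 * Real.pi ^ 2 * w ^ 2 / z) ^ 2 := by
    rw [← exp_nat_mul]
    congr 1
    push_cast
    ring
  rw [h, euler_sq_div_thetaProd_eq hz hw.1 hw.2, exp_div_euler_pow_eq k hz, he, dualCore, core]
  ring

lemma continuous_fz (k : ℕ) {z : ℂ} (hz : 0 < z.re) : Continuous fun w : ℝ => fz k z w := by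
  have hq := norm_exp_neg_lt_one hz
  have h1 : Continuous fun w : ℝ => thetaProd (exp (2 * Real.pi * I * w)) (exp (-z)) :=
    (differentiable_thetaProd hq).continuous.comp continuous_ofReal
  have h2 (w : ℝ) : thetaProd (exp (2 * Real.pi * I * w)) (exp (-z)) ≠ 0 := by
    refine thetaProd_ne_zero hq ?_ ?_ <;>
    simpa [norm_exp_two_pi_ofReal] using hq
  unfold fz core
  have h3 := euler_ne_zero hq
  exact continuous_const.mul (((continuous_const.div h1 h2).pow 2).div_const _)

/-- Allows the half w < 0 to be folded onto w > 0, where the inversion formula is available; the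
characters e^{±2πimw} then combine to a cosine. -/
lemma fz_neg (k : ℕ) (z : ℂ) (w : ℂ) : fz k z (-w) = fz k z w := by
  rw [fz, fz, core, core, mul_neg, exp_neg (2 * Real.pi * I * w), thetaProd_inv]

/-- The Fourier coefficient, written through the modular transformation. -/
lemma fourierF_eq (k : ℕ) (m : ℤ) {z : ℂ} (hz : 0 < z.re) :
    fourierF k m z = (z / (2 * Real.pi)) ^ ((k : ℂ) / 2) * exp (k * Real.pi ^ 2 / (6 * z)) *
      (8 * (Real.pi : ℂ) ^ 2 / z ^ 2 *
        ∫ w in Set.Ioc (0 : ℝ) (1 / 2), mainIntegrand m z w * dualCore k z w) := by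
  have hF : Continuous fun w : ℝ => fz k z w * exp (-(2 * Real.pi * I * m * w)) :=
    (continuous_fz k hz).mul (by fun_prop)
  have hF' : Continuous fun w : ℝ => fz k z w * exp (2 * Real.pi * I * m * w) :=
    (continuous_fz k hz).mul (by fun_prop)
  have h1 : ∫ w in (-(1 / 2) : ℝ)..0, fz k z w * exp (-(2 * Real.pi * I * m * w)) =
      ∫ w in (0 : ℝ)..(1 / 2), fz k z w * exp (2 * Real.pi * I * m * w) := by
    have := intervalIntegral.integral_comp_neg (a := 0) (b := 1 / 2)
      (fun w : ℝ => fz k z w * exp (-(2 * Real.pi * I * m * w)))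
    rw [neg_zero] at this
    rw [← this]
    refine intervalIntegral.integral_congr fun w _ => ?_
    simp only [ofReal_neg, fz_neg, mul_neg, neg_neg]
  rw [fourierF, ← intervalIntegral.integral_add_adjacent_intervals
    (hF.intervalIntegrable _ 0) (hF.intervalIntegrable 0 _), h1,
    ← intervalIntegral.integral_add (hF'.intervalIntegrable _ _) (hF.intervalIntegrable _ _),
    intervalIntegral.integral_of_le (by norm_num), ← integral_const_mul, ← integral_const_mul]
  refine setIntegral_congr_fun measurableSet_Ioc fun w hw => ?_
  have hcos : cos (2 * Real.pi * m * w) =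
      (exp (2 * Real.pi * I * m * w) + exp (-(2 * Real.pi * I * m * w))) / 2 := by
    rw [cos]
    ring_nf
  simp only [fz_eq k hz hw, mainIntegrand, hcos]
  ring

lemma measurable_dualCore (k : ℕ) {z : ℂ} (hz : 0 < z.re) : Measurable (dualCore k z) := by
  have hq : ‖exp (-(4 * (Real.pi : ℂ) ^ 2 / z))‖ < 1 := by
    refine norm_exp_neg_lt_one ?_
    have := ofReal_div_re (4 * Real.pi ^ 2) z
    push_cast at this
    rw [this]
    have := inv_re_pos hz
    positivity
  have h1 : Continuous fun w : ℝ => thetaProd (exp (4 * Real.pi ^ 2 * w / z))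
      (exp (-(4 * (Real.pi : ℂ) ^ 2 / z))) := by
    -- The point 2πw/(iz) is chosen so that e^{2πi · 2πw/(iz)} = e^{4π²w/z}.
    have := (differentiable_thetaProd hq).continuous.comp
      (show Continuous fun w : ℝ => 2 * (Real.pi : ℂ) * w / (I * z) by fun_prop)
    refine this.congr fun w => ?_
    simp only [Function.comp_apply]
    congr 2
    have hI := I_ne_zero
    have hz0 : z ≠ 0 := by rintro rfl; simp at hz
    field_simp
    ring
  unfold dualCore core
  exact ((measurable_const.div h1.measurable).pow_const 2).div_const _

lemma exp_neg_le_pow (N : ℕ) {x : ℝ} (hx : 0 < x) : Real.exp (-x) ≤ N.factorial * x⁻¹ ^ N := by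
  have h := Real.pow_div_factorial_le_exp x hx.le N
  rw [Real.exp_neg, inv_pow, ← div_eq_mul_inv, ← inv_div]
  gcongr

/-- Let ρ = Re (1/z) and let q, ζ be the transformed variables. For w ≤ 1/2, |ζq| = e^{-4π²(1-w)ρ} ≤
e^{-2π²ρ}, and |q|, |ζ⁻¹q| are no larger than this bound. So the logarithm of `dualCore` is
O(e^{-2π²ρ}), smaller than any power of |z| in the sector. The constant k + 8 is (k + 4) + 2 + 2,
from the weights in `core_eq_exp`. -/
lemma exists_dualCore_bound (k N : ℕ) {κ : ℝ} (hκ : 0 < κ) :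
    ∃ D : ℝ, 0 ≤ D ∧ ∀ z ∈ sector κ, ‖z‖ ≤ 1 → ∀ w ∈ Set.Ioc (0 : ℝ) (1 / 2),
      ‖dualCore k z w - 1‖ ≤ D * ‖z‖ ^ N := by
  set s₀ := Real.exp (-(2 * Real.pi ^ 2 * κ)) with hs₀
  have hpi := Real.pi_pos
  have hs₀1 : s₀ < 1 := by
    rw [hs₀, Real.exp_lt_one_iff, neg_lt_zero]
    positivity
  set A := ((k : ℝ) + 8) * ((1 - s₀)⁻¹ * (1 - s₀)⁻¹) with hA
  have h1s : 0 < 1 - s₀ := by linarith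
  have hA0 : 0 ≤ A := by positivity
  refine ⟨A * Real.exp A * (N.factorial * (2 * Real.pi ^ 2 * κ)⁻¹ ^ N), by positivity, ?_⟩
  intro z hz hz1 w hw
  have hρ := inv_re_pos hz.1
  set ρ := (z⁻¹).re with hρdef
  have hz0 : 0 < ‖z‖ := by
    have := hz.1
    rw [norm_pos_iff]; rintro rfl; simp at this
  have hρκ : ρ⁻¹ ≤ ‖z‖ / κ := inv_re_inv_le hκ hz
  -- The restriction |z| ≤ 1 keeps ρ away from 0, so the geometric sums are uniformly bounded
  -- through s ≤ s₀ < 1.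
  have hρκ' : κ ≤ ρ := by
    have h1 : ρ⁻¹ ≤ κ⁻¹ := hρκ.trans (by rw [inv_eq_one_div]; gcongr)
    exact (inv_le_inv₀ hρ hκ).1 h1
  set s := Real.exp (-(2 * Real.pi ^ 2 * ρ)) with hs
  have hss : s ≤ s₀ := Real.exp_le_exp.2 (by rw [neg_le_neg_iff]; gcongr)
  have hspos : 0 < s := Real.exp_pos _
  set q := exp (-(4 * (Real.pi : ℂ) ^ 2 / z)) with hq
  set ζ := exp (4 * (Real.pi : ℂ) ^ 2 * w / z) with hζ
  have hre (b : ℝ) : ‖exp (((b : ℝ) : ℂ) / z)‖ = Real.exp (b * ρ) := by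
    rw [Complex.norm_exp, ofReal_div_re]
  have hqn : ‖q‖ = Real.exp (-(4 * Real.pi ^ 2) * ρ) := by
    rw [hq, ← hre]; congr 2; push_cast; ring
  have hζq : ‖ζ * q‖ = Real.exp ((4 * Real.pi ^ 2 * w - 4 * Real.pi ^ 2) * ρ) := by
    rw [hq, hζ, ← exp_add, ← hre]; congr 2; push_cast; ring
  have hζq' : ‖ζ⁻¹ * q‖ = Real.exp ((-(4 * Real.pi ^ 2 * w) - 4 * Real.pi ^ 2) * ρ) := by
    rw [hq, hζ, ← exp_neg, ← exp_add, ← hre]; congr 2; push_cast; ring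
  have hp : 0 < Real.pi ^ 2 * ρ := by positivity
  have hw0 := hw.1
  have hw1 := hw.2
  have b1 : ‖q‖ ≤ s := by
    rw [hqn, hs]; exact Real.exp_le_exp.2 (by nlinarith)
  have b2 : ‖ζ * q‖ ≤ s := by
    rw [hζq, hs]; exact Real.exp_le_exp.2 (by nlinarith)
  have b3 : ‖ζ⁻¹ * q‖ ≤ s := by
    rw [hζq', hs]; exact Real.exp_le_exp.2 (by nlinarith)
  have key {x : ℂ} (hx : ‖x‖ ≤ s) :
      ‖∑' p, logTerm x q p‖ ≤ (1 - s₀)⁻¹ * (1 - s₀)⁻¹ * s := by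
    refine (norm_tsum_logTerm_le (by linarith) (by linarith)).trans ?_
    have i1 : (1 - ‖q‖)⁻¹ ≤ (1 - s₀)⁻¹ := by gcongr; linarith
    have i2 : (1 - ‖x‖)⁻¹ ≤ (1 - s₀)⁻¹ := by gcongr; linarith
    have i3 : 0 ≤ (1 - ‖x‖)⁻¹ := inv_nonneg.2 (by linarith)
    calc (1 - ‖q‖)⁻¹ * (‖x‖ * (1 - ‖x‖)⁻¹) ≤ (1 - s₀)⁻¹ * (s * (1 - s₀)⁻¹) := by gcongr
      _ = _ := by ring
  rw [dualCore, core_eq_exp k (by linarith) (by linarith) (by linarith)]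
  set S := ((k : ℂ) - 4) * ∑' p, logTerm q q p +
      (2 * ∑' p, logTerm (ζ * q) q p + 2 * ∑' p, logTerm (ζ⁻¹ * q) q p) with hS
  have hSb : ‖S‖ ≤ A * s := by
    have j1 : ‖(k : ℂ) - 4‖ ≤ k + 4 := by
      refine (norm_sub_le _ _).trans ?_
      simp
    refine (norm_add_le _ _).trans ((add_le_add le_rfl (norm_add_le _ _)).trans ?_)
    rw [norm_mul, norm_mul, norm_mul, Complex.norm_ofNat]
    have c1 := key b1
    have c2 := key b2
    have c3 := key b3
    have c4 := mul_le_mul j1 c1 (norm_nonneg _) (by positivity)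
    rw [hA]
    linarith
  have hSA : ‖S‖ ≤ A := hSb.trans (mul_le_of_le_one_right hA0 (by linarith))
  have hexp := Complex.norm_exp_sub_sum_le_norm_mul_exp S 1
  simp only [Finset.sum_range_one, pow_zero, Nat.factorial_zero, Nat.cast_one, div_one,
    pow_one] at hexp
  have hsN : s ≤ N.factorial * ((2 * Real.pi ^ 2 * κ)⁻¹ ^ N * ‖z‖ ^ N) := by
    refine (exp_neg_le_pow N (by positivity)).trans ?_
    rw [← mul_pow]
    have : (2 * Real.pi ^ 2 * ρ)⁻¹ ≤ (2 * Real.pi ^ 2 * κ)⁻¹ * ‖z‖ := by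
      rw [mul_inv, mul_inv _ κ, mul_assoc]
      have : ρ⁻¹ ≤ κ⁻¹ * ‖z‖ := by rwa [mul_comm, ← div_eq_mul_inv]
      gcongr
    gcongr
  calc ‖exp S - 1‖ ≤ ‖S‖ * Real.exp ‖S‖ := hexp
    _ ≤ A * s * Real.exp A := by gcongr
    _ ≤ A * (N.factorial * ((2 * Real.pi ^ 2 * κ)⁻¹ ^ N * ‖z‖ ^ N)) * Real.exp A := by gcongr
    _ = _ := by ring

/-- The function of `z` that is left of `fourierF` after the factors `z ^ (k / 2)` and
`exp (k π² / (6 z))` of the modular transformation have been removed. -/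
noncomputable def majorFactor (k : ℕ) (m : ℤ) (z : ℂ) : ℂ :=
  8 * (Real.pi : ℂ) ^ 2 / z ^ 2 *
    ∫ w in Set.Ioc (0 : ℝ) (1 / 2), mainIntegrand m z w * dualCore k z w

/-- `majorFactor` exceeds `gMain` by the integral of `mainIntegrand` against `dualCore` - 1, which
is O(z^{N+1}), so both have the same expansion. -/
lemma exp_mul_majorFactor_isBigO (m : ℤ) (k N : ℕ) {κ : ℝ} (hκ : 0 < κ) :
    (fun z : ℂ => exp (-((k : ℂ) * z / 24)) * majorFactor k m z -
      ∑ ℓ ∈ Finset.Icc 1 N, (d m k ℓ : ℂ) * z ^ ℓ) =O[𝓝[sector κ] 0] fun z : ℂ => z ^ (N + 1) := by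
  refine exp_mul_isBigO m k N nhdsWithin_le_nhds ?_
  obtain ⟨D, hD, hb⟩ := exists_dualCore_bound k N hκ
  have hbound : ∀ z ∈ sector κ, ‖z‖ ≤ 1 → ∀ w ∈ Set.Ioc (0 : ℝ) (1 / 2),
      ‖mainIntegrand m z w * (dualCore k z w - 1)‖ ≤ Real.pi ^ 2 * D * (‖z‖ ^ N * ‖z‖⁻¹ ^ 0) *
        (w ^ (0 + 2) * kernelBound (z⁻¹).re w) := by
    intro z hz hz1 w hw
    rw [norm_mul]
    have h1 := norm_mainIntegrand_le m hz.1 hw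
    have h2 := mul_le_mul h1 (hb z hz hz1 w hw) (norm_nonneg _) ((norm_nonneg _).trans h1)
    refine h2.trans (le_of_eq ?_)
    ring
  have hO := isBigO_integral_of_kernelBound hκ measurableSet_Ioc Set.Ioc_subset_Ioi_self
    (N := N) (by positivity) (by omega) hbound
  refine (hO.add (gMain_isBigO m N hκ)).congr' ?_ EventuallyEq.rfl
  filter_upwards [eventually_sector κ] with z hz
  obtain ⟨hz, hz1⟩ := hz
  have hρ := inv_re_pos hz.1
  have hi₁ : IntegrableOn (mainIntegrand m z) (Set.Ioc 0 (1 / 2)) :=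
    integrableOn_of_kernelBound measurableSet_Ioc Set.Ioc_subset_Ioi_self hρ
      (measurable_mainIntegrand m z) fun w hw => norm_mainIntegrand_le m hz.1 hw
  have hi₂ : IntegrableOn (fun w => mainIntegrand m z w * (dualCore k z w - 1))
      (Set.Ioc 0 (1 / 2)) :=
    integrableOn_of_kernelBound measurableSet_Ioc Set.Ioc_subset_Ioi_self hρ
      ((measurable_mainIntegrand m z).mul ((measurable_dualCore k hz.1).sub_const 1))
      (hbound z hz hz1)
  have hsum : ∫ w in Set.Ioc (0 : ℝ) (1 / 2), mainIntegrand m z w * dualCore k z w =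
      (∫ w in Set.Ioc (0 : ℝ) (1 / 2), mainIntegrand m z w * (dualCore k z w - 1)) +
        ∫ w in Set.Ioc (0 : ℝ) (1 / 2), mainIntegrand m z w := by
    rw [← integral_add hi₂ hi₁]
    refine integral_congr_ae (.of_forall fun w => ?_)
    simp only
    ring
  rw [majorFactor, hsum, gMain_eq]
  ring

end MajorArc

end ChiGenus

/-! ### The Bessel loop integral -/

namespace ChiGenus

open Complex MeasureTheory Filter Topology Asymptotics

section Bessel

lemma ofReal_mul_cpow {x : ℝ} (hx : 0 < x) {z : ℂ} (hz : z ≠ 0) (b : ℝ) :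
    ((x : ℂ) * z) ^ (b : ℂ) = ((x ^ b : ℝ) : ℂ) * z ^ (b : ℂ) := by
  have hx0 : (x : ℂ) ≠ 0 := ofReal_ne_zero.2 hx.ne'
  rw [ofReal_cpow hx.le, cpow_def_of_ne_zero (mul_ne_zero hx0 hz), cpow_def_of_ne_zero hx0,
    cpow_def_of_ne_zero hz, log_ofReal_mul hx hz, ← exp_add, ofReal_log hx.le, add_mul]

lemma exists_rpow_le_mul_exp {b : ℝ} (hb : 0 ≤ b) :
    ∃ C : ℝ, 0 ≤ C ∧ ∀ x : ℝ, 0 ≤ x → x ^ b ≤ C * Real.exp (x / 8) := by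
  obtain ⟨J, hJ⟩ := exists_nat_ge b
  refine ⟨J.factorial * 8 ^ J * Real.exp (1 / 8), by positivity, fun x hx => ?_⟩
  have h1 : x ^ b ≤ (1 + x) ^ b := Real.rpow_le_rpow hx (by linarith) hb
  have h2 : (1 + x) ^ b ≤ (1 + x) ^ (J : ℝ) := Real.rpow_le_rpow_of_exponent_le (by linarith) hJ
  rw [Real.rpow_natCast] at h2
  have h3 := Real.pow_div_factorial_le_exp ((1 + x) / 8) (by positivity) J
  rw [div_le_iff₀ (by positivity), div_pow, div_le_iff₀ (by positivity), add_div, Real.exp_add] at h3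
  refine h1.trans (h2.trans (h3.trans (le_of_eq ?_)))
  ring

/-- The integrand of the loop integral for the Bessel function at `2 * r`. -/
noncomputable def besselIntegrand (b r : ℝ) (t : ℂ) : ℂ :=
  t ^ (b : ℂ) * exp (t + (r : ℂ) ^ 2 / t)

lemma norm_besselIntegrand (b r : ℝ) (t : ℂ) :
    ‖besselIntegrand b r t‖ = ‖t‖ ^ b * Real.exp (t.re + r ^ 2 * t.re / (t.re ^ 2 + t.im ^ 2)) := by
  rw [besselIntegrand, norm_mul, norm_cpow_real, Complex.norm_exp, add_re, ← ofReal_pow,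
    ofReal_div_re, inv_re, normSq_apply]
  congr 3
  ring

/-- The horizontal parts of the loop are exponentially small compared to `exp (2 * r)`. -/
lemma exists_norm_integral_besselIntegrand_le {b : ℝ} (hb : 0 ≤ b) :
    ∃ C : ℝ, 0 ≤ C ∧ ∀ r : ℝ, 0 < r → ∀ σ : ℝ, |σ| = r →
      ‖∫ s in Set.Iic r, besselIntegrand b r (s + σ * I)‖ ≤ C * Real.exp (7 * r / 4) := by
  obtain ⟨C, hC, hCb⟩ := exists_rpow_le_mul_exp hb
  refine ⟨C * (8 / 7), by positivity, fun r hr σ hσ => ?_⟩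
  have hσ2 : σ ^ 2 = r ^ 2 := by rw [← sq_abs, hσ]
  have hinteg : IntegrableOn (fun s : ℝ => C * Real.exp (7 * r / 8) * Real.exp (7 / 8 * s))
      (Set.Iic r) := (integrableOn_exp_mul_Iic (by norm_num) r).const_mul _
  refine (norm_integral_le_of_norm_le hinteg ((ae_restrict_iff' measurableSet_Iic).2
    (.of_forall fun s hs => ?_))).trans (le_of_eq ?_)
  · rw [norm_besselIntegrand]
    have hre : ((s : ℂ) + σ * I).re = s := by simp
    have him : ((s : ℂ) + σ * I).im = σ := by simp
    rw [hre, him, hσ2]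
    have h1 : ‖(s : ℂ) + σ * I‖ ≤ |s| + r := by
      refine (norm_le_abs_re_add_abs_im _).trans ?_
      rw [hre, him, hσ]
    have h2 := hCb _ (norm_nonneg ((s : ℂ) + σ * I))
    -- By 2rs ≤ r² + s², the term r²/t contributes at most r/2 to the exponent on the horizontal
    -- edges, against r at the saddle point.
    have h3 : r ^ 2 * s / (s ^ 2 + r ^ 2) ≤ r / 2 := by
      rw [div_le_iff₀ (by positivity)]
      nlinarith [mul_nonneg hr.le (sq_nonneg (s - r))]
    have h4 : |s| ≤ 2 * r - s := by
      have : s ≤ r := hs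
      exact abs_le.2 ⟨by linarith, by linarith⟩
    -- On the edge |t| ≤ 3r - s. Spending only |t|/8 on the power leaves the exponent 7r/8 + 7s/8,
    -- integrable at -∞ and equal to 7r/4 < 2r at s = r.
    calc ‖(s : ℂ) + σ * I‖ ^ b * Real.exp (s + r ^ 2 * s / (s ^ 2 + r ^ 2))
        ≤ C * Real.exp (‖(s : ℂ) + σ * I‖ / 8) * Real.exp (s + r ^ 2 * s / (s ^ 2 + r ^ 2)) := by
          gcongr
      _ ≤ C * Real.exp ((3 * r - s) / 8) * Real.exp (s + r / 2) := by
          gcongr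
          linarith
      _ = C * Real.exp (7 * r / 8) * Real.exp (7 / 8 * s) := by
          rw [mul_assoc, mul_assoc, ← Real.exp_add, ← Real.exp_add]
          congr 2
          ring
  · rw [integral_const_mul, integral_exp_mul_Iic (by norm_num),
      show 7 * r / 4 = 7 * r / 8 + 7 / 8 * r by ring, Real.exp_add]
    ring

/-- The vertical part of the loop integral. -/
noncomputable def besselVertical (b r : ℝ) : ℂ :=
  ∫ y in (-r)..r, besselIntegrand b r (r + y * I)

/-- The factor r^{1+b} undoes the prefactor (x/2)^ν for x = 2r, ν = -1 - b, and the i of the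
vertical direction cancels that of 1/(2πi). Only the horizontal edges remain. -/
lemma exists_besselI_sub_besselVertical_le {b : ℝ} (hb : 0 ≤ b) :
    ∃ C : ℝ, 0 ≤ C ∧ ∀ r : ℝ, 0 < r →
      ‖2 * Real.pi * ((r ^ (1 + b) : ℝ) : ℂ) * besselI (-1 - b) (2 * r) - besselVertical b r‖ ≤
        C * Real.exp (7 * r / 4) := by
  obtain ⟨C, hC, hCb⟩ := exists_norm_integral_besselIntegrand_le hb
  refine ⟨2 * C, by positivity, fun r hr => ?_⟩
  have h1 := hCb r hr (-r) (by rw [abs_neg, abs_of_pos hr])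
  have h2 := hCb r hr r (abs_of_pos hr)
  have hb1 : (-(-1 - b) - 1 : ℝ) = b := by ring
  have hr1 : 2 * r / 2 = r := by ring
  have hp : ((r ^ (1 + b) : ℝ) : ℂ) * ((r ^ (-1 - b) : ℝ) : ℂ) = 1 := by
    rw [← ofReal_mul, ← Real.rpow_add hr, show 1 + b + (-1 - b) = 0 by ring, Real.rpow_zero,
      ofReal_one]
  have hpi : (Real.pi : ℂ) ≠ 0 := ofReal_ne_zero.2 Real.pi_ne_zero
  have hI : I * I = -1 := I_mul_I
  have hF : (fun t : ℂ => t ^ ((-(-1 - b) - 1 : ℝ) : ℂ) * exp (t + ((2 * r / 2 : ℝ) : ℂ) ^ 2 / t)) =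
      besselIntegrand b r := by
    rw [hb1, hr1]
    rfl
  have hmain : 2 * Real.pi * ((r ^ (1 + b) : ℝ) : ℂ) * besselI (-1 - b) (2 * r) -
      besselVertical b r = -I * ((∫ s in Set.Iic r, besselIntegrand b r (s + ((-r : ℝ) : ℂ) * I)) -
        ∫ s in Set.Iic r, besselIntegrand b r (s + (r : ℂ) * I)) := by
    rw [besselI, hF, hr1, loopIntegral, besselVertical]
    have e1 (s : ℝ) : (s : ℂ) - r * I = s + ((-r : ℝ) : ℂ) * I := by push_cast; ring
    simp_rw [e1]
    generalize (∫ s in Set.Iic r, besselIntegrand b r (s + ((-r : ℝ) : ℂ) * I)) = A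
    generalize (∫ s in Set.Iic r, besselIntegrand b r (s + (r : ℂ) * I)) = B
    generalize (∫ y in (-r)..r, besselIntegrand b r (r + y * I)) = V
    have e2 : 2 * Real.pi * ((r ^ (1 + b) : ℝ) : ℂ) *
        (((r ^ (-1 - b) : ℝ) : ℂ) / (2 * Real.pi * I) * (A + I * V - B)) =
        ((r ^ (1 + b) : ℝ) : ℂ) * ((r ^ (-1 - b) : ℝ) : ℂ) * (A + I * V - B) * I⁻¹ := by
      field_simp
    rw [e2, hp, inv_I]
    linear_combination (-V) * hI
  rw [hmain, norm_mul, norm_neg, norm_I, one_mul]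
  refine (norm_sub_le _ _).trans ?_
  linarith

/-- Substitution t = x(η + iy), with r = xη, so that r²/t = xη²/(η + iy) = c/(η + iy). -/
lemma integral_cpow_mul_exp_eq (b : ℝ) {x η c : ℝ} (hx : 0 < x) (hη : 0 < η)
    (hc : x * η ^ 2 = c) :
    ∫ y in (-η)..η, ((η : ℂ) + y * I) ^ (b : ℂ) *
        exp (x * ((η : ℂ) + y * I) + c / ((η : ℂ) + y * I)) =
      ((x ^ (-(1 + b)) : ℝ) : ℂ) * besselVertical b (x * η) := by
  have hx0 : (x : ℂ) ≠ 0 := ofReal_ne_zero.2 hx.ne'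
  have h := intervalIntegral.integral_comp_mul_left (a := -η) (b := η)
    (fun y : ℝ => besselIntegrand b (x * η) (((x * η : ℝ) : ℂ) + y * I)) hx.ne'
  have hpw : ((x ^ (-(1 + b)) : ℝ) : ℂ) * ((x ^ b : ℝ) : ℂ) * x = 1 := by
    rw [← ofReal_mul, ← ofReal_mul, ← Real.rpow_add hx, ← Real.rpow_add_one hx.ne',
      show -(1 + b) + b + 1 = 0 by ring, Real.rpow_zero, ofReal_one]
  have hpt (y : ℝ) : besselIntegrand b (x * η) (((x * η : ℝ) : ℂ) + ((x * y : ℝ) : ℂ) * I) =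
      ((x ^ b : ℝ) : ℂ) * (((η : ℂ) + y * I) ^ (b : ℂ) *
        exp (x * ((η : ℂ) + y * I) + c / ((η : ℂ) + y * I))) := by
    have hz : (η : ℂ) + y * I ≠ 0 := by
      intro h0
      have := congrArg re h0
      simp at this
      exact hη.ne' this
    have e1 : ((x * η : ℝ) : ℂ) + ((x * y : ℝ) : ℂ) * I = x * ((η : ℂ) + y * I) := by
      push_cast; ring
    rw [besselIntegrand, e1, ofReal_mul_cpow hx hz, mul_assoc]
    congr 4
    rw [← hc]
    push_cast
    field_simp
  simp_rw [hpt] at h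
  rw [intervalIntegral.integral_const_mul, mul_neg] at h
  have h' : besselVertical b (x * η) = x * (((x ^ b : ℝ) : ℂ) *
      ∫ y in (-η)..η, ((η : ℂ) + y * I) ^ (b : ℂ) *
        exp (x * ((η : ℂ) + y * I) + c / ((η : ℂ) + y * I))) := by
    rw [h, besselVertical, Complex.real_smul, ofReal_inv, mul_inv_cancel_left₀ hx0]
  rw [h']
  generalize (∫ y in (-η)..η, ((η : ℂ) + y * I) ^ (b : ℂ) *
        exp (x * ((η : ℂ) + y * I) + c / ((η : ℂ) + y * I))) = W
  linear_combination (-W) * hpw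

end Bessel

end ChiGenus

/-! ### Estimates on the minor and major arcs -/

namespace ChiGenus

open Complex MeasureTheory Filter Topology Asymptotics

section CircleMethod

lemma exists_exp_neg_div_le {δ : ℝ} (hδ : 0 < δ) (A : ℝ) :
    ∃ C : ℝ, 0 ≤ C ∧ ∀ η : ℝ, 0 < η → η ≤ 1 → Real.exp (-(δ / η)) ≤ C * η ^ A := by
  obtain ⟨J, hJ⟩ := exists_nat_ge A
  refine ⟨J.factorial * δ⁻¹ ^ J, by positivity, fun η hη hη1 => ?_⟩
  have h1 := exp_neg_le_pow J (div_pos hδ hη)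
  have h2 : η ^ (J : ℝ) ≤ η ^ A := Real.rpow_le_rpow_of_exponent_ge hη hη1 hJ
  rw [Real.rpow_natCast] at h2
  calc Real.exp (-(δ / η)) ≤ J.factorial * (δ / η)⁻¹ ^ J := h1
    _ = J.factorial * δ⁻¹ ^ J * η ^ J := by rw [inv_div, div_eq_inv_mul, mul_pow]; ring
    _ ≤ J.factorial * δ⁻¹ ^ J * η ^ A := by gcongr

lemma half_le_one_sub_exp_neg {η : ℝ} (hη : 0 < η) (hη1 : η ≤ 1) :
    η / 2 ≤ 1 - Real.exp (-η) := by
  have h1 := Real.add_one_le_exp η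
  have h2 : Real.exp (-η) * Real.exp η = 1 := by rw [← Real.exp_add]; simp
  have h3 := Real.exp_pos (-η)
  nlinarith

/-- The integrand of the circle method. -/
noncomputable def circleIntegrand (k : ℕ) (m : ℤ) (n : ℕ) (z : ℂ) : ℂ :=
  exp (z * ((n : ℂ) - (k : ℂ) / 24)) * fourierF k m z

/-- The factors e^{±kη/24} cancel and kπ²/(6η) = nη, so the exponent is 2nη - k/(10η). The constant
4096 is the square of 64, from 8/(η/2)³. -/
lemma norm_circleIntegrand_le (k : ℕ) (m : ℤ) (n : ℕ) {η y : ℝ} (hη : 0 < η) (hη1 : η ≤ 1)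
    (hn : (n : ℝ) * η ^ 2 = k * Real.pi ^ 2 / 6) (h1 : η ≤ |y|) (h2 : |y| ≤ Real.pi) :
    ‖circleIntegrand k m n (η + y * I)‖ ≤
      4096 * η⁻¹ ^ 6 * Real.exp (-((k / 10 : ℝ) / η)) * Real.exp (2 * (n * η)) := by
  have hre : ((η : ℂ) + y * I).re = η := by simp
  have him : ((η : ℂ) + y * I).im = y := by simp
  have hF := norm_fourierF_le k m (z := (η : ℂ) + y * I) (by rw [hre]; exact hη)
    (by rw [hre, him]; exact h1) (by rw [him]; exact h2)
  rw [hre] at hF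
  have hexp : ‖exp (((η : ℂ) + y * I) * ((n : ℂ) - (k : ℂ) / 24))‖ =
      Real.exp (η * (n - k / 24)) := by
    have : (n : ℂ) - (k : ℂ) / 24 = ((n - k / 24 : ℝ) : ℂ) := by push_cast; ring
    rw [Complex.norm_exp, this, re_mul_ofReal, hre]
  have hhalf := half_le_one_sub_exp_neg hη hη1
  have hpoly : (8 / (1 - Real.exp (-η)) ^ 3) ^ 2 ≤ 4096 * η⁻¹ ^ 6 := by
    have e1 : 8 / (1 - Real.exp (-η)) ^ 3 ≤ 8 / (η / 2) ^ 3 := by gcongr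
    have e0 : 0 ≤ 8 / (1 - Real.exp (-η)) ^ 3 := by
      have : 0 ≤ 1 - Real.exp (-η) := by linarith
      positivity
    calc (8 / (1 - Real.exp (-η)) ^ 3) ^ 2 ≤ (8 / (η / 2) ^ 3) ^ 2 := by gcongr
      _ = 4096 * η⁻¹ ^ 6 := by field_simp; norm_num
  rw [circleIntegrand, norm_mul, hexp]
  have harg : η * (n - k / 24) + k * η / 24 + k * ((Real.pi ^ 2 / 6 - 1 / 10) / η) =
      -((k / 10 : ℝ) / η) + 2 * (n * η) := by
    have : (k : ℝ) * (Real.pi ^ 2 / 6) / η = n * η := by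
      rw [div_eq_iff hη.ne']; linarith
    have e : (k : ℝ) * ((Real.pi ^ 2 / 6 - 1 / 10) / η) =
      k * (Real.pi ^ 2 / 6) / η - (k / 10 : ℝ) / η := by ring
    rw [e, this]
    ring
  calc Real.exp (η * (n - k / 24)) * ‖fourierF k m (η + y * I)‖
      ≤ Real.exp (η * (n - k / 24)) * (Real.exp (k * η / 24) *
        ((8 / (1 - Real.exp (-η)) ^ 3) ^ 2 * Real.exp (k * ((Real.pi ^ 2 / 6 - 1 / 10) / η)))) := by
        gcongr
    _ ≤ Real.exp (η * (n - k / 24)) * (Real.exp (k * η / 24) *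
        (4096 * η⁻¹ ^ 6 * Real.exp (k * ((Real.pi ^ 2 / 6 - 1 / 10) / η)))) := by gcongr
    _ = 4096 * η⁻¹ ^ 6 * Real.exp (η * (n - k / 24) + k * η / 24 +
        k * ((Real.pi ^ 2 / 6 - 1 / 10) / η)) := by rw [Real.exp_add, Real.exp_add]; ring
    _ = _ := by rw [harg, Real.exp_add]; ring

/-- The integrand whose integral over the major arc is a part of a Bessel function. -/
noncomputable def arcIntegrand (b : ℝ) (k n : ℕ) (z : ℂ) : ℂ :=
  z ^ (b : ℂ) * exp (n * z + ((k * Real.pi ^ 2 / 6 : ℝ) : ℂ) / z)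

lemma add_mul_I_ne_zero {η : ℝ} (hη : 0 < η) (y : ℝ) : (η : ℂ) + y * I ≠ 0 := by
  intro h0
  have := congrArg re h0
  simp at this
  exact hη.ne' this

lemma continuous_arcIntegrand (b : ℝ) (k n : ℕ) {η : ℝ} (hη : 0 < η) :
    Continuous fun y : ℝ => arcIntegrand b k n (η + y * I) := by
  unfold arcIntegrand
  have h1 : Continuous fun y : ℝ => (η : ℂ) + y * I := by fun_prop
  have h2 (y : ℝ) : (η : ℂ) + y * I ∈ slitPlane := Or.inl (by simpa using hη)
  refine (h1.cpow continuous_const h2).mul (continuous_exp.comp ?_)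
  exact (continuous_const.mul h1).add (continuous_const.div h1 (add_mul_I_ne_zero hη))

/-- With c = nη², the real part of nz + c/z on the line Re z = η is nη + cη/(η² + y²), which is
largest at y = 0. -/
lemma norm_exp_arc_le {k n : ℕ} {η : ℝ} (hη : 0 < η)
    (hn : (n : ℝ) * η ^ 2 = k * Real.pi ^ 2 / 6) (y : ℝ) :
    ‖exp (n * ((η : ℂ) + y * I) + ((k * Real.pi ^ 2 / 6 : ℝ) : ℂ) / ((η : ℂ) + y * I))‖ ≤
      Real.exp (2 * (n * η)) := by
  rw [Complex.norm_exp, Real.exp_le_exp, add_re, ofReal_div_re, inv_re, normSq_apply, ← hn]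
  have hre : ((η : ℂ) + y * I).re = η := by simp
  have him : ((η : ℂ) + y * I).im = y := by simp
  have e1 : ((n : ℂ) * ((η : ℂ) + y * I)).re = n * η := by simp
  rw [e1, hre, him]
  have e2 : (n : ℝ) * η ^ 2 * (η / (η * η + y * y)) ≤ n * η := by
    rw [mul_div_assoc', div_le_iff₀ (add_pos_of_pos_of_nonneg (mul_pos hη hη) (mul_self_nonneg y))]
    have : 0 ≤ (n : ℝ) * η * y ^ 2 := by positivity
    nlinarith
  linarith

lemma circleIntegrand_eq (k : ℕ) (m : ℤ) (n : ℕ) {z : ℂ} (hz : 0 < z.re) :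
    circleIntegrand k m n z = (((2 * Real.pi) ^ (-((k : ℝ) / 2)) : ℝ) : ℂ) *
      arcIntegrand (k / 2) k n z * (exp (-((k : ℂ) * z / 24)) * majorFactor k m z) := by
  have hz0 : z ≠ 0 := by rintro rfl; simp at hz
  have h1 : z / (2 * Real.pi) = (((2 * Real.pi)⁻¹ : ℝ) : ℂ) * z := by
    push_cast; ring
  have h2 : (k : ℂ) / 2 = ((k / 2 : ℝ) : ℂ) := by push_cast; ring
  have h3 : ((2 * Real.pi)⁻¹ : ℝ) ^ ((k : ℝ) / 2) = (2 * Real.pi) ^ (-((k : ℝ) / 2)) := by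
    rw [Real.inv_rpow Real.two_pi_pos.le, Real.rpow_neg Real.two_pi_pos.le]
  rw [circleIntegrand, fourierF_eq k m hz, h1, h2,
    ofReal_mul_cpow (inv_pos.2 Real.two_pi_pos) hz0, h3, arcIntegrand, exp_add, majorFactor,
    show z * ((n : ℂ) - (k : ℂ) / 24) = n * z + -((k : ℂ) * z / 24) by ring, exp_add,
    show (k : ℂ) * Real.pi ^ 2 / (6 * z) = ((k * Real.pi ^ 2 / 6 : ℝ) : ℂ) / z by
      push_cast; field_simp]
  ring

lemma arcIntegrand_add (b : ℝ) (ℓ k n : ℕ) {z : ℂ} (hz : z ≠ 0) :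
    arcIntegrand (ℓ + b) k n z = arcIntegrand b k n z * z ^ ℓ := by
  rw [arcIntegrand, arcIntegrand, ofReal_add, cpow_add _ _ hz, ofReal_natCast, cpow_natCast]
  ring

/-- The error term of the major arc. -/
lemma exists_major_arc_bound (k : ℕ) (m : ℤ) (N : ℕ) :
    ∃ C δ : ℝ, 0 ≤ C ∧ 0 < δ ∧ ∀ (n : ℕ) (η y : ℝ), 0 < η → η ≤ δ →
      (n : ℝ) * η ^ 2 = k * Real.pi ^ 2 / 6 → |y| ≤ η →
      ‖circleIntegrand k m n (η + y * I) - (((2 * Real.pi) ^ (-((k : ℝ) / 2)) : ℝ) : ℂ) *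
        ∑ ℓ ∈ Finset.Icc 1 N, (d m k ℓ : ℂ) * arcIntegrand (ℓ + (k : ℝ) / 2) k n (η + y * I)‖ ≤
        C * η ^ ((N : ℝ) + 1 + (k : ℝ) / 2) * Real.exp (2 * (n * η)) := by
  -- On |y| ≤ η one has |z| ≤ 2η = 2 Re z, hence the opening κ = 1/2, and the radius ε/3 below
  -- ensures |z| < ε.
  obtain ⟨C, hC, hO⟩ := (exp_mul_majorFactor_isBigO m k N (κ := 1 / 2) (by norm_num)).exists_pos
  rw [isBigOWith_iff, eventually_nhdsWithin_iff, Metric.eventually_nhds_iff] at hO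
  obtain ⟨ε, hε, hO⟩ := hO
  set P : ℝ := (2 * Real.pi) ^ (-((k : ℝ) / 2)) with hP
  have hP0 : 0 ≤ P := Real.rpow_nonneg Real.two_pi_pos.le _
  refine ⟨P * 2 ^ ((k : ℝ) / 2) * (C * 2 ^ (N + 1)), ε / 3, by positivity, by positivity, ?_⟩
  intro n η y hη hηδ hn hy
  set z : ℂ := (η : ℂ) + y * I with hz
  have hre : z.re = η := by simp [hz]
  have him : z.im = y := by simp [hz]
  have hz0 : z ≠ 0 := add_mul_I_ne_zero hη y
  have hnorm : ‖z‖ ≤ 2 * η := by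
    refine (norm_le_abs_re_add_abs_im _).trans ?_
    rw [hre, him, abs_of_pos hη]
    linarith
  have hb := hO (y := z) (by rw [dist_zero_right]; linarith)
    ⟨by rw [hre]; exact hη, by rw [hre]; linarith⟩
  have heq : circleIntegrand k m n z - (P : ℂ) *
      ∑ ℓ ∈ Finset.Icc 1 N, (d m k ℓ : ℂ) * arcIntegrand (ℓ + (k : ℝ) / 2) k n z =
      (P : ℂ) * arcIntegrand (k / 2) k n z * (exp (-((k : ℂ) * z / 24)) * majorFactor k m z -
        ∑ ℓ ∈ Finset.Icc 1 N, (d m k ℓ : ℂ) * z ^ ℓ) := by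
    rw [circleIntegrand_eq k m n (by rw [hre]; exact hη), mul_sub, Finset.mul_sum, Finset.mul_sum]
    congr 1
    refine Finset.sum_congr rfl fun ℓ _ => ?_
    rw [arcIntegrand_add _ _ _ _ hz0]
    ring
  rw [heq, norm_mul, norm_mul, norm_real, Real.norm_of_nonneg hP0]
  have harc : ‖arcIntegrand (k / 2) k n z‖ ≤
      2 ^ ((k : ℝ) / 2) * η ^ ((k : ℝ) / 2) * Real.exp (2 * (n * η)) := by
    rw [arcIntegrand, norm_mul, norm_cpow_real, ← Real.mul_rpow (by norm_num) hη.le]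
    exact mul_le_mul (Real.rpow_le_rpow (norm_nonneg _) hnorm (by positivity))
      (norm_exp_arc_le hη hn y) (norm_nonneg _) (by positivity)
  have hb2 : C * ‖z ^ (N + 1)‖ ≤ C * 2 ^ (N + 1) * η ^ (N + 1) := by
    rw [norm_pow, mul_assoc, ← mul_pow]
    gcongr
  have hpow : η ^ ((N : ℝ) + 1 + (k : ℝ) / 2) = η ^ (N + 1) * η ^ ((k : ℝ) / 2) := by
    rw [Real.rpow_add hη, ← Real.rpow_natCast η (N + 1)]
    push_cast
    ring
  rw [hpow]
  calc P * ‖arcIntegrand (k / 2) k n z‖ * _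
      ≤ P * (2 ^ ((k : ℝ) / 2) * η ^ ((k : ℝ) / 2) * Real.exp (2 * (n * η))) *
        (C * 2 ^ (N + 1) * η ^ (N + 1)) := by
        gcongr
        exact hb.trans hb2
    _ = _ := by ring

end CircleMethod

end ChiGenus

/-! ### Asymptotics of the coefficients -/

namespace ChiGenus

open Complex MeasureTheory Filter Topology Asymptotics

section CoefficientAsymptotics

variable {k : ℕ} {a : ℤ → ℕ → ℂ}

lemma natCast_pos_of_mul_sq {k n : ℕ} (hk : 1 ≤ k) {η : ℝ}
    (hn : (n : ℝ) * η ^ 2 = k * Real.pi ^ 2 / 6) : 1 ≤ n := by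
  rcases Nat.eq_zero_or_pos n with rfl | h
  · have h1 : (0 : ℝ) < k * Real.pi ^ 2 / 6 := by
      have : (0 : ℝ) < k := by exact_mod_cast hk
      have := Real.pi_pos
      positivity
    rw [← hn] at h1
    simp at h1
  · exact h

/-- The coefficient is the sum of the vertical parts of Bessel integrals, up to an error. -/
lemma IsCoeffs.exists_sub_besselVertical_le (hk : 1 ≤ k) (ha : IsCoeffs k a) (m : ℤ) (N : ℕ) :
    ∃ C δ : ℝ, 0 ≤ C ∧ 0 < δ ∧ ∀ (n : ℕ) (η : ℝ), 0 < η → η ≤ δ →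
      (n : ℝ) * η ^ 2 = k * Real.pi ^ 2 / 6 →
      ‖2 * Real.pi * a m n - (((2 * Real.pi) ^ (-((k : ℝ) / 2)) : ℝ) : ℂ) *
        ∑ ℓ ∈ Finset.Icc 1 N, (d m k ℓ : ℂ) * ((((n : ℝ) ^ (-(1 + (ℓ + (k : ℝ) / 2))) : ℝ) : ℂ) *
          besselVertical (ℓ + (k : ℝ) / 2) (n * η))‖ ≤
        C * η ^ ((N : ℝ) + 2 + (k : ℝ) / 2) * Real.exp (2 * (n * η)) := by
  obtain ⟨C₁, δ₁, hC₁, hδ₁, hmaj⟩ := exists_major_arc_bound k m N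
  have hk0 : (0 : ℝ) < k / 10 := by
    have : (0 : ℝ) < k := by exact_mod_cast hk
    positivity
  -- The extra 6 in the exponent absorbs the factor η⁻⁶ of the minor arc bound.
  obtain ⟨C₂, hC₂, hmin⟩ := exists_exp_neg_div_le hk0 ((N : ℝ) + 2 + (k : ℝ) / 2 + 6)
  have hpi := Real.pi_pos
  refine ⟨2 * (4096 * C₂ * Real.pi) + C₁ * 2, min δ₁ 1, by positivity, by positivity, ?_⟩
  intro n η hη hηδ hn
  have hη1 : η ≤ 1 := hηδ.trans (min_le_right _ _)
  have hηδ₁ : η ≤ δ₁ := hηδ.trans (min_le_left _ _)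
  have hn1 : 1 ≤ n := natCast_pos_of_mul_sq hk hn
  have hn0 : (0 : ℝ) < n := by exact_mod_cast hn1
  set P : ℝ := (2 * Real.pi) ^ (-((k : ℝ) / 2)) with hP
  set E := Real.exp (2 * (n * η)) with hE
  set B := η ^ ((N : ℝ) + 2 + (k : ℝ) / 2) with hB
  have hB0 : 0 < B := Real.rpow_pos_of_pos hη _
  have hE0 : 0 < E := Real.exp_pos _
  let Φ : ℝ → ℂ := fun y => circleIntegrand k m n (η + y * I)
  let T : ℝ → ℂ := fun y => (P : ℂ) *
    ∑ ℓ ∈ Finset.Icc 1 N, (d m k ℓ : ℂ) * arcIntegrand (ℓ + (k : ℝ) / 2) k n (η + y * I)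
  have hΦ : Continuous Φ := by
    refine Continuous.mul ?_ (ha.continuous_fourierF m hη)
    fun_prop
  have hTℓ (ℓ : ℕ) : Continuous fun y : ℝ =>
      (d m k ℓ : ℂ) * arcIntegrand (ℓ + (k : ℝ) / 2) k n (η + y * I) :=
    continuous_const.mul (continuous_arcIntegrand _ k n hη)
  have hT : Continuous T := continuous_const.mul (continuous_finsetSum _ fun ℓ _ => hTℓ ℓ)
  have hTint : ∫ y in (-η)..η, T y = (P : ℂ) * ∑ ℓ ∈ Finset.Icc 1 N, (d m k ℓ : ℂ) *
      ((((n : ℝ) ^ (-(1 + (ℓ + (k : ℝ) / 2))) : ℝ) : ℂ) *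
        besselVertical (ℓ + (k : ℝ) / 2) (n * η)) := by
    simp only [T]
    rw [intervalIntegral.integral_const_mul, intervalIntegral.integral_finsetSum
      fun ℓ _ => (hTℓ ℓ).intervalIntegrable _ _]
    congr 1
    refine Finset.sum_congr rfl fun ℓ _ => ?_
    rw [intervalIntegral.integral_const_mul, ← integral_cpow_mul_exp_eq _ hn0 hη hn]
    simp only [arcIntegrand, ofReal_natCast]
  have hsplit : 2 * Real.pi * a m n - ∫ y in (-η)..η, T y =
      (∫ y in (-Real.pi)..(-η), Φ y) + (∫ y in η..Real.pi, Φ y) +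
        ∫ y in (-η)..η, (Φ y - T y) := by
    rw [intervalIntegral.integral_sub (hΦ.intervalIntegrable _ _) (hT.intervalIntegrable _ _),
      ha.eq_integral m n hη]
    have h1 : ∫ y in (-Real.pi)..Real.pi, Φ y = (∫ y in (-Real.pi)..(-η), Φ y) +
        (∫ y in (-η)..η, Φ y) + ∫ y in η..Real.pi, Φ y := by
      rw [intervalIntegral.integral_add_adjacent_intervals (hΦ.intervalIntegrable _ _)
        (hΦ.intervalIntegrable _ _), intervalIntegral.integral_add_adjacent_intervals
        (hΦ.intervalIntegrable _ _) (hΦ.intervalIntegrable _ _)]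
    change (∫ y in (-Real.pi)..Real.pi, Φ y) - _ = _
    rw [h1]
    ring
  have hηpi : η ≤ Real.pi := hη1.trans (by linarith [Real.pi_gt_three])
  have hmin' (y : ℝ) (h1 : η ≤ |y|) (h2 : |y| ≤ Real.pi) : ‖Φ y‖ ≤ 4096 * C₂ * B * E := by
    refine (norm_circleIntegrand_le k m n hη hη1 hn h1 h2).trans ?_
    have h3 := hmin η hη hη1
    have h4 : η ^ ((N : ℝ) + 2 + (k : ℝ) / 2 + 6) = B * η ^ 6 := by
      rw [Real.rpow_add hη, hB]
      norm_cast
    rw [h4] at h3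
    calc 4096 * η⁻¹ ^ 6 * Real.exp (-((k / 10 : ℝ) / η)) * E
        ≤ 4096 * η⁻¹ ^ 6 * (C₂ * (B * η ^ 6)) * E := by gcongr
      _ = 4096 * C₂ * B * E := by field_simp
  have hI₁ : ‖∫ y in (-Real.pi)..(-η), Φ y‖ ≤ 4096 * C₂ * B * E * Real.pi := by
    have := intervalIntegral.norm_integral_le_of_norm_le_const (a := -Real.pi) (b := -η) (f := Φ)
      (C := 4096 * C₂ * B * E) fun y hy => by
        rw [Set.uIoc_of_le (by linarith)] at hy
        refine hmin' y ?_ ?_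
        · rw [abs_of_neg (by linarith [hy.2])]; linarith [hy.2]
        · rw [abs_of_neg (by linarith [hy.2])]; linarith [hy.1]
    refine this.trans ?_
    gcongr
    rw [abs_of_nonneg (by linarith)]
    linarith
  have hI₂ : ‖∫ y in η..Real.pi, Φ y‖ ≤ 4096 * C₂ * B * E * Real.pi := by
    have := intervalIntegral.norm_integral_le_of_norm_le_const (a := η) (b := Real.pi) (f := Φ)
      (C := 4096 * C₂ * B * E) fun y hy => by
        rw [Set.uIoc_of_le (by linarith)] at hy
        refine hmin' y ?_ ?_
        · rw [abs_of_pos (by linarith [hy.1])]; linarith [hy.1]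
        · rw [abs_of_pos (by linarith [hy.1])]; exact hy.2
    refine this.trans ?_
    gcongr
    rw [abs_of_nonneg (by linarith)]
    linarith
  have hI₃ : ‖∫ y in (-η)..η, (Φ y - T y)‖ ≤ C₁ * 2 * B * E := by
    have := intervalIntegral.norm_integral_le_of_norm_le_const (a := -η) (b := η)
      (f := fun y => Φ y - T y) (C := C₁ * η ^ ((N : ℝ) + 1 + (k : ℝ) / 2) * E) fun y hy => by
        rw [Set.uIoc_of_le (by linarith)] at hy
        exact hmaj n η y hη hηδ₁ hn (abs_le.2 ⟨hy.1.le, hy.2⟩)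
    refine this.trans (le_of_eq ?_)
    -- The length 2η of the major arc supplies the last power of η.
    have hBη : B = η ^ ((N : ℝ) + 1 + (k : ℝ) / 2) * η := by
      rw [← Real.rpow_add_one hη.ne', hB]
      congr 1
      ring
    rw [hBη, abs_of_nonneg (by linarith)]
    ring
  rw [← hTint, hsplit]
  refine (norm_add_le _ _).trans ((add_le_add (norm_add_le _ _) le_rfl).trans ?_)
  linarith

/-- The asymptotic expansion of the coefficients, in terms of the radius `η` of the major arc. -/
lemma IsCoeffs.exists_sub_besselI_le (hk : 1 ≤ k) (ha : IsCoeffs k a) (m : ℤ) (N : ℕ) :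
    ∃ C δ : ℝ, 0 ≤ C ∧ 0 < δ ∧ ∀ (n : ℕ) (η : ℝ), 0 < η → η ≤ δ →
      (n : ℝ) * η ^ 2 = k * Real.pi ^ 2 / 6 →
      ‖a m n - (((2 * Real.pi) ^ (-((k : ℝ) / 2)) : ℝ) : ℂ) *
        ∑ ℓ ∈ Finset.Icc 1 N, (d m k ℓ : ℂ) * (((η ^ (1 + (ℓ + (k : ℝ) / 2)) : ℝ) : ℂ) *
          besselI (-1 - (ℓ + (k : ℝ) / 2)) (2 * (n * η)))‖ ≤
        C * η ^ ((N : ℝ) + 2 + (k : ℝ) / 2) * Real.exp (2 * (n * η)) := by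
  obtain ⟨C₁, δ₁, hC₁, hδ₁, h₁⟩ := ha.exists_sub_besselVertical_le hk m N
  -- Since nη = kπ²/(6η), e^{7nη/4} = e^{2nη} e^{-nη/4} is smaller than e^{2nη} by the factor
  -- e^{-δ/η} with this δ, so the horizontal edges fit into the error term.
  have hc : (0 : ℝ) < k * Real.pi ^ 2 / 6 / 4 := by
    have : (0 : ℝ) < k := by exact_mod_cast hk
    have := Real.pi_pos
    positivity
  obtain ⟨C₂, hC₂, h₂⟩ := exists_exp_neg_div_le hc ((N : ℝ) + 2 + (k : ℝ) / 2)
  choose C₃ hC₃ h₃ using fun ℓ : ℕ =>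
    exists_besselI_sub_besselVertical_le (b := ℓ + (k : ℝ) / 2) (by positivity)
  set P : ℝ := (2 * Real.pi) ^ (-((k : ℝ) / 2)) with hP
  have hP0 : 0 ≤ P := Real.rpow_nonneg Real.two_pi_pos.le _
  refine ⟨C₁ + P * ∑ ℓ ∈ Finset.Icc 1 N, |d m k ℓ| * (C₃ ℓ * C₂), min δ₁ 1,
    add_nonneg hC₁ (mul_nonneg hP0 (Finset.sum_nonneg fun ℓ _ =>
      mul_nonneg (abs_nonneg _) (mul_nonneg (hC₃ ℓ) hC₂))), by positivity, ?_⟩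
  intro n η hη hηδ hn
  have hη1 : η ≤ 1 := hηδ.trans (min_le_right _ _)
  have hn1 : 1 ≤ n := natCast_pos_of_mul_sq hk hn
  have hn1' : (1 : ℝ) ≤ n := by exact_mod_cast hn1
  have hn0 : (0 : ℝ) < n := by linarith
  have hr : 0 < (n : ℝ) * η := by positivity
  have hV := h₁ n η hη (hηδ.trans (min_le_left _ _)) hn
  set E := Real.exp (2 * (n * η)) with hE
  set B := η ^ ((N : ℝ) + 2 + (k : ℝ) / 2) with hB
  have hB0 : 0 < B := Real.rpow_pos_of_pos hη _
  have hE0 : 0 < E := Real.exp_pos _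
  have hsmall : Real.exp (7 * (n * η) / 4) ≤ C₂ * (B * E) := by
    have h4 : k * Real.pi ^ 2 / 6 / 4 / η = n * η / 4 := by
      rw [← hn]; field_simp
    have h5 := h₂ η hη hη1
    rw [h4] at h5
    calc Real.exp (7 * (n * η) / 4) = Real.exp (-(n * η / 4)) * E := by
          rw [hE, ← Real.exp_add]; congr 1; ring
      _ ≤ C₂ * B * E := by gcongr
      _ = C₂ * (B * E) := by ring
  have hterm (ℓ : ℕ) : ‖(((n : ℝ) ^ (-(1 + (ℓ + (k : ℝ) / 2))) : ℝ) : ℂ) *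
      (2 * Real.pi * (((n * η) ^ (1 + (ℓ + (k : ℝ) / 2)) : ℝ) : ℂ) *
        besselI (-1 - (ℓ + (k : ℝ) / 2)) (2 * (n * η)) -
          besselVertical (ℓ + (k : ℝ) / 2) (n * η))‖ ≤ C₃ ℓ * C₂ * (B * E) := by
    rw [norm_mul, norm_real, Real.norm_of_nonneg (by positivity)]
    have h6 : (n : ℝ) ^ (-(1 + (ℓ + (k : ℝ) / 2))) ≤ 1 :=
      Real.rpow_le_one_of_one_le_of_nonpos hn1' (by rw [neg_nonpos]; positivity)
    have h7 := h₃ ℓ (n * η) hr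
    calc _ ≤ 1 * (C₃ ℓ * Real.exp (7 * (n * η) / 4)) :=
          mul_le_mul h6 h7 (norm_nonneg _) zero_le_one
      _ ≤ 1 * (C₃ ℓ * (C₂ * (B * E))) := by
          have := hC₃ ℓ
          gcongr
      _ = _ := by ring
  have hη' (ℓ : ℕ) : ((η ^ (1 + (ℓ + (k : ℝ) / 2)) : ℝ) : ℂ) =
      (((n : ℝ) ^ (-(1 + (ℓ + (k : ℝ) / 2))) : ℝ) : ℂ) *
        (((n * η) ^ (1 + (ℓ + (k : ℝ) / 2)) : ℝ) : ℂ) := by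
    rw [← ofReal_mul, Real.mul_rpow hn0.le hη.le, ← mul_assoc, ← Real.rpow_add hn0,
      neg_add_cancel, Real.rpow_zero, one_mul]
  have hdecomp : 2 * Real.pi * (a m n - (P : ℂ) *
        ∑ ℓ ∈ Finset.Icc 1 N, (d m k ℓ : ℂ) * (((η ^ (1 + (ℓ + (k : ℝ) / 2)) : ℝ) : ℂ) *
          besselI (-1 - (ℓ + (k : ℝ) / 2)) (2 * (n * η)))) =
      (2 * Real.pi * a m n - (P : ℂ) * ∑ ℓ ∈ Finset.Icc 1 N, (d m k ℓ : ℂ) *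
        ((((n : ℝ) ^ (-(1 + (ℓ + (k : ℝ) / 2))) : ℝ) : ℂ) *
          besselVertical (ℓ + (k : ℝ) / 2) (n * η))) -
      (P : ℂ) * ∑ ℓ ∈ Finset.Icc 1 N, (d m k ℓ : ℂ) *
        ((((n : ℝ) ^ (-(1 + (ℓ + (k : ℝ) / 2))) : ℝ) : ℂ) *
          (2 * Real.pi * (((n * η) ^ (1 + (ℓ + (k : ℝ) / 2)) : ℝ) : ℂ) *
            besselI (-1 - (ℓ + (k : ℝ) / 2)) (2 * (n * η)) -
              besselVertical (ℓ + (k : ℝ) / 2) (n * η))) := by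
    rw [mul_sub, sub_sub, ← mul_add, ← Finset.sum_add_distrib, mul_left_comm, Finset.mul_sum]
    congr 2
    refine Finset.sum_congr rfl fun ℓ _ => ?_
    rw [hη']
    ring
  have hsum : ‖(P : ℂ) * ∑ ℓ ∈ Finset.Icc 1 N, (d m k ℓ : ℂ) *
        ((((n : ℝ) ^ (-(1 + (ℓ + (k : ℝ) / 2))) : ℝ) : ℂ) *
          (2 * Real.pi * (((n * η) ^ (1 + (ℓ + (k : ℝ) / 2)) : ℝ) : ℂ) *
            besselI (-1 - (ℓ + (k : ℝ) / 2)) (2 * (n * η)) -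
              besselVertical (ℓ + (k : ℝ) / 2) (n * η)))‖ ≤
      P * (∑ ℓ ∈ Finset.Icc 1 N, |d m k ℓ| * (C₃ ℓ * C₂)) * (B * E) := by
    rw [norm_mul, norm_real, Real.norm_of_nonneg hP0, mul_assoc, Finset.sum_mul]
    refine mul_le_mul_of_nonneg_left (norm_sum_le_of_le _ fun ℓ _ => ?_) hP0
    rw [norm_mul, norm_real, Real.norm_eq_abs, mul_assoc |d m k ℓ|]
    exact mul_le_mul_of_nonneg_left (hterm ℓ) (abs_nonneg _)
  have hfin := (norm_sub_le _ _).trans (add_le_add hV hsum)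
  rw [← hdecomp, norm_mul] at hfin
  have h2pi : (1 : ℝ) ≤ ‖2 * (Real.pi : ℂ)‖ := by
    rw [norm_mul, norm_real, Real.norm_of_nonneg Real.pi_pos.le, Complex.norm_ofNat]
    linarith [Real.pi_gt_three]
  refine (le_mul_of_one_le_left (norm_nonneg _) h2pi).trans (hfin.trans (le_of_eq ?_))
  ring

end CoefficientAsymptotics

end ChiGenus

/-! ### Choice of the radius and conclusion -/

theorem theorem1p1 (k : ℕ) (hk : 1 ≤ k) :
    (∃! a : ℤ → ℕ → ℂ, ChiGenus.IsCoeffs k a) ∧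
    ∀ (m : ℤ) (N : ℕ),
      (∀ M : ℝ,
        (fun z : ℂ => Complex.exp (-((k : ℂ) * z / 24)) * ChiGenus.gMain m z -
            ∑ ℓ ∈ Finset.Icc 1 N, (ChiGenus.d m k ℓ : ℂ) * z ^ ℓ)
          =O[nhdsWithin 0 {z : ℂ | 0 < z.re ∧ |z.im| ≤ M * z.re}]
        (fun z : ℂ => z ^ (N + 1))) ∧
      ∀ a : ℤ → ℕ → ℂ, ChiGenus.IsCoeffs k a →
        (fun n : ℕ => a m n -
            (((2 * Real.pi) ^ (-((k : ℝ) / 2)) : ℝ) : ℂ) *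
              ∑ ℓ ∈ Finset.Icc 1 N,
                (ChiGenus.d m k ℓ : ℂ) *
                (((n : ℝ) ^ (-((2 + 2 * (ℓ : ℝ) + (k : ℝ)) / 4)) : ℝ) : ℂ) *
                (((Real.pi * Real.sqrt ((k : ℝ) / 6)) ^ (1 + (ℓ : ℝ) + (k : ℝ) / 2) : ℝ) : ℂ) *
                ChiGenus.besselI (-1 - (ℓ : ℝ) - (k : ℝ) / 2)
                  (Real.pi * Real.sqrt (2 * (k : ℝ) * (n : ℝ) / 3)))
          =O[Filter.atTop]
        (fun n : ℕ => (n : ℝ) ^ (-1 - (N : ℝ) / 2 - (k : ℝ) / 4) *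
          Real.exp (Real.pi * Real.sqrt (2 * (k : ℝ) * (n : ℝ) / 3))) := by
  refine ⟨ChiGenus.existsUnique_isCoeffs k, fun m N =>
    ⟨ChiGenus.exp_mul_gMain_isBigO m k N, fun a ha => ?_⟩⟩
  obtain ⟨C, δ, -, hδ, h⟩ := ha.exists_sub_besselI_le hk m N
  have hk0 : (0 : ℝ) < k := by exact_mod_cast hk
  -- The radius η = D n^{-1/2} solves n η² = kπ²/6. Then 2nη is the argument of the Bessel
  -- functions, and η^b = n^{-b/2} D^b converts powers of η into the stated powers of n and D.
  set D := Real.pi * Real.sqrt ((k : ℝ) / 6) with hD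
  have hD0 : 0 < D := mul_pos Real.pi_pos (Real.sqrt_pos.2 (by positivity))
  have hlim : Filter.Tendsto (fun n : ℕ => D * (n : ℝ) ^ (-(1 / 2 : ℝ))) Filter.atTop
      (nhds 0) := by
    have := ((tendsto_rpow_neg_atTop (show (0 : ℝ) < 1 / 2 by norm_num)).comp
      tendsto_natCast_atTop_atTop).const_mul D
    rwa [mul_zero] at this
  refine Asymptotics.IsBigO.of_bound (C * D ^ ((N : ℝ) + 2 + (k : ℝ) / 2)) ?_
  filter_upwards [hlim.eventually (ge_mem_nhds hδ), Filter.eventually_ge_atTop 1] with n hnδ hn1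
  have hn0 : (0 : ℝ) < n := by exact_mod_cast hn1
  have hη0 : 0 < D * (n : ℝ) ^ (-(1 / 2 : ℝ)) := mul_pos hD0 (Real.rpow_pos_of_pos hn0 _)
  have hsq : (n : ℝ) * (D * (n : ℝ) ^ (-(1 / 2 : ℝ))) ^ 2 = k * Real.pi ^ 2 / 6 := by
    rw [mul_pow, ← Real.rpow_mul_natCast hn0.le, hD, mul_pow, Real.sq_sqrt (by positivity),
      show -(1 / 2 : ℝ) * (2 : ℕ) = -1 by norm_num, Real.rpow_neg_one]
    field_simp
  have hx : 2 * ((n : ℝ) * (D * (n : ℝ) ^ (-(1 / 2 : ℝ)))) =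
      Real.pi * Real.sqrt (2 * (k : ℝ) * (n : ℝ) / 3) := by
    have h1 : (n : ℝ) * (n : ℝ) ^ (-(1 / 2 : ℝ)) = Real.sqrt n := by
      rw [Real.sqrt_eq_rpow, mul_comm, ← Real.rpow_add_one hn0.ne']
      norm_num
    have h2 : Real.sqrt (2 * (k : ℝ) * (n : ℝ) / 3) = 2 * (Real.sqrt ((k : ℝ) / 6) * Real.sqrt n) := by
      rw [← Real.sqrt_mul (by positivity), show (2 : ℝ) * (k : ℝ) * (n : ℝ) / 3 =
        2 ^ 2 * ((k : ℝ) / 6 * n) by ring, Real.sqrt_mul (by positivity),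
        Real.sqrt_sq (by norm_num)]
    rw [h2, ← h1, hD]
    ring
  have hpow (b : ℝ) : (D * (n : ℝ) ^ (-(1 / 2 : ℝ))) ^ b = (n : ℝ) ^ (-(b / 2)) * D ^ b := by
    rw [Real.mul_rpow hD0.le (Real.rpow_nonneg hn0.le _), ← Real.rpow_mul hn0.le, mul_comm]
    congr 2
    ring
  have hb := h n _ hη0 hnδ hsq
  rw [hx] at hb
  have hterm : ∀ ℓ ∈ Finset.Icc 1 N, (ChiGenus.d m k ℓ : ℂ) *
      ((((D * (n : ℝ) ^ (-(1 / 2 : ℝ))) ^ (1 + (ℓ + (k : ℝ) / 2)) : ℝ) : ℂ) *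
        ChiGenus.besselI (-1 - (ℓ + (k : ℝ) / 2))
          (Real.pi * Real.sqrt (2 * (k : ℝ) * (n : ℝ) / 3))) =
      (ChiGenus.d m k ℓ : ℂ) * (((n : ℝ) ^ (-((2 + 2 * (ℓ : ℝ) + (k : ℝ)) / 4)) : ℝ) : ℂ) *
        ((D ^ (1 + (ℓ : ℝ) + (k : ℝ) / 2) : ℝ) : ℂ) *
          ChiGenus.besselI (-1 - (ℓ : ℝ) - (k : ℝ) / 2)
            (Real.pi * Real.sqrt (2 * (k : ℝ) * (n : ℝ) / 3)) := by
    intro ℓ _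
    rw [hpow, show -1 - (ℓ + (k : ℝ) / 2) = -1 - (ℓ : ℝ) - (k : ℝ) / 2 by ring,
      show 1 + (ℓ + (k : ℝ) / 2) = 1 + (ℓ : ℝ) + (k : ℝ) / 2 by ring,
      show (1 + (ℓ : ℝ) + (k : ℝ) / 2) / 2 = (2 + 2 * (ℓ : ℝ) + (k : ℝ)) / 4 by ring]
    push_cast
    ring
  rw [Finset.sum_congr rfl hterm, hpow,
    show -(((N : ℝ) + 2 + (k : ℝ) / 2) / 2) = -1 - (N : ℝ) / 2 - (k : ℝ) / 4 by ring] at hb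
  refine hb.trans (le_of_eq ?_)
  rw [Real.norm_of_nonneg (mul_nonneg (Real.rpow_nonneg hn0.le _) (Real.exp_pos _).le)]
  ring
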